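/- **Setting.** Let $d\ge 1$, let $\mathcal K$ be a complex Hilbert space, let $\mathcal F_b$ be the boson Fock space over $L^2(\mathbb R^d)$ and $\mathcal H=\mathcal K\otimes\mathcal F_b$. Inner products are antilinear in the first argument. For an operator $B$ on $\mathcal F_b$ (resp. $A$ on $\mathcal K$), $1\otimes B$ (resp. $A\otimes 1$) is the closure of the algebraic tensor product. $a(f)$ denotes the annihilation operator, $(a(f)\Psi)^{(n)}(k_1,\dots,k_n)=\sqrt{n+1}\int \overline{f(k)}\,\Psi^{(n+1)}(k,k_1,\dots,k_n)\,dk$, and $H_b=d\Gamma(\omega)$ acts on $n$-boson components as multiplication by $\sum_i\omega(k_i)$. For operators $X,Y$ put $[X,Y]^0\langle\Phi,\Psi\rangle=\langle X^*\Phi,Y\Psi\rangle-\langle Y^*\Phi,X\Psi\rangle$. For an operator $X$ on $L^2(\mathbb R^d)$, $\Gamma(X)=\bigoplus_{n\ge0}\otimes^nX$. **Assumptions.** 1. $K$ is a self-adjoint operator on $\mathcal K$, bounded from below. 2. $\omega:\mathbb R^d\to\mathbb R$ is continuous, $\inf_k\omega(k)=0$, $\omega(k)\to\infty$ as $|k|\to\infty$,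 and $\omega(k)>0$ for almost every $k$. 3. $H_I$ is a symmetric operator on $\mathcal H$; $H_0=K\otimes1+1\otimes H_b$; and $H=H_0+H_I$ (operator sums with their natural domains) is self-adjoint and bounded from below. 4. $G:\mathbb R^d\to\mathcal L(\mathcal H)$ takes values in the bounded operators, and for all $\Phi,\Psi\in D(H)$ and all $f\in L^2(\mathbb R^d)$ with $f/\sqrt\omega\in L^2(\mathbb R^d)$, $$[H_I,1\otimes a(f)]^0\langle\Phi,\Psi\rangle=\int_{\mathbb R^d}\overline{f(k)}\,\langle\Phi,G(k)\Psi\rangle\,dk .$$ There are $\zeta_l,\tau_l\ge0$ $(l=0,1)$ with $\int\omega(k)^{-2l}\|G(k)\Psi\|^2dk\le\zeta_l\|H\Psi\|^2+\tau_l\|\Psi\|^2$ for all $\Psi\in D(H)$. 5. There is a countable set $I_0\subset\mathbb R^d$ such that $\omega$ is differentiable at every point of $\mathbb R^d\setminus I_0$, with derivative continuous on $\mathbb R^d\setminus I_0$, and $\sup_{k\notin I_0}|\partial_{k_j}\omega(k)|<\infty$ for $j=1,\dots,d$. 6. There are $\mu_0,\nu_0\ge0$ with $\int\frac{|\partial_{k_j}\omega(k)|^2}{\omega(k)^4}\|G(k)\Psi\|^2dk\le\mu_0\|H\Psi\|^2+\nu_0\|\Psi\|^2$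 for all $\Psi\in D(H)$ and $j=1,\dots,d$. 7. There is a countable set $J_0\subset\mathbb R^d$ such that $G$ is strongly differentiable at every point of $\mathbb R^d\setminus J_0$; if $d=1$, $G$ is moreover strongly continuous at those points $k\in J_0$ where $\omega(k)>0$. There are $\mu_j,\nu_j\ge0$ $(j=1,\dots,d)$ with $\int\frac{1}{\omega(k)^2}\|\partial_{k_j}G(k)\Psi\|^2dk\le\mu_j\|H\Psi\|^2+\nu_j\|\Psi\|^2$ for all $\Psi\in D(H)$. Let $E_0=\inf\sigma(H)$ and let $\Omega\in D(H)$ be a normalized ground state: $H\Omega=E_0\Omega$, $\|\Omega\|=1$. Put $$c_1=E_0^2\zeta_1+\tau_1,\qquad \xi_j=2\big((\mu_0+\mu_j)E_0^2+\nu_0+\nu_j\big),\qquad c_2=(d+1)^{1/4}\Big(c_1^{1/2}+c_1^{1/4}\big(\textstyle\sum_{j=1}^d\xi_j\big)^{1/4}\Big).$$ Let $\chi\in C_0^\infty(\mathbb R^d)$ satisfy $0\le\chi\le1$ and $\chi(k)=1$ for $|k|\le1$, and let $\chi_R(k)=\chi(k/R)$. **Conclusion.** For every $R>0$, $$\big\|1\otimes\big(1-\Gamma(\chi_R(-i\nabla_k))\big)\Omega\big\|^2\le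 c_1^{1/2}\Big(\frac{d+1}{R^4}\,c_1+\frac{d+1}{R^2}\sum_{j=1}^d\xi_j\Big)^{1/2},$$ and for every $R\ge1$, $$\big\|1\otimes\big(1-\Gamma(\chi_R(-i\nabla_k))\big)\Omega\big\|\le\frac{c_2}{\sqrt R}.$$ -/

import Mathlib

open MeasureTheory Filter Topology
open scoped ENNReal TensorProduct ComplexConjugate LinearPMap

noncomputable section

namespace BoseField

/-! ### Unbounded operators -/

section Operators

variable {E : Type*} [NormedAddCommGroup E] [InnerProductSpace ℂ E]

/-- The identity operator, as an everywhere defined (partial) operator. -/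
def idOp (E : Type*) [NormedAddCommGroup E] [InnerProductSpace ℂ E] : E →ₗ.[ℂ] E :=
  LinearMap.id.toPMap ⊤

/-- `T` is symmetric: `⟪T x, y⟫ = ⟪x, T y⟫` on its domain. -/
def IsSymmetricOp (T : E →ₗ.[ℂ] E) : Prop :=
  ∀ x y : T.domain, inner ℂ (T x) (y : E) = inner ℂ (x : E) (T y)

/-- `T` is bounded from below: `⟪x, T x⟫ ≥ m ‖x‖²` for some real `m`. -/
def IsBoundedBelowOp (T : E →ₗ.[ℂ] E) : Prop :=
  ∃ m : ℝ, ∀ x : T.domain, m * ‖(x : E)‖ ^ 2 ≤ (inner ℂ (x : E) (T x)).re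

/-- The resolvent set of an unbounded operator: all `z` for which `T - z` is a bijection from the
domain of `T` onto the space, with bounded inverse `S`. -/
def resolventSetOp (T : E →ₗ.[ℂ] E) : Set ℂ :=
  {z | ∃ S : E →L[ℂ] E,
    (∀ x : E, ∃ h : S x ∈ T.domain, T ⟨S x, h⟩ - z • S x = x) ∧
    (∀ x : T.domain, S (T x - z • (x : E)) = x)}

/-- The spectrum of an unbounded operator. -/
def spectrumOp (T : E →ₗ.[ℂ] E) : Set ℂ := (resolventSetOp T)ᶜ

/-- The infimum of the (real) spectrum, for operators whose spectrum is real and bounded below. -/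
def groundEnergy (T : E →ₗ.[ℂ] E) : ℝ := sInf {x : ℝ | (x : ℂ) ∈ spectrumOp T}

/-- The weak commutator `⟪X* Φ, Y Ψ⟫ - ⟪Y* Φ, X Ψ⟫`, defined for `Φ ∈ D(X*) ∩ D(Y*)` and
`Ψ ∈ D(X) ∩ D(Y)`. -/
def weakCommutator [CompleteSpace E] (X Y : E →ₗ.[ℂ] E)
    (Φ : ↥(X†.domain ⊓ Y†.domain)) (Ψ : ↥(X.domain ⊓ Y.domain)) : ℂ :=
  inner ℂ (X† ⟨Φ, Φ.2.1⟩) (Y ⟨Ψ, Ψ.2.2⟩) - inner ℂ (Y† ⟨Φ, Φ.2.2⟩) (X ⟨Ψ, Ψ.2.1⟩)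

end Operators

section Tensor

variable (E F : Type*) [NormedAddCommGroup E] [InnerProductSpace ℂ E]
  [NormedAddCommGroup F] [InnerProductSpace ℂ F]

/-- The Hilbert space tensor product: the completion of the algebraic tensor product with respect
to the inner product determined by `⟪u ⊗ v, u' ⊗ v'⟫ = ⟪u, u'⟫ ⟪v, v'⟫`. -/
def HilbertTensor : Type _ := UniformSpace.Completion (E ⊗[ℂ] F)

instance : NormedAddCommGroup (HilbertTensor E F) :=
  inferInstanceAs (NormedAddCommGroup (UniformSpace.Completion (E ⊗[ℂ] F)))

instance : InnerProductSpace ℂ (HilbertTensor E F) :=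
  inferInstanceAs (InnerProductSpace ℂ (UniformSpace.Completion (E ⊗[ℂ] F)))

instance : CompleteSpace (HilbertTensor E F) :=
  inferInstanceAs (CompleteSpace (UniformSpace.Completion (E ⊗[ℂ] F)))

variable {E F}

/-- The simple tensor `u ⊗ v` in the Hilbert space tensor product. -/
def pureTensor (u : E) (v : F) : HilbertTensor E F :=
  ((u ⊗ₜ[ℂ] v : E ⊗[ℂ] F) : UniformSpace.Completion (E ⊗[ℂ] F))

/-- The tensor product `A ⊗ B` of two densely defined closable operators: the closure of the
algebraic tensor product, i.e. the operator whose graph is the closure of the span of the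
pairs `(u ⊗ v, A u ⊗ B v)`, `u ∈ D(A)`, `v ∈ D(B)`. -/
def tensorOp (A : E →ₗ.[ℂ] E) (B : F →ₗ.[ℂ] F) : HilbertTensor E F →ₗ.[ℂ] HilbertTensor E F :=
  (Submodule.span ℂ {p : HilbertTensor E F × HilbertTensor E F |
    ∃ (u : A.domain) (v : B.domain), p = (pureTensor (u : E) (v : F), pureTensor (A u) (B v))}
    ).topologicalClosure.toLinearPMap

end Tensor

/-! ### The boson Fock space over `L²(ℝᵈ)` -/

/-- `ℝᵈ` with its Euclidean structure. -/
abbrev Momentum (d : ℕ) := EuclideanSpace ℝ (Fin d)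

/-- The one-boson space `L²(ℝᵈ)`. -/
abbrev OneBoson (d : ℕ) := Lp ℂ 2 (volume : Measure (Momentum d))

/-- `L²((ℝᵈ)ⁿ)`, i.e. the `n`-fold Hilbert space tensor power of `L²(ℝᵈ)`. -/
abbrev NBoson (d n : ℕ) := Lp ℂ 2 (volume : Measure (Fin n → Momentum d))

/-- The full Fock space `⨁ₙ L²((ℝᵈ)ⁿ)` (Hilbert space direct sum). -/
abbrev FullFock (d : ℕ) := lp (fun n : ℕ => NBoson d n) 2

theorem quasiMeasurePreserving_perm {d n : ℕ} (σ : Equiv.Perm (Fin n)) :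
    Measure.QuasiMeasurePreserving (fun k : Fin n → Momentum d => k ∘ σ) volume volume := by
  have h := (volume_measurePreserving_piCongrLeft (fun _ : Fin n => Momentum d) σ⁻¹)
  have e : (fun k : Fin n → Momentum d => k ∘ σ)
      = MeasurableEquiv.piCongrLeft (fun _ : Fin n => Momentum d) σ⁻¹ := by
    funext k
    funext i
    have := MeasurableEquiv.piCongrLeft_apply_apply (β := fun _ : Fin n => Momentum d) (e := σ⁻¹)
      k (σ i)
    simpa using this.symm
  rw [e]
  exact h.quasiMeasurePreserving

/-- The vectors of the full Fock space all of whose components are symmetric functions. -/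
def symmetricSubspace (d : ℕ) : Submodule ℂ (FullFock d) where
  carrier := {Ψ | ∀ (n : ℕ) (σ : Equiv.Perm (Fin n)),
    (fun k => (Ψ n : NBoson d n) (k ∘ σ)) =ᵐ[volume] (Ψ n : NBoson d n)}
  zero_mem' := by
    intro n σ
    have h0 := Lp.coeFn_zero ℂ 2 (volume : Measure (Fin n → Momentum d))
    have h1 := (quasiMeasurePreserving_perm (d := d) σ).ae_eq_comp h0
    filter_upwards [h0, h1] with k a b
    simp only [lp.coeFn_zero, Pi.zero_apply, Function.comp_apply] at a b ⊢
    rw [a, b]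
  add_mem' := by
    intro Ψ Φ hΨ hΦ n σ
    have h0 := Lp.coeFn_add (Ψ n) (Φ n)
    have h1 := (quasiMeasurePreserving_perm (d := d) σ).ae_eq_comp h0
    filter_upwards [h0, h1, hΨ n σ, hΦ n σ] with k a b c e
    simp only [lp.coeFn_add, Pi.add_apply, Function.comp_apply] at a b ⊢
    rw [a, b, c, e]
  smul_mem' := by
    intro z Ψ hΨ n σ
    have h0 := Lp.coeFn_smul z (Ψ n)
    have h1 := (quasiMeasurePreserving_perm (d := d) σ).ae_eq_comp h0
    filter_upwards [h0, h1, hΨ n σ] with k a b c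
    simp only [lp.coeFn_smul, Pi.smul_apply, Function.comp_apply] at a b ⊢
    rw [a, b, c]

/-- The boson Fock space over `L²(ℝᵈ)`. -/
def BoseFock (d : ℕ) : Type := symmetricSubspace d

instance (d : ℕ) : NormedAddCommGroup (BoseFock d) :=
  inferInstanceAs (NormedAddCommGroup (symmetricSubspace d))

instance (d : ℕ) : InnerProductSpace ℂ (BoseFock d) :=
  inferInstanceAs (InnerProductSpace ℂ (symmetricSubspace d))

/-- The `n`-boson component `Ψ⁽ⁿ⁾` of a Fock space vector `Ψ`. -/
def component (d n : ℕ) : BoseFock d →ₗ[ℂ] NBoson d n where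
  toFun Ψ := (Subtype.val (p := fun x => x ∈ symmetricSubspace d) Ψ : FullFock d) n
  map_add' _ _ := rfl
  map_smul' _ _ := rfl

/-- The graph of the second quantization `dΓ(ω)` of multiplication by `ω`:
`(dΓ(ω) Ψ)⁽ⁿ⁾(k₁, …, kₙ) = (ω(k₁) + ⋯ + ω(kₙ)) Ψ⁽ⁿ⁾(k₁, …, kₙ)`, on its maximal domain. -/
def fieldEnergyGraph {d : ℕ} (ω : Momentum d → ℝ) : Submodule ℂ (BoseFock d × BoseFock d) where
  carrier := {p | ∀ n : ℕ, ∀ᵐ k : Fin n → Momentum d,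
    component d n p.2 k = ((∑ i, ω (k i) : ℝ) : ℂ) * component d n p.1 k}
  zero_mem' := by
    intro n
    filter_upwards [Lp.coeFn_zero ℂ 2 (volume : Measure (Fin n → Momentum d))] with k a
    simp only [Prod.fst_zero, Prod.snd_zero, map_zero]
    rw [a]
    simp
  add_mem' := by
    intro p q hp hq n
    filter_upwards [hp n, hq n, Lp.coeFn_add (component d n p.1) (component d n q.1),
      Lp.coeFn_add (component d n p.2) (component d n q.2)] with k a b c e
    simp only [Prod.fst_add, Prod.snd_add, map_add]
    rw [c, e, Pi.add_apply, Pi.add_apply, a, b, mul_add]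
  smul_mem' := by
    intro z p hp n
    filter_upwards [hp n, Lp.coeFn_smul z (component d n p.1), Lp.coeFn_smul z (component d n p.2)] with k a c e
    simp only [Prod.smul_fst, Prod.smul_snd, map_smul]
    rw [c, e, Pi.smul_apply, Pi.smul_apply, a, smul_eq_mul, smul_eq_mul]
    ring

/-- The free field Hamiltonian `dΓ(ω)`. -/
def fieldEnergy {d : ℕ} (ω : Momentum d → ℝ) : BoseFock d →ₗ.[ℂ] BoseFock d :=
  (fieldEnergyGraph ω).toLinearPMap

theorem measurePreserving_cons (d n : ℕ) :
    MeasurePreserving (fun p : (Fin n → Momentum d) × Momentum d =>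
      (Fin.cons p.2 p.1 : Fin (n + 1) → Momentum d))
      ((volume : Measure (Fin n → Momentum d)).prod volume) volume := by
  have h := ((volume_preserving_piFinSuccAbove (fun _ : Fin (n + 1) => Momentum d) 0).symm _).comp
    (Measure.measurePreserving_swap (μ := (volume : Measure (Fin n → Momentum d)))
      (ν := (volume : Measure (Momentum d))))
  have e : (fun p : (Fin n → Momentum d) × Momentum d =>
      (Fin.cons p.2 p.1 : Fin (n + 1) → Momentum d))
      = (MeasurableEquiv.piFinSuccAbove (fun _ : Fin (n + 1) => Momentum d) 0).symm ∘ Prod.swap := by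
    funext p
    simp [MeasurableEquiv.piFinSuccAbove, Fin.insertNthEquiv]
  rw [e]
  exact h

theorem ae_ae_cons {d n : ℕ} {P : (Fin (n + 1) → Momentum d) → Prop} (h : ∀ᵐ x, P x) :
    ∀ᵐ k : Fin n → Momentum d, ∀ᵐ q : Momentum d, P (Fin.cons q k) :=
  Measure.ae_ae_of_ae_prod ((measurePreserving_cons d n).quasiMeasurePreserving.ae h)

theorem integrable_annihilation {d n : ℕ} (f : OneBoson d) (Ψ : NBoson d (n + 1)) :
    ∀ᵐ k : Fin n → Momentum d, Integrable
      (fun q : Momentum d => conj (f q) * Ψ (Fin.cons q k : Fin (n + 1) → Momentum d)) := by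
  have h1 : MemLp (fun p : (Fin n → Momentum d) × Momentum d =>
      Ψ (Fin.cons p.2 p.1 : Fin (n + 1) → Momentum d)) 2
      ((volume : Measure (Fin n → Momentum d)).prod volume) :=
    (Lp.memLp Ψ).comp_measurePreserving (measurePreserving_cons d n)
  have h2 := (memLp_two_iff_integrable_sq_norm h1.1).1 h1
  filter_upwards [h2.prod_right_ae, h1.1.prodMk_left] with k a b
  have h3 : MemLp (fun q : Momentum d => Ψ (Fin.cons q k : Fin (n + 1) → Momentum d)) 2 :=
    (memLp_two_iff_integrable_sq_norm b).2 a
  have h4 : MemLp (fun q : Momentum d => conj (f q)) 2 := (Lp.memLp f).star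
  exact h4.integrable_mul h3

/-- The graph of the annihilation operator `a(f)`:
`(a(f) Ψ)⁽ⁿ⁾(k₁, …, kₙ) = √(n+1) ∫ conj f(q) Ψ⁽ⁿ⁺¹⁾(q, k₁, …, kₙ) dq`, on its maximal domain. -/
def annihilationGraph {d : ℕ} (f : OneBoson d) : Submodule ℂ (BoseFock d × BoseFock d) where
  carrier := {p | ∀ n : ℕ, ∀ᵐ k : Fin n → Momentum d,
    component d n p.2 k = (Real.sqrt (n + 1) : ℂ) * ∫ q : Momentum d,
      conj (f q) * component d (n + 1) p.1 (Fin.cons q k : Fin (n + 1) → Momentum d)}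
  zero_mem' := by
    intro n
    filter_upwards [Lp.coeFn_zero ℂ 2 (volume : Measure (Fin n → Momentum d)),
      ae_ae_cons (Lp.coeFn_zero ℂ 2 (volume : Measure (Fin (n + 1) → Momentum d)))] with k a b
    simp only [Prod.fst_zero, Prod.snd_zero, map_zero]
    rw [a, integral_eq_zero_of_ae]
    · simp
    · filter_upwards [b] with q c
      rw [c]
      simp
  add_mem' := by
    intro p q hp hq n
    filter_upwards [hp n, hq n, Lp.coeFn_add (component d n p.2) (component d n q.2),
      ae_ae_cons (Lp.coeFn_add (component d (n + 1) p.1) (component d (n + 1) q.1)),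
      integrable_annihilation f (component d (n + 1) p.1),
      integrable_annihilation f (component d (n + 1) q.1)] with k a b c e i j
    simp only [Prod.fst_add, Prod.snd_add, map_add]
    rw [c, Pi.add_apply, a, b, ← mul_add, ← integral_add i j]
    congr 1
    apply integral_congr_ae
    filter_upwards [e] with x hx
    rw [hx, Pi.add_apply, mul_add]
  smul_mem' := by
    intro z p hp n
    filter_upwards [hp n, Lp.coeFn_smul z (component d n p.2),
      ae_ae_cons (Lp.coeFn_smul z (component d (n + 1) p.1))] with k a c e
    simp only [Prod.smul_fst, Prod.smul_snd, map_smul]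
    rw [c, Pi.smul_apply, a, smul_eq_mul, mul_left_comm, ← integral_const_mul]
    congr 1
    apply integral_congr_ae
    filter_upwards [e] with x hx
    rw [hx, Pi.smul_apply, smul_eq_mul]
    ring

/-- The annihilation operator `a(f)`, antilinear in `f`. -/
def annihilation {d : ℕ} (f : OneBoson d) : BoseFock d →ₗ.[ℂ] BoseFock d :=
  (annihilationGraph f).toLinearPMap

/-- The graph of `⊗ⁿ X` on `L²((ℝᵈ)ⁿ)`: the closure of the span of the pairs
`(f₁ ⊗ ⋯ ⊗ fₙ, X f₁ ⊗ ⋯ ⊗ X fₙ)`, where `f₁ ⊗ ⋯ ⊗ fₙ` is the function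
`(k₁, …, kₙ) ↦ f₁(k₁) ⋯ fₙ(kₙ)`. -/
def tensorPowerGraph {d : ℕ} (X : OneBoson d →ₗ.[ℂ] OneBoson d) (n : ℕ) :
    Submodule ℂ (NBoson d n × NBoson d n) :=
  (Submodule.span ℂ {p : NBoson d n × NBoson d n | ∃ f : Fin n → X.domain,
    (p.1 =ᵐ[volume] fun k => ∏ i, (f i : OneBoson d) (k i)) ∧
    (p.2 =ᵐ[volume] fun k => ∏ i, (X (f i)) (k i))}).topologicalClosure

/-- `Γ(X) = ⨁ₙ ⊗ⁿ X` on the boson Fock space: `Φ = Γ(X) Ψ` iff `Φ⁽ⁿ⁾ = (⊗ⁿ X) Ψ⁽ⁿ⁾` for all `n`. -/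
def Gam {d : ℕ} (X : OneBoson d →ₗ.[ℂ] OneBoson d) : BoseFock d →ₗ.[ℂ] BoseFock d :=
  (⨅ n : ℕ, (tensorPowerGraph X n).comap
    ((component d n).prodMap (component d n))).toLinearPMap

/-- The graph of the operator `m(-i∇)` on `L²(ℝᵈ)`, on its maximal domain. The Fourier transform is
normalized as `𝓕 f (p) = ∫ exp(-2πi⟨k, p⟩) f(k) dk`, so it carries `-i∇` to multiplication
by `2πp`. -/
def fourierMultiplierGraph {d : ℕ} (m : Momentum d → ℝ) :
    Submodule ℂ (OneBoson d × OneBoson d) where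
  carrier := {p | ∀ᵐ x : Momentum d, Lp.fourierTransformₗᵢ (Momentum d) ℂ p.2 x
    = (m ((2 * Real.pi) • x) : ℂ) * Lp.fourierTransformₗᵢ (Momentum d) ℂ p.1 x}
  zero_mem' := by
    filter_upwards [Lp.coeFn_zero ℂ 2 (volume : Measure (Momentum d))] with x a
    simp only [Prod.fst_zero, Prod.snd_zero, map_zero]
    rw [a]
    simp
  add_mem' := by
    intro p q hp hq
    filter_upwards [hp, hq,
      Lp.coeFn_add (Lp.fourierTransformₗᵢ (Momentum d) ℂ p.1)
        (Lp.fourierTransformₗᵢ (Momentum d) ℂ q.1),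
      Lp.coeFn_add (Lp.fourierTransformₗᵢ (Momentum d) ℂ p.2)
        (Lp.fourierTransformₗᵢ (Momentum d) ℂ q.2)] with x a b c e
    simp only [Prod.fst_add, Prod.snd_add, map_add]
    rw [c, e, Pi.add_apply, Pi.add_apply, a, b, mul_add]
  smul_mem' := by
    intro z p hp
    filter_upwards [hp, Lp.coeFn_smul z (Lp.fourierTransformₗᵢ (Momentum d) ℂ p.1),
      Lp.coeFn_smul z (Lp.fourierTransformₗᵢ (Momentum d) ℂ p.2)] with x a c e
    simp only [Prod.smul_fst, Prod.smul_snd, map_smul]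
    rw [c, e, Pi.smul_apply, Pi.smul_apply, a, smul_eq_mul, smul_eq_mul]
    ring

/-- The operator `m(-i∇)` on `L²(ℝᵈ)`. -/
def fourierMultiplier {d : ℕ} (m : Momentum d → ℝ) : OneBoson d →ₗ.[ℂ] OneBoson d :=
  (fourierMultiplierGraph m).toLinearPMap

/-! ### The interacting system -/

section System

variable (𝒦 : Type*) [NormedAddCommGroup 𝒦] [InnerProductSpace ℂ 𝒦]

/-- The state space `𝒦 ⊗ 𝓕_b`. -/
abbrev StateSpace (d : ℕ) := HilbertTensor 𝒦 (BoseFock d)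

/-- The operator `1 ⊗ B` on the state space. -/
def oneTensor {d : ℕ} (B : BoseFock d →ₗ.[ℂ] BoseFock d) :
    StateSpace 𝒦 d →ₗ.[ℂ] StateSpace 𝒦 d :=
  tensorOp (idOp 𝒦) B

variable {𝒦}

/-- The free Hamiltonian `H₀ = K ⊗ 1 + 1 ⊗ dΓ(ω)` with domain `D(K ⊗ 1) ∩ D(1 ⊗ dΓ(ω))`. -/
def freeHamiltonian {d : ℕ} (K : 𝒦 →ₗ.[ℂ] 𝒦) (ω : Momentum d → ℝ) :
    StateSpace 𝒦 d →ₗ.[ℂ] StateSpace 𝒦 d :=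
  tensorOp K (idOp (BoseFock d)) + oneTensor 𝒦 (fieldEnergy ω)

/-- The total Hamiltonian `H = H₀ + H_I` with domain `D(H₀) ∩ D(H_I)`. -/
def totalHamiltonian {d : ℕ} (K : 𝒦 →ₗ.[ℂ] 𝒦) (ω : Momentum d → ℝ)
    (HI : StateSpace 𝒦 d →ₗ.[ℂ] StateSpace 𝒦 d) : StateSpace 𝒦 d →ₗ.[ℂ] StateSpace 𝒦 d :=
  freeHamiltonian K ω + HI

/-- The operator `1 ⊗ (1 - Γ(χ_R(-i∇)))` with `χ_R(k) = χ(k / R)`. -/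
def momentumCutoffDefect (𝒦 : Type*) [NormedAddCommGroup 𝒦] [InnerProductSpace ℂ 𝒦] {d : ℕ}
    (χ : Momentum d → ℝ) (R : ℝ) : StateSpace 𝒦 d →ₗ.[ℂ] StateSpace 𝒦 d :=
  oneTensor 𝒦 (idOp (BoseFock d) - Gam (fourierMultiplier fun k => χ (R⁻¹ • k)))

/-- The partial derivative `∂_{k_j}` of a function on `ℝᵈ`. -/
def partialD {d : ℕ} {V : Type*} [NormedAddCommGroup V] [NormedSpace ℝ V] (j : Fin d)
    (g : Momentum d → V) (k : Momentum d) : V :=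
  fderiv ℝ g k (EuclideanSpace.single j 1)

end System

end BoseField

end

/-! Write `u(k) = a(k)Ω` for the one-boson field of the ground state and `p` for the variable dual
to `k`. In the Fourier picture `Γ(χ_R(-i∇))` multiplies by `∏ χ_R(p_i)`. The number `1 - ∏ χ_R(p_i)`
lies in `[0,1]` and vanishes unless some `|p_i|` exceeds `R`, so its square is at most the number of
such `i`. Hence the squared norm of the defect is at most `⟨Ω, dΓ(1_{|p|>R}) Ω⟩`, which is the
Fourier tail `∫_{|p|>R} ‖û(p)‖² dp`. By Plancherel and Chebyshev this tail is at most `∫ ‖u‖²` and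
also at most `R⁻² ∑_j ∫ ‖∂_j u‖²`.

The pull-through formula gives `u(k) = (H - E₀ + ω(k))⁻¹ G(k)Ω`. The resolvent has norm at most
`1/ω(k)`, because `H ≥ E₀` (`formBound_groundEnergy`), and its derivative in `ω` is minus its
square. The hypotheses on `G` and `ω` then yield `∫ ‖u‖² ≤ c₁` and `∫ ‖∂_j u‖² ≤ ξ_j`. Multiplying
the two bounds for the defect gives the first claim, and fourth roots give the second
(`rpow_bounds`).

Since `a(k)` is not an operator, the pull-through formula is proved in smeared form
(`annihilation_ground_eq_integral`): `a(f)Ω = ∫ conj f(k) u(k) dk` when `ω` is bounded and bounded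
away from `0` on the support of `f`. The commutator identity shows that the error `D(f)` of this
formula satisfies `(H - E₀) D(f) = -D(ωf)` weakly, hence `(H - E₀ + l) D(f) = D((l - ω)f)`.
Iterating the resulting contraction forces `D(f) = 0`. `oneBosonCoef_ae_eq` turns this into an
almost everywhere identity for the scalar coefficients of `u`, and `enorm_defect_sq_le` expresses
the defect through the Fourier tails of those coefficients.

The other delicate point is that `u` need not be differentiable on a countable set or at the zeros
of `ω`. In `integral_conj_partialD_mul` a cutoff in the variable `ω` removes the zeros; its error is
controlled because `(∂_j ω / ω) u` is square integrable, which is what the weight `|∂_j ω|²/ω⁴`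
provides. -/

noncomputable section

namespace BoseField

/-! ### Hilbert space tensor products -/

section HilbertTensorProducts

variable {E F E' F' : Type*} [NormedAddCommGroup E] [InnerProductSpace ℂ E]
  [NormedAddCommGroup F] [InnerProductSpace ℂ F]
  [NormedAddCommGroup E'] [InnerProductSpace ℂ E']
  [NormedAddCommGroup F'] [InnerProductSpace ℂ F']

/-- The bounded operator `A ⊗ B`. -/
def tmap (A : E →L[ℂ] E') (B : F →L[ℂ] F') : HilbertTensor E F →L[ℂ] HilbertTensor E' F' :=
  ContinuousLinearMap.completion (TensorProduct.mapL A B)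

theorem tmap_pureTensor (A : E →L[ℂ] E') (B : F →L[ℂ] F') (u : E) (v : F) :
    tmap A B (pureTensor u v) = pureTensor (A u) (B v) := by
  unfold tmap pureTensor
  erw [ContinuousLinearMap.completion_apply_coe]
  rfl

theorem inner_pureTensor (u u' : E) (v v' : F) :
    inner ℂ (pureTensor u v) (pureTensor u' v') = inner ℂ u u' * inner ℂ v v' := by
  unfold pureTensor
  erw [UniformSpace.Completion.inner_coe]
  simp

theorem norm_pureTensor (u : E) (v : F) : ‖pureTensor u v‖ = ‖u‖ * ‖v‖ := by
  unfold pureTensor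
  erw [UniformSpace.Completion.norm_coe]
  simp

/-- The bounded map `v ↦ u ⊗ v`. -/
def pureTensorL (u : E) : F →L[ℂ] HilbertTensor E F :=
  (UniformSpace.Completion.toComplL (𝕜 := ℂ) (E := E ⊗[ℂ] F)).comp (TensorProduct.mkL ℂ E F u)

@[simp]
theorem pureTensorL_apply (u : E) (v : F) : pureTensorL u v = pureTensor u v := rfl

/-- The bounded map `u ↦ u ⊗ v`. -/
def pureTensorR (v : F) : E →L[ℂ] HilbertTensor E F :=
  (UniformSpace.Completion.toComplL (𝕜 := ℂ) (E := E ⊗[ℂ] F)).comp ((TensorProduct.mkL ℂ E F).flip v)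

theorem dense_span_pureTensor :
    (Submodule.span ℂ {x : HilbertTensor E F | ∃ u v, x = pureTensor u v}).topologicalClosure
      = ⊤ := by
  rw [← Submodule.dense_iff_topologicalClosure_eq_top]
  have h : DenseRange ((↑) : E ⊗[ℂ] F → UniformSpace.Completion (E ⊗[ℂ] F)) :=
    UniformSpace.Completion.denseRange_coe
  let J : E ⊗[ℂ] F →L[ℂ] HilbertTensor E F := UniformSpace.Completion.toComplL
  have hJ : ∀ t, J t ∈ Submodule.span ℂ {x : HilbertTensor E F | ∃ u v, x = pureTensor u v} := by
    intro t
    induction t using TensorProduct.induction_on with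
    | zero => rw [map_zero]; exact Submodule.zero_mem _
    | tmul u v => exact Submodule.subset_span ⟨u, v, rfl⟩
    | add a b ha hb => rw [map_add]; exact Submodule.add_mem _ ha hb
  refine h.mono ?_
  rintro _ ⟨t, rfl⟩
  exact hJ t

theorem eq_of_pureTensor {M : Type*} [AddCommMonoid M] [Module ℂ M] [TopologicalSpace M]
    [T2Space M] {S T : HilbertTensor E F →L[ℂ] M}
    (h : ∀ u v, S (pureTensor u v) = T (pureTensor u v)) : S = T := by
  ext x
  have hx : x ∈ (Submodule.span ℂ
      {x : HilbertTensor E F | ∃ u v, x = pureTensor u v}).topologicalClosure := by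
    rw [dense_span_pureTensor]; trivial
  have hs : (Submodule.span ℂ {x : HilbertTensor E F | ∃ u v, x = pureTensor u v} :
      Set (HilbertTensor E F)).EqOn S T := by
    apply LinearMap.eqOn_span (f := S.toLinearMap) (g := T.toLinearMap)
    rintro _ ⟨u, v, rfl⟩
    exact h u v
  exact hs.closure S.continuous T.continuous hx

/-- The closed graph that defines `A ⊗ B`. -/
def tensorGraph (A : E →ₗ.[ℂ] E) (B : F →ₗ.[ℂ] F) :
    Submodule ℂ (HilbertTensor E F × HilbertTensor E F) :=
  (Submodule.span ℂ {p : HilbertTensor E F × HilbertTensor E F |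
    ∃ (u : A.domain) (v : B.domain), p = (pureTensor (u : E) (v : F), pureTensor (A u) (B v))}
    ).topologicalClosure

theorem tensorOp_eq (A : E →ₗ.[ℂ] E) (B : F →ₗ.[ℂ] F) :
    tensorOp A B = (tensorGraph A B).toLinearPMap := rfl

variable [CompleteSpace F] [CompleteSpace F']

/-- The partial inner product `⟪v| : E ⊗ F → F`. -/
def slice (v : E) : HilbertTensor E F →L[ℂ] F :=
  ContinuousLinearMap.adjoint (pureTensorL v)

theorem inner_slice_right (v : E) (x : HilbertTensor E F) (φ : F) :
    inner ℂ φ (slice v x) = inner ℂ (pureTensor v φ) x := by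
  rw [slice, ContinuousLinearMap.adjoint_inner_right, pureTensorL_apply]

theorem slice_pureTensor (v u : E) (φ : F) :
    slice v (pureTensor u φ) = inner ℂ v u • φ := by
  refine ext_inner_left ℂ fun ψ => ?_
  rw [inner_slice_right, inner_pureTensor, inner_smul_right]

theorem slice_tmap (v : E) (B : F →L[ℂ] F') (x : HilbertTensor E F) :
    slice v (tmap (ContinuousLinearMap.id ℂ E) B x) = B (slice v x) := by
  have : (slice v).comp (tmap (ContinuousLinearMap.id ℂ E) B) = B.comp (slice v) := by
    apply eq_of_pureTensor
    intro u φ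
    simp [tmap_pureTensor, slice_pureTensor]
  exact DFunLike.congr_fun this x

/-- A basis of the first factor splits `E ⊗ F` into orthogonal copies of `F`. Operators of the form
`1 ⊗ B` are diagonal in this splitting, so every question about them reduces to slices in `F`. -/
theorem isHilbertSum_pureTensor {κ : Type*} (b : HilbertBasis κ ℂ E) :
    IsHilbertSum ℂ (fun _ : κ => F) (fun a =>
      (⟨(pureTensorL (b a) : F →L[ℂ] HilbertTensor E F).toLinearMap, fun φ => by
        simp [norm_pureTensor, b.orthonormal.1 a]⟩ : F →ₗᵢ[ℂ] HilbertTensor E F)) := by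
  refine IsHilbertSum.mk ?_ ?_
  · intro a a' haa φ ψ
    change inner ℂ (pureTensor (b a) φ) (pureTensor (b a') ψ) = 0
    rw [inner_pureTensor, b.orthonormal.2 haa, zero_mul]
  · rw [← dense_span_pureTensor]
    refine Submodule.topologicalClosure_minimal _ ?_ (Submodule.isClosed_topologicalClosure _)
    rw [Submodule.span_le]
    rintro _ ⟨u, v, rfl⟩
    have h := (b.hasSum_repr u).mapL (pureTensorR v : E →L[ℂ] HilbertTensor E F)
    refine mem_closure_of_tendsto h (Eventually.of_forall fun s => ?_)
    refine Submodule.sum_mem _ fun a _ => ?_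
    rw [map_smul]
    refine Submodule.smul_mem _ _ (Submodule.mem_iSup_of_mem a ?_)
    exact ⟨v, rfl⟩

theorem linearIsometryEquiv_pureTensor_apply {κ : Type*} (b : HilbertBasis κ ℂ E)
    (x : HilbertTensor E F) (a : κ) :
    (isHilbertSum_pureTensor (F := F) b).linearIsometryEquiv x a = slice (b a) x := by
  classical
  refine ext_inner_left ℂ fun φ => ?_
  have h := lp.inner_single_left (𝕜 := ℂ) a φ
    ((isHilbertSum_pureTensor (F := F) b).linearIsometryEquiv x)
  rw [← (isHilbertSum_pureTensor (F := F) b).linearIsometryEquiv.symm.inner_map_map,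
    LinearIsometryEquiv.symm_apply_apply, IsHilbertSum.linearIsometryEquiv_symm_apply_single] at h
  rw [inner_slice_right]
  exact h.symm

theorem hasSum_slice {κ : Type*} (b : HilbertBasis κ ℂ E) (x : HilbertTensor E F) :
    HasSum (fun a => pureTensor (b a) (slice (b a) x)) x := by
  have h := (isHilbertSum_pureTensor (F := F) b).hasSum_linearIsometryEquiv_symm
    ((isHilbertSum_pureTensor (F := F) b).linearIsometryEquiv x)
  rw [LinearIsometryEquiv.symm_apply_apply] at h
  convert h using 2 with a
  rw [linearIsometryEquiv_pureTensor_apply]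
  rfl

theorem hasSum_inner_slice {κ : Type*} (b : HilbertBasis κ ℂ E) (x y : HilbertTensor E F) :
    HasSum (fun a => inner ℂ (slice (b a) x) (slice (b a) y)) (inner ℂ x y) := by
  have h := lp.hasSum_inner (𝕜 := ℂ) ((isHilbertSum_pureTensor (F := F) b).linearIsometryEquiv x)
    ((isHilbertSum_pureTensor (F := F) b).linearIsometryEquiv y)
  rw [LinearIsometryEquiv.inner_map_map] at h
  simpa only [linearIsometryEquiv_pureTensor_apply] using h

theorem hasSum_norm_sq_slice {κ : Type*} (b : HilbertBasis κ ℂ E) (x : HilbertTensor E F) :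
    HasSum (fun a => ‖slice (b a) x‖ ^ 2) (‖x‖ ^ 2) := by
  have h := (hasSum_inner_slice b x x).mapL Complex.reCLM
  simpa [← inner_self_eq_norm_sq (𝕜 := ℂ)] using h

theorem slice_ext {κ : Type*} (b : HilbertBasis κ ℂ E) {x y : HilbertTensor E F}
    (h : ∀ a, slice (b a) x = slice (b a) y) : x = y := by
  have h1 := hasSum_slice b x
  simp only [h] at h1
  exact h1.unique (hasSum_slice b y)

theorem exists_slice_eq {κ : Type*} (b : HilbertBasis κ ℂ E) (η : κ → F)
    (h : Summable fun a => ‖η a‖ ^ 2) : ∃ y : HilbertTensor E F, ∀ a, slice (b a) y = η a := by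
  have hm : Memℓp η 2 := by
    rw [memℓp_gen_iff (by norm_num)]
    simpa using h
  refine ⟨(isHilbertSum_pureTensor (F := F) b).linearIsometryEquiv.symm ⟨η, hm⟩, fun a => ?_⟩
  rw [← linearIsometryEquiv_pureTensor_apply, LinearIsometryEquiv.apply_symm_apply]

/-- From right to left, the partial sums of `∑ b_a ⊗ (slice)` already lie in the algebraic graph.
Closedness of `B` serves the other direction, where slices must survive the closure. -/
theorem mem_tensorGraph_id_iff {κ : Type*} (b : HilbertBasis κ ℂ E) {B : F →ₗ.[ℂ] F}
    (hB : B.IsClosed) (p : HilbertTensor E F × HilbertTensor E F) :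
    p ∈ tensorGraph (idOp E) B ↔ ∀ a, (slice (b a) p.1, slice (b a) p.2) ∈ B.graph := by
  constructor
  · intro hp a
    let T : (HilbertTensor E F × HilbertTensor E F) →L[ℂ] F × F :=
      (slice (b a)).prodMap (slice (b a))
    have hle : tensorGraph (idOp E) B ≤ B.graph.comap T.toLinearMap := by
      refine Submodule.topologicalClosure_minimal _ ?_ (hB.preimage T.continuous)
      rw [Submodule.span_le]
      rintro _ ⟨u, v, rfl⟩
      change (slice (b a) (pureTensor (u : E) (v : F)),
        slice (b a) (pureTensor (idOp E u) (B v))) ∈ B.graph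
      rw [slice_pureTensor, slice_pureTensor]
      have : idOp E u = (u : E) := rfl
      rw [this]
      exact B.graph.smul_mem (inner ℂ (b a) (u : E)) (B.mem_graph v)
    exact hle hp
  · intro h
    have hs := (hasSum_slice b p.1).prodMk (hasSum_slice b p.2)
    refine mem_closure_of_tendsto hs (Eventually.of_forall fun s => ?_)
    refine Submodule.sum_mem _ fun a _ => Submodule.subset_span ?_
    obtain ⟨v, hv1, hv2⟩ := (LinearPMap.mem_graph_iff _).1 (h a)
    refine ⟨⟨b a, trivial⟩, v, ?_⟩
    simp only at hv1 hv2
    rw [hv1, hv2]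
    rfl

/-- `Submodule.toLinearPMap` has the prescribed graph only if that graph contains no nonzero
vertical vector; slicing reduces this to `B`. -/
theorem tensorOp_id_graph {B : F →ₗ.[ℂ] F} [CompleteSpace E] (hB : B.IsClosed) :
    (tensorOp (idOp E) B).graph = tensorGraph (idOp E) B := by
  obtain ⟨w, b, -⟩ := exists_hilbertBasis ℂ E
  rw [tensorOp_eq, Submodule.toLinearPMap_graph_eq]
  rintro ⟨x, y⟩ hp hx
  rw [mem_tensorGraph_id_iff b hB] at hp
  simp only at hx hp ⊢
  subst hx
  refine slice_ext b fun a => ?_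
  have := hp a
  rw [map_zero] at this ⊢
  exact B.graph_fst_eq_zero_snd this rfl

theorem mem_tensorOp_id_graph_iff {κ : Type*} [CompleteSpace E] (b : HilbertBasis κ ℂ E)
    {B : F →ₗ.[ℂ] F} (hB : B.IsClosed) (p : HilbertTensor E F × HilbertTensor E F) :
    p ∈ (tensorOp (idOp E) B).graph ↔ ∀ a, (slice (b a) p.1, slice (b a) p.2) ∈ B.graph := by
  rw [tensorOp_id_graph hB, mem_tensorGraph_id_iff b hB]

end HilbertTensorProducts

end BoseField

end

noncomputable section

namespace BoseField

/-! ### Tensor products of square integrable functions -/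

section SquareIntegrable

variable {d : ℕ}

/-- Multiplication by a bounded function on `L²`. -/
def mulL {X : Type*} [MeasurableSpace X] {μ : Measure X} {φ : X → ℂ} (hφ : MemLp φ ∞ μ) :
    Lp ℂ 2 μ →L[ℂ] Lp ℂ 2 μ :=
  (ContinuousLinearMap.mul ℂ ℂ).holderL μ ∞ 2 2 hφ.toLp

theorem mulL_coeFn {X : Type*} [MeasurableSpace X] {μ : Measure X} {φ : X → ℂ}
    (hφ : MemLp φ ∞ μ) (f : Lp ℂ 2 μ) : mulL hφ f =ᵐ[μ] fun x => φ x * f x := by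
  have h := ContinuousLinearMap.coeFn_holder (B := ContinuousLinearMap.mul ℂ ℂ) (r := 2)
    (hφ.toLp) f
  filter_upwards [h, hφ.coeFn_toLp] with x h1 h2
  rw [← h2]
  exact h1

/-- Removing the first variable, as a measurable equivalence. -/
def splitEquiv (d n : ℕ) : (Fin (n + 1) → Momentum d) ≃ᵐ (Fin n → Momentum d) × Momentum d :=
  (MeasurableEquiv.piFinSuccAbove (fun _ : Fin (n + 1) => Momentum d) 0).trans
    MeasurableEquiv.prodComm

theorem splitEquiv_apply (n : ℕ) (x : Fin (n + 1) → Momentum d) :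
    splitEquiv d n x = (Fin.tail x, x 0) := by
  simp [splitEquiv, MeasurableEquiv.piFinSuccAbove, Fin.insertNthEquiv]
  rfl

theorem splitEquiv_symm_apply (n : ℕ) (p : (Fin n → Momentum d) × Momentum d) :
    (splitEquiv d n).symm p = Fin.cons p.2 p.1 := by
  rw [MeasurableEquiv.symm_apply_eq, splitEquiv_apply]
  simp

theorem measurePreserving_splitEquiv_symm (d n : ℕ) :
    MeasurePreserving (splitEquiv d n).symm
      ((volume : Measure (Fin n → Momentum d)).prod volume) volume := by
  convert measurePreserving_cons d n using 1
  funext p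
  exact splitEquiv_symm_apply n p

theorem measurePreserving_split (d n : ℕ) :
    MeasurePreserving (fun x : Fin (n + 1) → Momentum d => (Fin.tail x, x 0)) volume
      ((volume : Measure (Fin n → Momentum d)).prod volume) := by
  convert (measurePreserving_splitEquiv_symm d n).symm using 1
  funext x
  exact (splitEquiv_apply n x).symm

theorem integral_cons {n : ℕ} (F : (Fin (n + 1) → Momentum d) → ℂ) :
    ∫ p : (Fin n → Momentum d) × Momentum d, F (Fin.cons p.2 p.1)
      ∂((volume : Measure (Fin n → Momentum d)).prod volume) = ∫ x, F x := by
  rw [← (measurePreserving_splitEquiv_symm d n).integral_comp'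
    (g := F)]
  simp only [splitEquiv_symm_apply]

theorem memLp_mul_prod {X Y : Type*} [MeasurableSpace X] [MeasurableSpace Y] {μ : Measure X}
    {ν : Measure Y} [SFinite μ] [SFinite ν] {f : X → ℂ} {g : Y → ℂ} (hf : MemLp f 2 μ)
    (hg : MemLp g 2 ν) : MemLp (fun p : X × Y => f p.1 * g p.2) 2 (μ.prod ν) := by
  refine (memLp_two_iff_integrable_sq_norm (f := fun p : X × Y => f p.1 * g p.2)
    (hf.1.comp_fst.mul hg.1.comp_snd)).2 ?_
  have h1 := (memLp_two_iff_integrable_sq_norm hf.1).1 hf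
  have h2 := (memLp_two_iff_integrable_sq_norm hg.1).1 hg
  simpa [mul_pow] using h1.mul_prod h2

theorem memLp_cons {n : ℕ} {f : Momentum d → ℂ} {g : (Fin n → Momentum d) → ℂ}
    (hf : MemLp f 2) (hg : MemLp g 2) :
    MemLp (fun x : Fin (n + 1) → Momentum d => f (x 0) * g (Fin.tail x)) 2 := by
  have := (memLp_mul_prod hg hf).comp_measurePreserving (measurePreserving_split d n)
  refine this.congr_norm ?_ ?_
  · refine AEStronglyMeasurable.congr this.1 (Eventually.of_forall fun x => ?_)
    exact mul_comm _ _
  · exact Eventually.of_forall fun x => by simp [mul_comm]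

theorem quasiMeasurePreserving_zero (d n : ℕ) :
    Measure.QuasiMeasurePreserving (fun x : Fin (n + 1) → Momentum d => x 0) volume volume :=
  Measure.quasiMeasurePreserving_snd.comp (measurePreserving_split d n).quasiMeasurePreserving

theorem quasiMeasurePreserving_tail (d n : ℕ) :
    Measure.QuasiMeasurePreserving
      (fun x : Fin (n + 1) → Momentum d => (Fin.tail x : Fin n → Momentum d)) volume volume :=
  Measure.quasiMeasurePreserving_fst.comp (measurePreserving_split d n).quasiMeasurePreserving

/-- The function `(q, k) ↦ f q * g k` as an element of `L²`. -/
def consFun {n : ℕ} (f : OneBoson d) (g : NBoson d n) : NBoson d (n + 1) :=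
  (memLp_cons (Lp.memLp f) (Lp.memLp g)).toLp

theorem consFun_coeFn {n : ℕ} (f : OneBoson d) (g : NBoson d n) :
    consFun f g =ᵐ[volume] fun x => f (x 0) * g (Fin.tail x) :=
  MemLp.coeFn_toLp _

theorem inner_consFun {n : ℕ} (f f' : OneBoson d) (g g' : NBoson d n) :
    inner ℂ (consFun f g) (consFun f' g') = inner ℂ f f' * inner ℂ g g' := by
  simp only [L2.inner_def]
  rw [mul_comm, ← integral_prod_mul, ← integral_cons]
  refine integral_congr_ae ?_
  filter_upwards [(measurePreserving_cons d n).quasiMeasurePreserving.ae (consFun_coeFn f g),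
    (measurePreserving_cons d n).quasiMeasurePreserving.ae (consFun_coeFn f' g')] with p h1 h2
  rw [h1, h2]
  simp
  ring

/-- The bounded bilinear map `(f, g) ↦ f ⊗ g`. -/
def consTensor (d n : ℕ) : OneBoson d →L[ℂ] NBoson d n →L[ℂ] NBoson d (n + 1) :=
  LinearMap.mkContinuous₂
    (LinearMap.mk₂ ℂ consFun
      (by
        intro f f' g
        refine Lp.ext ?_
        filter_upwards [consFun_coeFn (f + f') g, consFun_coeFn f g, consFun_coeFn f' g,
          Lp.coeFn_add (consFun f g) (consFun f' g),
          (quasiMeasurePreserving_zero d n).ae (Lp.coeFn_add f f')] with x h1 h2 h3 h4 h5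
        rw [h1, h4, Pi.add_apply, h2, h3, h5, Pi.add_apply, add_mul])
      (by
        intro z f g
        refine Lp.ext ?_
        filter_upwards [consFun_coeFn (z • f) g, consFun_coeFn f g,
          Lp.coeFn_smul z (consFun f g),
          (quasiMeasurePreserving_zero d n).ae (Lp.coeFn_smul z f)] with x h1 h2 h4 h5
        rw [h1, h4, Pi.smul_apply, h2, h5, Pi.smul_apply, smul_mul_assoc])
      (by
        intro f g g'
        refine Lp.ext ?_
        filter_upwards [consFun_coeFn f (g + g'), consFun_coeFn f g, consFun_coeFn f g',
          Lp.coeFn_add (consFun f g) (consFun f g'),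
          (quasiMeasurePreserving_tail d n).ae (Lp.coeFn_add g g')] with x h1 h2 h3 h4 h5
        rw [h1, h4, Pi.add_apply, h2, h3, h5, Pi.add_apply, mul_add])
      (by
        intro z f g
        refine Lp.ext ?_
        filter_upwards [consFun_coeFn f (z • g), consFun_coeFn f g,
          Lp.coeFn_smul z (consFun f g),
          (quasiMeasurePreserving_tail d n).ae (Lp.coeFn_smul z g)] with x h1 h2 h4 h5
        rw [h1, h4, Pi.smul_apply, h2, h5, Pi.smul_apply, mul_smul_comm]))
    1 (by
      intro f g
      change ‖consFun f g‖ ≤ _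
      refine le_of_eq ?_
      rw [one_mul, ← sq_eq_sq₀ (norm_nonneg _) (by positivity), mul_pow]
      have h := inner_consFun f f g g
      simp only [inner_self_eq_norm_sq_to_K] at h
      exact_mod_cast h)

theorem consTensor_coeFn {n : ℕ} (f : OneBoson d) (g : NBoson d n) :
    consTensor d n f g =ᵐ[volume] fun x => f (x 0) * g (Fin.tail x) :=
  consFun_coeFn f g

theorem inner_consTensor {n : ℕ} (f f' : OneBoson d) (g g' : NBoson d n) :
    inner ℂ (consTensor d n f g) (consTensor d n f' g') = inner ℂ f f' * inner ℂ g g' :=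
  inner_consFun f f' g g'

theorem norm_consTensor {n : ℕ} (f : OneBoson d) (g : NBoson d n) :
    ‖consTensor d n f g‖ = ‖f‖ * ‖g‖ := by
  rw [← sq_eq_sq₀ (norm_nonneg _) (by positivity), mul_pow]
  have h := inner_consTensor f f g g
  simp only [inner_self_eq_norm_sq_to_K] at h
  exact_mod_cast h

/-- Contraction of the first variable with `f`. -/
def annih {n : ℕ} (f : OneBoson d) : NBoson d (n + 1) →L[ℂ] NBoson d n :=
  ContinuousLinearMap.adjoint (consTensor d n f)

/-- Contraction of all variables but the first with `g`. -/
def contract {n : ℕ} (g : NBoson d n) : NBoson d (n + 1) →L[ℂ] OneBoson d :=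
  ContinuousLinearMap.adjoint ((consTensor d n).flip g)

theorem inner_annih_right {n : ℕ} (f : OneBoson d) (g : NBoson d n) (Ψ : NBoson d (n + 1)) :
    inner ℂ g (annih f Ψ) = inner ℂ (consTensor d n f g) Ψ := by
  rw [annih, ContinuousLinearMap.adjoint_inner_right]

theorem inner_contract_right {n : ℕ} (f : OneBoson d) (g : NBoson d n) (Ψ : NBoson d (n + 1)) :
    inner ℂ f (contract g Ψ) = inner ℂ (consTensor d n f g) Ψ := by
  rw [contract, ContinuousLinearMap.adjoint_inner_right, ContinuousLinearMap.flip_apply]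

theorem norm_annih_apply_le {n : ℕ} (f : OneBoson d) (Ψ : NBoson d (n + 1)) :
    ‖annih f Ψ‖ ≤ ‖f‖ * ‖Ψ‖ := by
  have h1 : ‖annih f Ψ‖ ^ 2 ≤ ‖f‖ * ‖annih f Ψ‖ * ‖Ψ‖ := by
    calc ‖annih f Ψ‖ ^ 2 = ‖inner ℂ (annih f Ψ) (annih f Ψ)‖ := by
          rw [inner_self_eq_norm_sq_to_K]; simp
      _ ≤ ‖consTensor d n f (annih f Ψ)‖ * ‖Ψ‖ := by
          rw [inner_annih_right]; exact norm_inner_le_norm _ _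
      _ = _ := by rw [norm_consTensor]
  rcases (norm_nonneg (annih f Ψ)).eq_or_lt with h | h
  · rw [← h]; positivity
  · nlinarith

/-- Links the contraction defined as an adjoint with the pointwise integral in `annihilationGraph`.
Both sides have the same integral over every set of finite measure, by Fubini applied to the pairing
with an indicator function. -/
theorem annih_coeFn {n : ℕ} (f : OneBoson d) (Ψ : NBoson d (n + 1)) :
    annih f Ψ =ᵐ[volume] fun k => ∫ q : Momentum d, conj (f q) *
      Ψ (Fin.cons q k : Fin (n + 1) → Momentum d) := by
  have key : ∀ s : Set (Fin n → Momentum d), MeasurableSet s → volume s < ∞ →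
      Integrable (fun p : (Fin n → Momentum d) × Momentum d =>
        s.indicator 1 p.1 * (conj (f p.2) * Ψ (Fin.cons p.2 p.1 : Fin (n + 1) → Momentum d)))
        (volume.prod volume) ∧
      ∫ p : (Fin n → Momentum d) × Momentum d,
        s.indicator 1 p.1 * (conj (f p.2) * Ψ (Fin.cons p.2 p.1 : Fin (n + 1) → Momentum d))
        ∂(volume.prod volume) = ∫ k in s, annih f Ψ k := by
    intro s hs hsf
    have h1 := inner_annih_right f (indicatorConstLp 2 hs hsf.ne (1 : ℂ)) Ψ
    rw [L2.inner_indicatorConstLp_one] at h1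
    have hae : (fun p : (Fin n → Momentum d) × Momentum d =>
        inner ℂ (consTensor d n f (indicatorConstLp 2 hs hsf.ne (1 : ℂ))
          (Fin.cons p.2 p.1 : Fin (n + 1) → Momentum d))
          (Ψ (Fin.cons p.2 p.1 : Fin (n + 1) → Momentum d))) =ᵐ[volume.prod volume]
        fun p => s.indicator 1 p.1 *
          (conj (f p.2) * Ψ (Fin.cons p.2 p.1 : Fin (n + 1) → Momentum d)) := by
      filter_upwards [(measurePreserving_cons d n).quasiMeasurePreserving.ae
        (consTensor_coeFn f (indicatorConstLp 2 hs hsf.ne (1 : ℂ))),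
        (Measure.quasiMeasurePreserving_fst (μ := (volume : Measure (Fin n → Momentum d)))
          (ν := (volume : Measure (Momentum d)))).ae
          (indicatorConstLp_coeFn (p := 2) (hs := hs) (hμs := hsf.ne) (c := (1 : ℂ)))] with p a b
      rw [a]
      simp only [Fin.cons_zero, Fin.tail_cons]
      rw [b]
      by_cases hp : p.1 ∈ s <;> simp [hp, mul_comm]
    refine ⟨?_, ?_⟩
    · refine Integrable.congr ?_ hae
      exact (measurePreserving_cons d n).integrable_comp_of_integrable (L2.integrable_inner
        (𝕜 := ℂ) (consTensor d n f (indicatorConstLp 2 hs hsf.ne (1 : ℂ))) Ψ)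
    · rw [h1, L2.inner_def, ← integral_cons]
      exact (integral_congr_ae hae).symm
  have hind : ∀ (s : Set (Fin n → Momentum d)) (k : Fin n → Momentum d),
      ∫ q : Momentum d, s.indicator 1 k * (conj (f q) *
        Ψ (Fin.cons q k : Fin (n + 1) → Momentum d)) = s.indicator (fun k =>
          ∫ q : Momentum d, conj (f q) * Ψ (Fin.cons q k : Fin (n + 1) → Momentum d)) k := by
    intro s k
    rw [integral_const_mul]
    by_cases hk : k ∈ s <;> simp [hk]
  refine ae_eq_of_forall_setIntegral_eq_of_sigmaFinite ?_ ?_ ?_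
  · intro s hs hsf
    exact (L2.integrable_inner (𝕜 := ℂ) (indicatorConstLp 2 hs hsf.ne (1 : ℂ))
      (annih f Ψ)).integrableOn.congr (by
        filter_upwards [ae_restrict_of_ae (indicatorConstLp_coeFn (p := 2) (hs := hs)
          (hμs := hsf.ne) (c := (1 : ℂ))), ae_restrict_mem hs] with k a b
        rw [a]; simp [b])
  · intro s hs hsf
    have h := (key s hs hsf).1.integral_prod_left
    simp only [hind] at h
    exact (integrable_indicator_iff hs).1 h
  · intro s hs hsf
    rw [← (key s hs hsf).2, integral_prod _ (key s hs hsf).1]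
    simp only [hind]
    rw [integral_indicator hs]

end SquareIntegrable

end BoseField

end

noncomputable section

namespace BoseField

/-! ### Elementary tensors, product bases, and tensor powers of unitaries. -/

section ElementaryTensors

variable {d : ℕ}

/-- The null set off which the contraction with `f` vanishes depends on `f`. Separability of `L²`
supplies a countable dense set of `f`, hence one null set off which the section `q ↦ Ψ(q, k)` is
orthogonal to everything. -/
theorem eq_zero_of_annih_eq_zero {n : ℕ} {Ψ : NBoson d (n + 1)}
    (h : ∀ f : OneBoson d, annih f Ψ = 0) : Ψ = 0 := by
  have : Fact ((2 : ℝ≥0∞) ≠ ∞) := ⟨by norm_num⟩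
  obtain ⟨D, hDc, hD⟩ := TopologicalSpace.exists_countable_dense (OneBoson d)
  have h1 : ∀ᵐ k : Fin n → Momentum d, ∀ f ∈ D, ∫ q : Momentum d, conj (f q) *
      Ψ (Fin.cons q k : Fin (n + 1) → Momentum d) = 0 := by
    rw [ae_ball_iff hDc]
    intro f _
    filter_upwards [annih_coeFn f Ψ, Lp.coeFn_zero ℂ 2 (volume : Measure (Fin n → Momentum d))]
      with k a b
    rw [← a, h f, b, Pi.zero_apply]
  have h2 : MemLp (fun p : (Fin n → Momentum d) × Momentum d =>
      Ψ (Fin.cons p.2 p.1 : Fin (n + 1) → Momentum d)) 2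
      ((volume : Measure (Fin n → Momentum d)).prod volume) :=
    (Lp.memLp Ψ).comp_measurePreserving (measurePreserving_cons d n)
  have h3 := (memLp_two_iff_integrable_sq_norm h2.1).1 h2
  have h4 : ∀ᵐ k : Fin n → Momentum d, ∀ᵐ q : Momentum d,
      Ψ (Fin.cons q k : Fin (n + 1) → Momentum d) = 0 := by
    filter_upwards [h3.prod_right_ae, h2.1.prodMk_left, h1] with k a b c
    have h5 : MemLp (fun q : Momentum d => Ψ (Fin.cons q k : Fin (n + 1) → Momentum d)) 2 :=
      (memLp_two_iff_integrable_sq_norm b).2 a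
    have h6 : h5.toLp = 0 := by
      refine hD.eq_zero_of_inner_right ℂ fun f hf => ?_
      rw [L2.inner_def, ← c f hf]
      refine integral_congr_ae ?_
      filter_upwards [h5.coeFn_toLp] with q hq
      rw [hq]
      simp only [RCLike.inner_apply, mul_comm]
    have h7 := h5.coeFn_toLp
    rw [h6] at h7
    filter_upwards [h7, Lp.coeFn_zero ℂ 2 (volume : Measure (Momentum d))] with q a b
    rw [← a, b, Pi.zero_apply]
  have h8 : ∀ᵐ p ∂((volume : Measure (Fin n → Momentum d)).prod (volume : Measure (Momentum d))),
      Ψ (Fin.cons p.2 p.1 : Fin (n + 1) → Momentum d) = 0 := by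
    refine (Measure.ae_prod_iff_ae_ae ?_).2 h4
    have hm : Measurable fun p : (Fin n → Momentum d) × Momentum d =>
        Ψ (Fin.cons p.2 p.1 : Fin (n + 1) → Momentum d) :=
      (Lp.stronglyMeasurable Ψ).measurable.comp (measurePreserving_cons d n).measurable
    exact hm (measurableSet_singleton 0)
  refine Lp.ext ?_
  filter_upwards [(measurePreserving_split d n).quasiMeasurePreserving.ae h8,
    Lp.coeFn_zero ℂ 2 (volume : Measure (Fin (n + 1) → Momentum d))] with x a b
  rw [b, Pi.zero_apply, ← a]
  simp

/-- The elementary tensor `f₁ ⊗ ⋯ ⊗ fₙ`. -/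
def elemTensor : {n : ℕ} → (Fin n → OneBoson d) → NBoson d n
  | 0, _ => indicatorConstLp 2 MeasurableSet.univ
      (by rw [volume_pi, Measure.pi_empty_univ]; exact ENNReal.one_ne_top) (1 : ℂ)
  | n + 1, f => consTensor d n (f 0) (elemTensor (Fin.tail f))

theorem elemTensor_succ {n : ℕ} (f : Fin (n + 1) → OneBoson d) :
    elemTensor f = consTensor d n (f 0) (elemTensor (Fin.tail f)) := rfl

theorem elemTensor_cons {n : ℕ} (f : OneBoson d) (g : Fin n → OneBoson d) :
    elemTensor (Fin.cons f g) = consTensor d n f (elemTensor g) := rfl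

theorem elemTensor_coeFn {n : ℕ} (f : Fin n → OneBoson d) :
    elemTensor f =ᵐ[volume] fun k => ∏ i, f i (k i) := by
  induction n with
  | zero =>
    refine (indicatorConstLp_coeFn (p := 2)).trans (Eventually.of_forall fun k => ?_)
    simp
  | succ n ih =>
    filter_upwards [consTensor_coeFn (f 0) (elemTensor (Fin.tail f)),
      (quasiMeasurePreserving_tail d n).ae (ih (Fin.tail f))] with k a b
    rw [elemTensor_succ, a, b, Fin.prod_univ_succ]
    rfl

theorem inner_elemTensor {n : ℕ} (f g : Fin n → OneBoson d) :
    inner ℂ (elemTensor f) (elemTensor g) = ∏ i, inner ℂ (f i) (g i) := by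
  induction n with
  | zero =>
    simp only [elemTensor, Finset.univ_eq_empty, Finset.prod_empty]
    rw [L2.inner_indicatorConstLp_indicatorConstLp]
    simp [Measure.real, volume_pi]
  | succ n ih =>
    rw [elemTensor_succ, elemTensor_succ, inner_consTensor, ih, Fin.prod_univ_succ]
    rfl

/-- Completeness of the product system, by induction on the number of variables: contracting the
first variable with `e i` leaves a function orthogonal to all shorter product tensors. -/
theorem eq_zero_of_inner_elemTensor {ι : Type*} (e : HilbertBasis ι ℂ (OneBoson d)) {n : ℕ}
    {Ψ : NBoson d n} (h : ∀ I : Fin n → ι, inner ℂ (elemTensor (e ∘ I)) Ψ = 0) : Ψ = 0 := by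
  induction n with
  | zero =>
    have h0 := h Fin.elim0
    simp only [elemTensor] at h0
    rw [L2.inner_indicatorConstLp_one, setIntegral_univ, integral_unique] at h0
    have hu : (volume : Measure (Fin 0 → Momentum d)).real Set.univ = 1 := by
      simp [Measure.real, volume_pi]
    rw [hu, one_smul] at h0
    refine Lp.ext ?_
    filter_upwards [Lp.coeFn_zero ℂ 2 (volume : Measure (Fin 0 → Momentum d))] with x a
    rw [a, Pi.zero_apply, ← h0]
    congr 1
    exact Subsingleton.elim _ _
  | succ n ih =>
    have key : ∀ i, annih (e i) Ψ = 0 := by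
      intro i
      refine ih fun I => ?_
      rw [inner_annih_right]
      have := h (Fin.cons i I)
      have h2 : (e ∘ (Fin.cons i I : Fin (n + 1) → ι)) = Fin.cons (e i) (e ∘ I) := by
        funext j
        refine Fin.cases ?_ (fun j => ?_) j <;> simp
      rwa [h2, elemTensor_cons] at this
    refine eq_zero_of_annih_eq_zero fun f => ?_
    refine ext_inner_left ℂ fun g => ?_
    rw [inner_annih_right, inner_zero_right]
    have hz : ((innerSL ℂ Ψ).comp ((consTensor d n).flip g)) = 0 := by
      refine ContinuousLinearMap.ext_on ?_ (s := Set.range e) ?_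
      · have := e.dense_span
        rwa [← Submodule.dense_iff_topologicalClosure_eq_top] at this
      · rintro _ ⟨i, rfl⟩
        change inner ℂ Ψ (consTensor d n (e i) g) = 0
        rw [← inner_conj_symm, ← inner_annih_right, key i, inner_zero_right, map_zero]
    have := DFunLike.congr_fun hz f
    rw [← inner_conj_symm]
    change conj (inner ℂ Ψ (consTensor d n f g)) = 0
    rw [show inner ℂ Ψ (consTensor d n f g) = 0 from this, map_zero]

theorem orthonormal_elemTensor {ι : Type*} {e : ι → OneBoson d} (he : Orthonormal ℂ e) (n : ℕ) :
    Orthonormal ℂ (fun I : Fin n → ι => elemTensor (e ∘ I)) := by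
  classical
  rw [orthonormal_iff_ite] at he ⊢
  intro I J
  rw [inner_elemTensor]
  simp only [Function.comp_apply, he]
  by_cases h : I = J
  · simp [h]
  · rw [if_neg h]
    obtain ⟨i, hi⟩ := Function.ne_iff.1 h
    exact Finset.prod_eq_zero (Finset.mem_univ i) (if_neg hi)

/-- The Hilbert basis of elementary tensors. -/
def tensorBasis {ι : Type*} (e : HilbertBasis ι ℂ (OneBoson d)) (n : ℕ) :
    HilbertBasis (Fin n → ι) ℂ (NBoson d n) :=
  HilbertBasis.mkOfOrthogonalEqBot (orthonormal_elemTensor e.orthonormal n) (by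
    rw [Submodule.eq_bot_iff]
    intro Ψ hΨ
    exact eq_zero_of_inner_elemTensor e fun I =>
      hΨ _ (Submodule.subset_span ⟨I, rfl⟩))

@[simp]
theorem tensorBasis_apply {ι : Type*} (e : HilbertBasis ι ℂ (OneBoson d)) (n : ℕ)
    (I : Fin n → ι) : tensorBasis e n I = elemTensor (e ∘ I) := by
  rw [tensorBasis, HilbertBasis.coe_mkOfOrthogonalEqBot]

theorem dense_span_elemTensor (d n : ℕ) :
    (Submodule.span ℂ (Set.range (elemTensor : (Fin n → OneBoson d) → NBoson d n))
      ).topologicalClosure = ⊤ := by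
  obtain ⟨w, e, -⟩ := exists_hilbertBasis ℂ (OneBoson d)
  rw [eq_top_iff, ← (tensorBasis e n).dense_span]
  refine Submodule.topologicalClosure_mono (Submodule.span_mono ?_)
  rintro _ ⟨I, rfl⟩
  exact ⟨e ∘ I, (tensorBasis_apply e n I).symm⟩

theorem clm_ext_elemTensor {n : ℕ} {M : Type*} [NormedAddCommGroup M] [NormedSpace ℂ M]
    {S T : NBoson d n →L[ℂ] M} (h : ∀ f, S (elemTensor f) = T (elemTensor f)) : S = T := by
  refine ContinuousLinearMap.ext_on ?_ (s := Set.range (elemTensor (d := d) (n := n))) ?_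
  · rw [Submodule.dense_iff_topologicalClosure_eq_top]
    exact dense_span_elemTensor d n
  · rintro _ ⟨f, rfl⟩
    exact h f

theorem hilbertBasis_ext_inner {ι E : Type*} [NormedAddCommGroup E] [InnerProductSpace ℂ E]
    (b : HilbertBasis ι ℂ E) {x y : E} (h : ∀ i, inner ℂ (b i) x = inner ℂ (b i) y) : x = y := by
  apply b.repr.injective
  ext i
  rw [b.repr_apply_apply, b.repr_apply_apply, h i]

/-- The Hilbert basis transported by a unitary map. -/
def mapBasis {ι E : Type*} [NormedAddCommGroup E] [InnerProductSpace ℂ E]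
    (b : HilbertBasis ι ℂ E) (V : E ≃ₗᵢ[ℂ] E) : HilbertBasis ι ℂ E :=
  ⟨V.symm.trans b.repr⟩

theorem mapBasis_apply {ι E : Type*} [NormedAddCommGroup E] [InnerProductSpace ℂ E]
    (b : HilbertBasis ι ℂ E) (V : E ≃ₗᵢ[ℂ] E) (i : ι) : mapBasis b V i = V (b i) := by
  classical
  rw [← HilbertBasis.repr_symm_single, ← HilbertBasis.repr_symm_single]
  rfl

/-- There is a unitary map `⊗ⁿ V`. -/
theorem exists_tensorPower (V : OneBoson d ≃ₗᵢ[ℂ] OneBoson d) (n : ℕ) :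
    ∃ W : NBoson d n ≃ₗᵢ[ℂ] NBoson d n, ∀ f, W (elemTensor f) = elemTensor (fun i => V (f i)) := by
  obtain ⟨w, e, -⟩ := exists_hilbertBasis ℂ (OneBoson d)
  let B := tensorBasis e n
  let B' := tensorBasis (mapBasis e V) n
  -- The unitary that matches the product basis of `e` with the product basis of `V e`. Its effect
  -- on an arbitrary elementary tensor is then checked on coefficients, which are products of
  -- one-boson inner products.
  refine ⟨B.repr.trans B'.repr.symm, fun f => ?_⟩
  refine hilbertBasis_ext_inner B' fun I => ?_
  rw [← B'.repr_apply_apply, LinearIsometryEquiv.trans_apply, LinearIsometryEquiv.apply_symm_apply,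
    B.repr_apply_apply, tensorBasis_apply, tensorBasis_apply, inner_elemTensor, inner_elemTensor]
  refine Finset.prod_congr rfl fun i _ => ?_
  simp only [Function.comp_apply, mapBasis_apply, LinearIsometryEquiv.inner_map_map]

/-- The unitary map `⊗ⁿ V`. -/
def tensorPow (V : OneBoson d ≃ₗᵢ[ℂ] OneBoson d) (n : ℕ) : NBoson d n ≃ₗᵢ[ℂ] NBoson d n :=
  (exists_tensorPower V n).choose

theorem tensorPow_elemTensor (V : OneBoson d ≃ₗᵢ[ℂ] OneBoson d) {n : ℕ} (f : Fin n → OneBoson d) :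
    tensorPow V n (elemTensor f) = elemTensor (fun i => V (f i)) :=
  (exists_tensorPower V n).choose_spec f

theorem tensorPow_consTensor (V : OneBoson d ≃ₗᵢ[ℂ] OneBoson d) {n : ℕ} (f : OneBoson d)
    (g : NBoson d n) :
    tensorPow V (n + 1) (consTensor d n f g) = consTensor d n (V f) (tensorPow V n g) := by
  have : ((tensorPow V (n + 1)).toContinuousLinearEquiv : NBoson d (n + 1) →L[ℂ] NBoson d (n + 1)).comp
      (consTensor d n f) = (consTensor d n (V f)).comp
      ((tensorPow V n).toContinuousLinearEquiv : NBoson d n →L[ℂ] NBoson d n) := by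
    refine clm_ext_elemTensor fun g => ?_
    change tensorPow V (n + 1) (consTensor d n f (elemTensor g))
      = consTensor d n (V f) (tensorPow V n (elemTensor g))
    rw [← elemTensor_cons, tensorPow_elemTensor, tensorPow_elemTensor, ← elemTensor_cons]
    congr 1
    funext i
    refine Fin.cases ?_ (fun j => ?_) i <;> simp
  exact DFunLike.congr_fun this g

theorem measurePreserving_perm {n : ℕ} (σ : Equiv.Perm (Fin n)) :
    MeasurePreserving (fun k : Fin n → Momentum d => k ∘ σ) volume volume := by
  have e : (fun k : Fin n → Momentum d => k ∘ σ)
      = MeasurableEquiv.piCongrLeft (fun _ : Fin n => Momentum d) σ⁻¹ := by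
    funext k
    funext i
    have := MeasurableEquiv.piCongrLeft_apply_apply (β := fun _ : Fin n => Momentum d) (e := σ⁻¹)
      k (σ i)
    simpa using this.symm
  rw [e]
  exact volume_measurePreserving_piCongrLeft (fun _ : Fin n => Momentum d) σ⁻¹

/-- Permutation of the variables. -/
def permL {n : ℕ} (σ : Equiv.Perm (Fin n)) : NBoson d n →ₗᵢ[ℂ] NBoson d n :=
  Lp.compMeasurePreservingₗᵢ ℂ (fun k : Fin n → Momentum d => k ∘ σ) (measurePreserving_perm σ)

theorem permL_coeFn {n : ℕ} (σ : Equiv.Perm (Fin n)) (Ψ : NBoson d n) :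
    permL σ Ψ =ᵐ[volume] fun k => Ψ (k ∘ σ) :=
  Lp.coeFn_compMeasurePreserving Ψ (measurePreserving_perm σ)

theorem permL_elemTensor {n : ℕ} (σ : Equiv.Perm (Fin n)) (f : Fin n → OneBoson d) :
    permL σ (elemTensor f) = elemTensor (f ∘ σ.symm) := by
  refine Lp.ext ?_
  filter_upwards [permL_coeFn σ (elemTensor f), elemTensor_coeFn (f ∘ σ.symm),
    (measurePreserving_perm σ).quasiMeasurePreserving.ae (elemTensor_coeFn f)] with k a b c
  rw [a, b, c]
  refine Fintype.prod_equiv σ _ _ fun i => ?_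
  simp

theorem permL_eq_iff {n : ℕ} (σ : Equiv.Perm (Fin n)) (Ψ : NBoson d n) :
    permL σ Ψ = Ψ ↔ (fun k => Ψ (k ∘ σ)) =ᵐ[volume] Ψ := by
  constructor
  · intro h
    have := permL_coeFn σ Ψ
    rw [h] at this
    exact this.symm
  · intro h
    exact Lp.ext ((permL_coeFn σ Ψ).trans h)

theorem tensorPow_permL (V : OneBoson d ≃ₗᵢ[ℂ] OneBoson d) {n : ℕ} (σ : Equiv.Perm (Fin n))
    (Ψ : NBoson d n) : tensorPow V n (permL σ Ψ) = permL σ (tensorPow V n Ψ) := by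
  have : ((tensorPow V n).toContinuousLinearEquiv : NBoson d n →L[ℂ] NBoson d n).comp
      (permL σ).toContinuousLinearMap = (permL σ).toContinuousLinearMap.comp
      ((tensorPow V n).toContinuousLinearEquiv : NBoson d n →L[ℂ] NBoson d n) := by
    refine clm_ext_elemTensor fun g => ?_
    change tensorPow V n (permL σ (elemTensor g)) = permL σ (tensorPow V n (elemTensor g))
    rw [permL_elemTensor, tensorPow_elemTensor, tensorPow_elemTensor, permL_elemTensor]
    rfl
  exact DFunLike.congr_fun this Ψ

end ElementaryTensors

end BoseField

end

noncomputable section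

namespace BoseField

/-! ### The boson Fock space -/

section Fock

variable {d : ℕ}

theorem mem_symmetricSubspace_iff (Ψ : FullFock d) :
    Ψ ∈ symmetricSubspace d ↔ ∀ (n : ℕ) (σ : Equiv.Perm (Fin n)), permL σ (Ψ n) = Ψ n :=
  forall_congr' fun n => forall_congr' fun σ => (permL_eq_iff σ (Ψ n)).symm

theorem permL_component (n : ℕ) (σ : Equiv.Perm (Fin n)) (Ψ : BoseFock d) :
    permL σ (component d n Ψ) = component d n Ψ :=
  (mem_symmetricSubspace_iff _).1 Ψ.2 n σ

instance : CompleteSpace (BoseFock d) := by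
  have h : IsClosed (symmetricSubspace d : Set (FullFock d)) := by
    have : (symmetricSubspace d : Set (FullFock d)) = ⋂ (n : ℕ) (σ : Equiv.Perm (Fin n)),
        {Ψ : FullFock d | permL σ (Ψ n) = Ψ n} := by
      ext Ψ
      simp only [SetLike.mem_coe, mem_symmetricSubspace_iff, Set.mem_iInter, Set.mem_ofPred_eq]
    rw [this]
    refine isClosed_iInter fun n => isClosed_iInter fun σ => ?_
    have hc : Continuous fun Ψ : FullFock d => Ψ n :=
      (lp.evalCLM ℂ (fun n : ℕ => NBoson d n) 2 n).continuous
    exact isClosed_eq ((permL σ).continuous.comp hc) hc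
  exact h.completeSpace_coe

theorem hasSum_inner_component (Φ Ψ : BoseFock d) :
    HasSum (fun n => inner ℂ (component d n Φ) (component d n Ψ)) (inner ℂ Φ Ψ) :=
  lp.hasSum_inner (𝕜 := ℂ) (Subtype.val (p := fun x => x ∈ symmetricSubspace d) Φ)
    (Subtype.val (p := fun x => x ∈ symmetricSubspace d) Ψ)

theorem hasSum_norm_sq_component (Ψ : BoseFock d) :
    HasSum (fun n => ‖component d n Ψ‖ ^ 2) (‖Ψ‖ ^ 2) := by
  have h := (hasSum_inner_component Ψ Ψ).mapL Complex.reCLM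
  simpa [← inner_self_eq_norm_sq (𝕜 := ℂ)] using h

/-- The component map as a bounded operator. -/
def compL (d n : ℕ) : BoseFock d →L[ℂ] NBoson d n :=
  (component d n).mkContinuous 1 fun Ψ => by
    rw [one_mul]
    exact lp.norm_apply_le_norm (by norm_num)
      (Subtype.val (p := fun x => x ∈ symmetricSubspace d) Ψ) n

theorem continuous_component (n : ℕ) : Continuous (component d n) := (compL d n).continuous

theorem fock_ext {Φ Ψ : BoseFock d} (h : ∀ n, component d n Φ = component d n Ψ) : Φ = Ψ := by
  refine Subtype.ext (lp.ext ?_)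
  funext n
  exact h n

theorem exists_component_eq (η : ∀ n, NBoson d n) (hs : ∀ n σ, permL σ (η n) = η n)
    (h : Summable fun n => ‖η n‖ ^ 2) : ∃ Ψ : BoseFock d, ∀ n, component d n Ψ = η n := by
  have hm : Memℓp η 2 := by
    rw [memℓp_gen_iff (by norm_num)]
    simpa using h
  exact ⟨⟨⟨η, hm⟩, (mem_symmetricSubspace_iff _).2 hs⟩, fun n => rfl⟩

/-! ### Closedness of the basic operators -/

/-- Replaces the almost everywhere conditions by equalities between bounded maps of single sectors,
from which closedness of the graph is immediate. -/
theorem mem_annihilationGraph_iff (f : OneBoson d) (p : BoseFock d × BoseFock d) :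
    p ∈ annihilationGraph f ↔ ∀ n : ℕ, component d n p.2
      = (Real.sqrt (n + 1) : ℂ) • annih f (component d (n + 1) p.1) := by
  refine forall_congr' fun n => ?_
  constructor
  · intro h
    refine Lp.ext ?_
    filter_upwards [h, Lp.coeFn_smul (Real.sqrt (n + 1) : ℂ) (annih f (component d (n + 1) p.1)),
      annih_coeFn f (component d (n + 1) p.1)] with k a b c
    rw [a, b, Pi.smul_apply, c, smul_eq_mul]
  · intro h
    rw [h]
    filter_upwards [Lp.coeFn_smul (Real.sqrt (n + 1) : ℂ) (annih f (component d (n + 1) p.1)),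
      annih_coeFn f (component d (n + 1) p.1)] with k b c
    rw [b, Pi.smul_apply, c, smul_eq_mul]

theorem annihilation_graph (f : OneBoson d) : (annihilation f).graph = annihilationGraph f := by
  refine Submodule.toLinearPMap_graph_eq _ ?_
  rintro ⟨x, y⟩ hp hx
  simp only at hx ⊢
  subst hx
  refine fock_ext fun n => ?_
  rw [(mem_annihilationGraph_iff f _).1 hp n]
  simp

theorem annihilation_isClosed (f : OneBoson d) : (annihilation f).IsClosed := by
  rw [LinearPMap.IsClosed, annihilation_graph]
  have : (annihilationGraph f : Set (BoseFock d × BoseFock d)) = ⋂ n : ℕ,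
      {p | component d n p.2 = (Real.sqrt (n + 1) : ℂ) • annih f (component d (n + 1) p.1)} := by
    ext p
    simp only [SetLike.mem_coe, mem_annihilationGraph_iff, Set.mem_iInter, Set.mem_ofPred_eq]
  rw [this]
  refine isClosed_iInter fun n => isClosed_eq ((continuous_component n).comp continuous_snd) ?_
  have hc : Continuous fun p : BoseFock d × BoseFock d => annih f (component d (n + 1) p.1) :=
    (annih f).continuous.comp ((continuous_component _).comp continuous_fst)
  exact hc.const_smul (Real.sqrt (n + 1) : ℂ)

/-- The energy function `ω(k₁) + ⋯ + ω(kₙ)`. -/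
def totalEnergy (ω : Momentum d → ℝ) {n : ℕ} (k : Fin n → Momentum d) : ℝ := ∑ i, ω (k i)

theorem measurable_totalEnergy {ω : Momentum d → ℝ} (hω : Measurable ω) (n : ℕ) :
    Measurable (totalEnergy ω : (Fin n → Momentum d) → ℝ) :=
  Finset.measurable_sum _ fun i _ => hω.comp (measurable_pi_apply i)

/-- `W` may be unbounded, so the relation is restricted to `{|W| ≤ m}`, where both sides are bounded
operators. The graph is the intersection over `m` of these closed sets. -/
theorem isClosed_mulGraph {X : Type*} [MeasurableSpace X] {μ : Measure X} {W : X → ℝ}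
    (hW : Measurable W) : IsClosed {p : Lp ℂ 2 μ × Lp ℂ 2 μ | ∀ᵐ x ∂μ, p.2 x = (W x : ℂ) * p.1 x} := by
  have h1 : ∀ m : ℕ, MemLp ({x | |W x| ≤ m}.indicator fun x => (W x : ℂ)) ∞ μ := by
    intro m
    refine memLp_top_of_bound (C := m) ?_ (Eventually.of_forall fun x => ?_)
    · exact ((Complex.measurable_ofReal.comp hW).indicator
        (measurableSet_le hW.abs measurable_const)).aestronglyMeasurable
    · by_cases hx : |W x| ≤ m
      · simp [hx]
      · simp [hx]
  have h2 : ∀ m : ℕ, MemLp ({x | |W x| ≤ m}.indicator fun _ => (1 : ℂ)) ∞ μ := by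
    intro m
    refine memLp_top_of_bound (C := 1) ?_ (Eventually.of_forall fun x => ?_)
    · exact (measurable_const.indicator
        (measurableSet_le hW.abs measurable_const)).aestronglyMeasurable
    · by_cases hx : |W x| ≤ m
      · simp [hx]
      · simp [hx]
  have : {p : Lp ℂ 2 μ × Lp ℂ 2 μ | ∀ᵐ x ∂μ, p.2 x = (W x : ℂ) * p.1 x}
      = ⋂ m : ℕ, {p | mulL (h2 m) p.2 = mulL (h1 m) p.1} := by
    ext p
    simp only [Set.mem_iInter, Set.mem_ofPred_eq]
    constructor
    · intro h m
      refine Lp.ext ?_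
      filter_upwards [h, mulL_coeFn (h1 m) p.1, mulL_coeFn (h2 m) p.2] with x a b c
      rw [b, c, a]
      by_cases hx : |W x| ≤ m <;> simp [hx]
    · intro h
      have h3 : ∀ m : ℕ, ∀ᵐ x ∂μ, ({x | |W x| ≤ m}.indicator (fun _ => (1 : ℂ)) x) * p.2 x
          = ({x | |W x| ≤ m}.indicator (fun x => (W x : ℂ)) x) * p.1 x := by
        intro m
        have h4 := mulL_coeFn (h2 m) p.2
        rw [h m] at h4
        filter_upwards [h4, mulL_coeFn (h1 m) p.1] with x a b
        rw [← a, ← b]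
      filter_upwards [ae_all_iff.2 h3] with x hx
      obtain ⟨m, hm⟩ := exists_nat_ge |W x|
      have := hx m
      simpa [hm] using this
  rw [this]
  exact isClosed_iInter fun m => isClosed_eq ((mulL (h2 m)).continuous.comp continuous_snd)
    ((mulL (h1 m)).continuous.comp continuous_fst)

theorem fieldEnergy_graph (ω : Momentum d → ℝ) : (fieldEnergy ω).graph = fieldEnergyGraph ω := by
  refine Submodule.toLinearPMap_graph_eq _ ?_
  rintro ⟨x, y⟩ hp hx
  simp only at hx ⊢
  subst hx
  refine fock_ext fun n => Lp.ext ?_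
  rw [map_zero]
  filter_upwards [hp n, Lp.coeFn_zero ℂ 2 (volume : Measure (Fin n → Momentum d))] with k a b
  simp only [map_zero] at a
  rw [a, b]
  simp

theorem fieldEnergy_isClosed {ω : Momentum d → ℝ} (hω : Measurable ω) :
    (fieldEnergy ω).IsClosed := by
  rw [LinearPMap.IsClosed, fieldEnergy_graph]
  have : (fieldEnergyGraph ω : Set (BoseFock d × BoseFock d)) = ⋂ n : ℕ,
      (fun p : BoseFock d × BoseFock d => (component d n p.1, component d n p.2)) ⁻¹'
        {p | ∀ᵐ k, p.2 k = (totalEnergy ω k : ℂ) * p.1 k} := by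
    ext p
    simp only [SetLike.mem_coe, Set.mem_iInter, Set.mem_preimage]
    rfl
  rw [this]
  refine isClosed_iInter fun n => (isClosed_mulGraph (measurable_totalEnergy hω n)).preimage ?_
  exact ((continuous_component n).comp continuous_fst).prodMk
    ((continuous_component n).comp continuous_snd)

/-! ### Components of vectors in the state space -/

variable {𝒦 : Type*} [NormedAddCommGroup 𝒦] [InnerProductSpace ℂ 𝒦] {κ : Type*}
  (b : HilbertBasis κ ℂ 𝒦)

/-- The component of a vector in the state space along a basis vector of `𝒦` in the `n`-boson
sector. -/
def sector (i : κ × ℕ) : StateSpace 𝒦 d →L[ℂ] NBoson d i.2 := (compL d i.2).comp (slice (b i.1))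

theorem hasSum_norm_sq_sector (x : StateSpace 𝒦 d) :
    HasSum (fun i => ‖sector b i x‖ ^ 2) (‖x‖ ^ 2) := by
  have h1 : ∀ a, HasSum (fun n => ‖sector b (a, n) x‖ ^ 2) (‖slice (b a) x‖ ^ 2) :=
    fun a => hasSum_norm_sq_component (slice (b a) x)
  have h2 : Summable (fun i => ‖sector b i x‖ ^ 2) := by
    refine (summable_prod_of_nonneg fun i => by positivity).2 ⟨fun a => (h1 a).summable, ?_⟩
    simp only [(h1 _).tsum_eq]
    exact (hasSum_norm_sq_slice b x).summable
  have h3 := h2.hasSum.prod_fiberwise h1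
  rw [(hasSum_norm_sq_slice b x).unique h3]
  exact h2.hasSum

theorem hasSum_inner_sector (x y : StateSpace 𝒦 d) :
    HasSum (fun i => inner ℂ (sector b i x) (sector b i y)) (inner ℂ x y) := by
  have h1 : ∀ a, HasSum (fun n => inner ℂ (sector b (a, n) x) (sector b (a, n) y))
      (inner ℂ (slice (b a) x) (slice (b a) y)) :=
    fun a => hasSum_inner_component (slice (b a) x) (slice (b a) y)
  have h2 : Summable (fun i => inner ℂ (sector b i x) (sector b i y)) := by
    refine Summable.of_norm_bounded ((hasSum_norm_sq_sector b x).summable.add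
      (hasSum_norm_sq_sector b y).summable) fun i => ?_
    refine (norm_inner_le_norm _ _).trans ?_
    nlinarith [sq_nonneg (‖sector b i x‖ - ‖sector b i y‖), sq_nonneg ‖sector b i x‖,
      sq_nonneg ‖sector b i y‖]
  have h3 := h2.hasSum.prod_fiberwise h1
  rw [(hasSum_inner_slice b x y).unique h3]
  exact h2.hasSum

end Fock

end BoseField

end

noncomputable section

namespace BoseField

/-! ### Relative bounds for annihilation operators -/

section RelativeBounds

theorem lintegral_mul_sq_le {X : Type*} [MeasurableSpace X] {μ : Measure X} {u v : X → ℝ≥0∞}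
    (hu : AEMeasurable u μ) (hv : AEMeasurable v μ) :
    (∫⁻ x, u x * v x ∂μ) ^ 2 ≤ (∫⁻ x, u x ^ 2 ∂μ) * ∫⁻ x, v x ^ 2 ∂μ := by
  have h := ENNReal.lintegral_mul_le_Lp_mul_Lq μ Real.HolderConjugate.two_two hu hv
  have h2 := pow_le_pow_left' h 2
  rw [mul_pow, ← ENNReal.rpow_natCast, ← ENNReal.rpow_natCast (_ ^ _), ← ENNReal.rpow_mul,
    ← ENNReal.rpow_natCast (_ ^ _), ← ENNReal.rpow_mul] at h2
  norm_num at h2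
  simpa using h2

theorem enorm_sq_eq_lintegral {X : Type*} [MeasurableSpace X] {μ : Measure X} (f : Lp ℂ 2 μ) :
    ‖f‖ₑ ^ 2 = ∫⁻ x, ‖f x‖ₑ ^ 2 ∂μ := by
  have h := eLpNorm_eq_lintegral_rpow_enorm_toReal (p := 2) (f := f) (μ := μ) (by norm_num)
    (by norm_num)
  rw [Lp.enorm_def, h, ← ENNReal.rpow_natCast, ← ENNReal.rpow_mul]
  simp

theorem enorm_inner_L2_le {X : Type*} [MeasurableSpace X] {μ : Measure X} (f g : Lp ℂ 2 μ) :
    ‖inner ℂ f g‖ₑ ≤ ∫⁻ x, ‖f x‖ₑ * ‖g x‖ₑ ∂μ := by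
  rw [L2.inner_def]
  refine (enorm_integral_le_lintegral_enorm _).trans (lintegral_mono fun x => ?_)
  rw [RCLike.inner_apply, enorm_mul, mul_comm]
  simp

/-- Cauchy–Schwarz after inserting `1 = √a · √(1/a)`. The weight is `1/ω(x 0)` in the estimate for
`a(f)` and `totalEnergy ω x / ω(x 0)` in the one for its adjoint. -/
theorem enorm_inner_sq_le_weighted {X : Type*} [MeasurableSpace X] {μ : Measure X}
    (f g : Lp ℂ 2 μ) {a : X → ℝ} (ha : Measurable a) (hpos : ∀ᵐ x ∂μ, 0 < a x) :
    ‖inner ℂ f g‖ₑ ^ 2 ≤ (∫⁻ x, ENNReal.ofReal (a x) * ‖f x‖ₑ ^ 2 ∂μ)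
      * ∫⁻ x, ENNReal.ofReal (1 / a x) * ‖g x‖ₑ ^ 2 ∂μ := by
  have hfm : AEMeasurable (fun x => ‖f x‖ₑ) μ := (Lp.aestronglyMeasurable f).enorm
  have hgm : AEMeasurable (fun x => ‖g x‖ₑ) μ := (Lp.aestronglyMeasurable g).enorm
  have h1 : ∫⁻ x, ‖f x‖ₑ * ‖g x‖ₑ ∂μ = ∫⁻ x, (ENNReal.ofReal (Real.sqrt (a x)) * ‖f x‖ₑ)
      * (ENNReal.ofReal (Real.sqrt (1 / a x)) * ‖g x‖ₑ) ∂μ := by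
    refine lintegral_congr_ae ?_
    filter_upwards [hpos] with x hx
    rw [mul_mul_mul_comm, ← ENNReal.ofReal_mul (Real.sqrt_nonneg _), ← Real.sqrt_mul hx.le,
      mul_one_div_cancel hx.ne']
    simp
  have h2 : ∀ {c : ℝ} (z : ℝ≥0∞), 0 ≤ c → (ENNReal.ofReal (Real.sqrt c) * z) ^ 2
      = ENNReal.ofReal c * z ^ 2 := by
    intro c z hc
    rw [mul_pow, ← ENNReal.ofReal_pow (Real.sqrt_nonneg _), Real.sq_sqrt hc]
  refine (pow_le_pow_left' (enorm_inner_L2_le f g) 2).trans ?_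
  rw [h1]
  refine (lintegral_mul_sq_le ((by fun_prop : AEMeasurable _ μ)) (by fun_prop)).trans
    (le_of_eq ?_)
  congr 1 <;>
  · refine lintegral_congr_ae ?_
    filter_upwards [hpos] with x hx
    exact h2 _ (by positivity)

variable {d : ℕ}

/-- For symmetric functions all variables contribute equally. -/
theorem lintegral_sum_symm {n : ℕ} {Ψ : NBoson d (n + 1)}
    (hΨ : ∀ σ, permL σ Ψ = Ψ) {g : Momentum d → ℝ≥0∞} (hg : Measurable g)
    {w : (Fin (n + 1) → Momentum d) → ℝ≥0∞} (hw : Measurable w)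
    (hws : ∀ (σ : Equiv.Perm (Fin (n + 1))) k, w (k ∘ σ) = w k) :
    ∫⁻ x, (∑ i, g (x i)) * (w x * ‖Ψ x‖ₑ ^ 2)
      = (n + 1 : ℝ≥0∞) * ∫⁻ x, g (x 0) * (w x * ‖Ψ x‖ₑ ^ 2) := by
  have hΨm : Measurable fun x => ‖Ψ x‖ₑ ^ 2 := (Lp.stronglyMeasurable Ψ).enorm.pow_const 2
  have h1 : ∀ i : Fin (n + 1), ∫⁻ x, g (x i) * (w x * ‖Ψ x‖ₑ ^ 2)
      = ∫⁻ x, g (x 0) * (w x * ‖Ψ x‖ₑ ^ 2) := by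
    intro i
    have hmp := measurePreserving_perm (d := d) (Equiv.swap 0 i)
    rw [← hmp.lintegral_comp (f := fun x => g (x 0) * (w x * ‖Ψ x‖ₑ ^ 2))]
    · refine lintegral_congr_ae ?_
      filter_upwards [(permL_eq_iff _ _).1 (hΨ (Equiv.swap 0 i))] with x hx
      rw [hws, hx]
      simp
    · exact (hg.comp (measurable_pi_apply 0)).mul (hw.mul hΨm)
  simp only [Finset.sum_mul]
  have h2 : ∀ i : Fin (n + 1), Measurable fun x : Fin (n + 1) → Momentum d =>
      g (x i) * (w x * ‖Ψ x‖ₑ ^ 2) :=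
    fun i => (hg.comp (measurable_pi_apply i)).mul (hw.mul hΨm)
  rw [lintegral_finsetSum _ fun i _ => h2 i]
  simp only [h1]
  simp

theorem lintegral_cons_mul {n : ℕ} {A : Momentum d → ℝ≥0∞} {B : (Fin n → Momentum d) → ℝ≥0∞}
    (hA : AEMeasurable A) (hB : AEMeasurable B) :
    ∫⁻ x : Fin (n + 1) → Momentum d, A (x 0) * B (Fin.tail x) = (∫⁻ q, A q) * ∫⁻ k, B k := by
  have hAB : AEMeasurable (fun p : (Fin n → Momentum d) × Momentum d => B p.1 * A p.2)
      (volume.prod volume) := hB.comp_fst.mul hA.comp_snd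
  have h2 : ∫⁻ x : Fin (n + 1) → Momentum d, A (x 0) * B (Fin.tail x)
      = ∫⁻ p : (Fin n → Momentum d) × Momentum d, B p.1 * A p.2 ∂(volume.prod volume) := by
    rw [← (measurePreserving_split d n).map_eq, lintegral_map' ?_ ?_]
    · simp only [mul_comm]
    · rwa [(measurePreserving_split d n).map_eq]
    · exact (measurePreserving_split d n).measurable.aemeasurable
  rw [h2, lintegral_prod_mul hB hA, mul_comm]

variable {ω : Momentum d → ℝ}

theorem totalEnergy_nonneg (hnn : ∀ k, 0 ≤ ω k) {n : ℕ} (k : Fin n → Momentum d) :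
    0 ≤ totalEnergy ω k := Finset.sum_nonneg fun i _ => hnn (k i)

theorem totalEnergy_succ {n : ℕ} (k : Fin (n + 1) → Momentum d) :
    totalEnergy ω k = ω (k 0) + totalEnergy ω (Fin.tail k) := Fin.sum_univ_succ _

theorem totalEnergy_perm {n : ℕ} (σ : Equiv.Perm (Fin n)) (k : Fin n → Momentum d) :
    totalEnergy ω (k ∘ σ) = totalEnergy ω k := Equiv.sum_comp σ fun i => ω (k i)

theorem ofReal_totalEnergy (hnn : ∀ k, 0 ≤ ω k) {n : ℕ} (k : Fin n → Momentum d) :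
    ENNReal.ofReal (totalEnergy ω k) = ∑ i, ENNReal.ofReal (ω (k i)) :=
  ENNReal.ofReal_sum_of_nonneg fun i _ => hnn (k i)

theorem enorm_consTensor_sq_coeFn {n : ℕ} (f : OneBoson d) (φ : NBoson d n) :
    (fun x => ‖consTensor d n f φ x‖ₑ ^ 2)
      =ᵐ[volume] fun x => ‖f (x 0)‖ₑ ^ 2 * ‖φ (Fin.tail x)‖ₑ ^ 2 := by
  filter_upwards [consTensor_coeFn f φ] with x hx
  rw [hx, enorm_mul, mul_pow]

/-- Sector version of `‖a(f)Ψ‖² ≤ ‖f/√ω‖² ⟨Ψ, dΓ(ω)Ψ⟩`. The weight `1/ω(x 0)` isolates `∫ |f|²/ω`,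
and by symmetry `n + 1` copies of `ω(x 0)` add up to the total energy. -/
theorem enorm_annih_sq_le (hω : Measurable ω) (hnn : ∀ k, 0 ≤ ω k) (hpos : ∀ᵐ k, 0 < ω k)
    (f : OneBoson d) {C : ℝ}
    (hC : ∫⁻ q, ENNReal.ofReal (1 / ω q) * ‖f q‖ₑ ^ 2 ≤ ENNReal.ofReal C) {n : ℕ}
    {Ψ : NBoson d (n + 1)} (hΨ : ∀ σ, permL σ Ψ = Ψ) :
    (n + 1 : ℝ≥0∞) * ‖annih f Ψ‖ₑ ^ 2
      ≤ ENNReal.ofReal C * ∫⁻ x, ENNReal.ofReal (totalEnergy ω x) * ‖Ψ x‖ₑ ^ 2 := by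
  have hfm : AEMeasurable (fun x => ‖f x‖ₑ ^ 2) :=
    (Lp.aestronglyMeasurable f).enorm.pow_const 2
  have hω0 : Measurable fun x : Fin (n + 1) → Momentum d => 1 / ω (x 0) :=
    (hω.comp (measurable_pi_apply 0)).const_div 1
  have h1 := enorm_inner_sq_le_weighted (consTensor d n f (annih f Ψ)) Ψ hω0 (by
    filter_upwards [(quasiMeasurePreserving_zero d n).ae hpos] with x hx
    exact one_div_pos.2 hx)
  have h2 : ∫⁻ x, ENNReal.ofReal (1 / ω (x 0)) * ‖consTensor d n f (annih f Ψ) x‖ₑ ^ 2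
      ≤ ENNReal.ofReal C * ‖annih f Ψ‖ₑ ^ 2 := by
    rw [enorm_sq_eq_lintegral (annih f Ψ)]
    refine le_trans (le_of_eq ?_) (mul_le_mul_left hC _)
    have hA : AEMeasurable fun q => ENNReal.ofReal (1 / ω q) * ‖f q‖ₑ ^ 2 :=
      (hω.const_div 1).ennreal_ofReal.aemeasurable.mul hfm
    rw [← lintegral_cons_mul hA
      ((Lp.aestronglyMeasurable (annih f Ψ)).enorm.pow_const 2)]
    refine lintegral_congr_ae ?_
    filter_upwards [enorm_consTensor_sq_coeFn f (annih f Ψ)] with x hx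
    rw [hx, ← mul_assoc]
  have h3 : (n + 1 : ℝ≥0∞) * ∫⁻ x, ENNReal.ofReal (1 / (1 / ω (x 0))) * ‖Ψ x‖ₑ ^ 2
      = ∫⁻ x, ENNReal.ofReal (totalEnergy ω x) * ‖Ψ x‖ₑ ^ 2 := by
    have := lintegral_sum_symm hΨ hω.ennreal_ofReal (w := fun _ => 1) measurable_const
      fun _ _ => rfl
    simp only [one_mul] at this
    simp only [one_div_one_div]
    rw [← this]
    simp only [ofReal_totalEnergy hnn]
  rw [← inner_annih_right, inner_self_eq_norm_sq_to_K] at h1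
  have h4 : ‖((‖annih f Ψ‖ : ℂ)) ^ 2‖ₑ = ‖annih f Ψ‖ₑ ^ 2 := by
    rw [enorm_pow]
    simp [← ofReal_norm]
  erw [h4] at h1
  have h5 : ‖annih f Ψ‖ₑ ^ 2 * ‖annih f Ψ‖ₑ ^ 2 ≤ ‖annih f Ψ‖ₑ ^ 2 * (ENNReal.ofReal C *
      ∫⁻ x, ENNReal.ofReal (1 / (1 / ω (x 0))) * ‖Ψ x‖ₑ ^ 2) := by
    rw [← sq]
    refine h1.trans ((mul_le_mul_left h2 _).trans (le_of_eq ?_))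
    ring
  by_cases h0 : ‖annih f Ψ‖ₑ ^ 2 = 0
  · rw [h0]; simp
  · have h6 := (ENNReal.mul_le_mul_iff_right h0 (by simp)).1 h5
    rw [← h3, mul_left_comm]
    exact mul_le_mul_right h6 _

/-- The bound for the adjoint of `a(f)`, obtained without a creation operator. With `W` the total
energy and weight `W/ω(x 0) = 1 + W(tail)/ω(x 0)`, the first factor of Cauchy–Schwarz splits into
the two terms shown, while by symmetry the `n + 1` copies of `ω(x 0)/W` sum to at most `1`. -/
theorem enorm_inner_consTensor_sq_le (hω : Measurable ω) (hnn : ∀ k, 0 ≤ ω k)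
    (hpos : ∀ᵐ k, 0 < ω k) (f : OneBoson d) {C : ℝ}
    (hC : ∫⁻ q, ENNReal.ofReal (1 / ω q) * ‖f q‖ₑ ^ 2 ≤ ENNReal.ofReal C) {n : ℕ}
    (φ : NBoson d n) {Ψ : NBoson d (n + 1)} (hΨ : ∀ σ, permL σ Ψ = Ψ) :
    (n + 1 : ℝ≥0∞) * ‖inner ℂ (consTensor d n f φ) Ψ‖ₑ ^ 2
      ≤ (‖f‖ₑ ^ 2 * ‖φ‖ₑ ^ 2 + ENNReal.ofReal C *
        ∫⁻ x, ENNReal.ofReal (totalEnergy ω x) * ‖φ x‖ₑ ^ 2) * ‖Ψ‖ₑ ^ 2 := by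
  have hfm : AEMeasurable (fun x => ‖f x‖ₑ ^ 2) :=
    (Lp.aestronglyMeasurable f).enorm.pow_const 2
  have hφm : AEMeasurable (fun x => ‖φ x‖ₑ ^ 2) :=
    (Lp.aestronglyMeasurable φ).enorm.pow_const 2
  have hW : Measurable (totalEnergy ω : (Fin n → Momentum d) → ℝ) := measurable_totalEnergy hω n
  have hW' : Measurable (totalEnergy ω : (Fin (n + 1) → Momentum d) → ℝ) :=
    measurable_totalEnergy hω (n + 1)
  have hω0 : Measurable fun x : Fin (n + 1) → Momentum d => ω (x 0) :=
    hω.comp (measurable_pi_apply 0)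
  have hp0 := (quasiMeasurePreserving_zero d n).ae hpos
  have h1 := enorm_inner_sq_le_weighted (consTensor d n f φ) Ψ (hW'.div hω0) (by
    filter_upwards [hp0] with x hx
    refine div_pos ?_ hx
    rw [totalEnergy_succ]
    exact add_pos_of_pos_of_nonneg hx (totalEnergy_nonneg hnn _))
  have h2 : ∫⁻ x, ENNReal.ofReal (totalEnergy ω x / ω (x 0)) * ‖consTensor d n f φ x‖ₑ ^ 2
      ≤ ‖f‖ₑ ^ 2 * ‖φ‖ₑ ^ 2 + ENNReal.ofReal C *
        ∫⁻ x, ENNReal.ofReal (totalEnergy ω x) * ‖φ x‖ₑ ^ 2 := by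
    rw [enorm_sq_eq_lintegral f, enorm_sq_eq_lintegral φ]
    refine le_trans (le_of_eq ?_) (add_le_add_right (mul_le_mul_left hC _) _)
    have hA : AEMeasurable fun q => ENNReal.ofReal (1 / ω q) * ‖f q‖ₑ ^ 2 :=
      (hω.const_div 1).ennreal_ofReal.aemeasurable.mul hfm
    have hB : AEMeasurable fun k : Fin n → Momentum d =>
        ENNReal.ofReal (totalEnergy ω k) * ‖φ k‖ₑ ^ 2 :=
      hW.ennreal_ofReal.aemeasurable.mul hφm
    rw [← lintegral_cons_mul hfm hφm, ← lintegral_cons_mul hA hB, ← lintegral_add_left']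
    · refine lintegral_congr_ae ?_
      filter_upwards [enorm_consTensor_sq_coeFn f φ, hp0] with x hx hx0
      have e : totalEnergy ω x / ω (x 0) = 1 + 1 / ω (x 0) * totalEnergy ω (Fin.tail x) := by
        rw [totalEnergy_succ]; field_simp
      rw [hx, e, ENNReal.ofReal_add zero_le_one
        (mul_nonneg (one_div_pos.2 hx0).le (totalEnergy_nonneg hnn _)),
        ENNReal.ofReal_mul (one_div_pos.2 hx0).le, ENNReal.ofReal_one]
      ring
    · exact (hfm.comp_quasiMeasurePreserving (quasiMeasurePreserving_zero d n)).mul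
        (hφm.comp_quasiMeasurePreserving (quasiMeasurePreserving_tail d n))
  have h3 : (n + 1 : ℝ≥0∞) * ∫⁻ x, ENNReal.ofReal (1 / (totalEnergy ω x / ω (x 0))) * ‖Ψ x‖ₑ ^ 2
      ≤ ‖Ψ‖ₑ ^ 2 := by
    have h4 := lintegral_sum_symm hΨ hω.ennreal_ofReal
      (w := fun x => ENNReal.ofReal (1 / totalEnergy ω x)) (hW'.const_div 1).ennreal_ofReal
      fun σ k => by rw [totalEnergy_perm]
    have h5 : ∫⁻ x, ENNReal.ofReal (1 / (totalEnergy ω x / ω (x 0))) * ‖Ψ x‖ₑ ^ 2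
        = ∫⁻ x, ENNReal.ofReal (ω (x 0)) * (ENNReal.ofReal (1 / totalEnergy ω x) *
          ‖Ψ x‖ₑ ^ 2) := by
      refine lintegral_congr fun x => ?_
      rw [← mul_assoc, ← ENNReal.ofReal_mul (hnn _)]
      congr 2
      rw [one_div_div, mul_one_div]
    rw [h5, ← h4, enorm_sq_eq_lintegral]
    refine lintegral_mono fun x => ?_
    rw [← ofReal_totalEnergy hnn, ← mul_assoc, ← ENNReal.ofReal_mul (totalEnergy_nonneg hnn _),
      mul_one_div]
    -- Only an inequality: where the total energy vanishes the quotient is `0` by convention.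
    refine (mul_le_mul_left (ENNReal.ofReal_le_ofReal (div_self_le_one _)) _).trans ?_
    simp
  refine (mul_le_mul_right h1 _).trans ?_
  rw [mul_left_comm]
  exact mul_le_mul' h2 h3

/-- Pointwise `t ≤ 1 + t²`. This trades the quadratic form of `dΓ(ω)` for its graph norm, so no
square root of the operator is needed. -/
theorem lintegral_totalEnergy_le (hnn : ∀ k, 0 ≤ ω k) {p : BoseFock d × BoseFock d}
    (hp : p ∈ fieldEnergyGraph ω) (n : ℕ) :
    ∫⁻ x, ENNReal.ofReal (totalEnergy ω x) * ‖component d n p.1 x‖ₑ ^ 2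
      ≤ ‖component d n p.1‖ₑ ^ 2 + ‖component d n p.2‖ₑ ^ 2 := by
  rw [enorm_sq_eq_lintegral, enorm_sq_eq_lintegral, ← lintegral_add_left'
    ((Lp.aestronglyMeasurable _).enorm.pow_const 2)]
  refine lintegral_mono_ae ?_
  filter_upwards [hp n] with k hk
  have h1 : ∀ x : ℝ≥0∞, x ≤ 1 + x ^ 2 := fun x => by
    rcases le_total x 1 with h | h
    · exact h.trans le_self_add
    · calc x = x * 1 := (mul_one x).symm
        _ ≤ x * x := mul_le_mul_right h x
        _ ≤ 1 + x ^ 2 := by rw [sq]; exact le_add_self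
  have h2 : ‖component d n p.2 k‖ₑ = ENNReal.ofReal (totalEnergy ω k) * ‖component d n p.1 k‖ₑ := by
    rw [hk, enorm_mul, ← ofReal_norm (((∑ i, ω (k i) : ℝ) : ℂ)), Complex.norm_real,
      Real.norm_of_nonneg (Finset.sum_nonneg fun i _ => hnn (k i))]
    rfl
  rw [h2, mul_pow]
  calc _ ≤ (1 + ENNReal.ofReal (totalEnergy ω k) ^ 2) * ‖component d n p.1 k‖ₑ ^ 2 :=
        mul_le_mul_left (h1 _) _
    _ = _ := by ring

theorem norm_annih_component_sq_le (hω : Measurable ω) (hnn : ∀ k, 0 ≤ ω k)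
    (hpos : ∀ᵐ k, 0 < ω k) (f : OneBoson d) {C : ℝ} (hC0 : 0 ≤ C)
    (hC : ∫⁻ q, ENNReal.ofReal (1 / ω q) * ‖f q‖ₑ ^ 2 ≤ ENNReal.ofReal C)
    {p : BoseFock d × BoseFock d} (hp : p ∈ fieldEnergyGraph ω) (n : ℕ) :
    (n + 1 : ℝ) * ‖annih f (component d (n + 1) p.1)‖ ^ 2
      ≤ C * (‖component d (n + 1) p.1‖ ^ 2 + ‖component d (n + 1) p.2‖ ^ 2) := by
  have h := (enorm_annih_sq_le hω hnn hpos f hC (permL_component (n + 1) · p.1)).trans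
    (mul_le_mul_right (lintegral_totalEnergy_le hnn hp (n + 1)) _)
  rw [← ENNReal.ofReal_le_ofReal_iff (by positivity)]
  refine le_trans (le_of_eq ?_) (h.trans (le_of_eq ?_))
  · rw [ENNReal.ofReal_mul (by positivity), ENNReal.ofReal_pow (norm_nonneg _), ofReal_norm]
    congr 1
    rw [ENNReal.ofReal_add (by positivity) zero_le_one]
    simp
  · symm
    rw [ENNReal.ofReal_mul hC0, ENNReal.ofReal_add (by positivity) (by positivity),
      ENNReal.ofReal_pow (norm_nonneg _), ENNReal.ofReal_pow (norm_nonneg _), ofReal_norm,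
      ofReal_norm]

theorem norm_inner_annih_component_sq_le (hω : Measurable ω) (hnn : ∀ k, 0 ≤ ω k)
    (hpos : ∀ᵐ k, 0 < ω k) (f : OneBoson d) {C : ℝ} (hC0 : 0 ≤ C)
    (hC : ∫⁻ q, ENNReal.ofReal (1 / ω q) * ‖f q‖ₑ ^ 2 ≤ ENNReal.ofReal C)
    {p : BoseFock d × BoseFock d} (hp : p ∈ fieldEnergyGraph ω) (n : ℕ)
    {Ψ : NBoson d (n + 1)} (hΨ : ∀ σ, permL σ Ψ = Ψ) :
    (n + 1 : ℝ) * ‖inner ℂ (component d n p.1) (annih f Ψ)‖ ^ 2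
      ≤ (‖f‖ ^ 2 * ‖component d n p.1‖ ^ 2
        + C * (‖component d n p.1‖ ^ 2 + ‖component d n p.2‖ ^ 2)) * ‖Ψ‖ ^ 2 := by
  have h := (enorm_inner_consTensor_sq_le hω hnn hpos f hC (component d n p.1) hΨ).trans
    (mul_le_mul_left (add_le_add_right
      (mul_le_mul_right (lintegral_totalEnergy_le hnn hp n) (ENNReal.ofReal C)) _) _)
  rw [← ENNReal.ofReal_le_ofReal_iff (by positivity)]
  rw [inner_annih_right]
  refine le_trans (le_of_eq ?_) (h.trans (le_of_eq ?_))
  · rw [ENNReal.ofReal_mul (by positivity), ENNReal.ofReal_pow (norm_nonneg _), ofReal_norm]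
    congr 1
    rw [ENNReal.ofReal_add (by positivity) zero_le_one]
    simp
  · symm
    rw [ENNReal.ofReal_mul (by positivity), ENNReal.ofReal_add (by positivity) (by positivity),
      ENNReal.ofReal_mul (by positivity), ENNReal.ofReal_mul hC0,
      ENNReal.ofReal_add (by positivity) (by positivity)]
    simp only [ENNReal.ofReal_pow (norm_nonneg _), ofReal_norm]

end RelativeBounds

end BoseField

end

noncomputable section

namespace BoseField

/-! ### Annihilation operators on the state space -/

section StateSpaceAnnihilation

variable {d : ℕ}

theorem permL_annih {n : ℕ} (f : OneBoson d) {Ψ : NBoson d (n + 1)}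
    (hΨ : ∀ σ, permL σ Ψ = Ψ) (σ : Equiv.Perm (Fin n)) : permL σ (annih f Ψ) = annih f Ψ := by
  rw [permL_eq_iff]
  -- `τ` fixes the contracted first variable and acts as `σ` on the remaining ones.
  let τ : Equiv.Perm (Fin (n + 1)) := Equiv.Perm.decomposeFin.symm (0, σ)
  have h1 := ae_ae_cons ((permL_eq_iff τ Ψ).1 (hΨ τ))
  filter_upwards [annih_coeFn f Ψ, (measurePreserving_perm σ).quasiMeasurePreserving.ae
    (annih_coeFn f Ψ), h1] with k a b c
  rw [a, b]
  refine integral_congr_ae ?_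
  filter_upwards [c] with q hq
  rw [← hq]
  congr 2
  funext i
  refine Fin.cases ?_ (fun j => ?_) i
  · simp [τ]
  · simp [τ]

variable {𝒦 : Type*} [NormedAddCommGroup 𝒦] [InnerProductSpace ℂ 𝒦] {κ : Type*}
  (b : HilbertBasis κ ℂ 𝒦)

theorem permL_sector (i : κ × ℕ) (σ : Equiv.Perm (Fin i.2)) (x : StateSpace 𝒦 d) :
    permL σ (sector b i x) = sector b i x := permL_component _ _ _

theorem exists_sector_eq (η : ∀ i : κ × ℕ, NBoson d i.2) (hs : ∀ i σ, permL σ (η i) = η i)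
    (h : Summable fun i => ‖η i‖ ^ 2) : ∃ y : StateSpace 𝒦 d, ∀ i, sector b i y = η i := by
  have h1 := (summable_prod_of_nonneg fun i => by positivity).1 h
  choose Ψ hΨ using fun a => exists_component_eq (fun n => η (a, n)) (fun n => hs (a, n)) (h1.1 a)
  have h2 : ∀ a, ‖Ψ a‖ ^ 2 = ∑' n, ‖η (a, n)‖ ^ 2 := by
    intro a
    have := hasSum_norm_sq_component (Ψ a)
    simp only [hΨ] at this
    exact this.tsum_eq.symm
  obtain ⟨y, hy⟩ := exists_slice_eq b Ψ (by simpa only [h2] using h1.2)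
  refine ⟨y, fun i => ?_⟩
  rw [← hΨ, ← hy]
  rfl

/-! ### Sector-wise matrix elements of the annihilation operator -/

/-- The matrix element of `1 ⊗ a(f)`, up to normalization, between the `n`-boson component of `x`
and the `(n+1)`-boson component of `y`. -/
def annihForm (f : OneBoson d) (n : ℕ) (x y : StateSpace 𝒦 d) : ℂ :=
  inner ℂ (tmap (ContinuousLinearMap.id ℂ 𝒦) (compL d n) x)
    (tmap (ContinuousLinearMap.id ℂ 𝒦) ((annih f).comp (compL d (n + 1))) y)

theorem hasSum_annihForm (f : OneBoson d) (n : ℕ) (x y : StateSpace 𝒦 d) :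
    HasSum (fun a => inner ℂ (sector b (a, n) x) (annih f (sector b (a, n + 1) y)))
      (annihForm f n x y) := by
  have := hasSum_inner_slice b (tmap (ContinuousLinearMap.id ℂ 𝒦) (compL d n) x)
    (tmap (ContinuousLinearMap.id ℂ 𝒦) ((annih f).comp (compL d (n + 1))) y)
  simp only [slice_tmap] at this
  exact this

theorem hasSum_inner_sectors (x y : StateSpace 𝒦 d) :
    ∃ g : ℕ → ℂ, (∀ n, HasSum (fun a => inner ℂ (sector b (a, n) x) (sector b (a, n) y)) (g n))
      ∧ HasSum g (inner ℂ x y) := by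
  have h := (Equiv.prodComm ℕ κ).hasSum_iff.2 (hasSum_inner_sector b x y)
  have h1 : ∀ n : ℕ, Summable fun a => inner ℂ (sector b (a, n) x) (sector b (a, n) y) :=
    fun n => h.summable.prod_factor n
  exact ⟨_, fun n => (h1 n).hasSum, h.prod_fiberwise fun n => (h1 n).hasSum⟩

/-! ### Domains -/

variable [CompleteSpace 𝒦]

theorem mem_oneTensor_annihilation_graph_iff (f : OneBoson d)
    (p : StateSpace 𝒦 d × StateSpace 𝒦 d) :
    p ∈ (oneTensor 𝒦 (annihilation f)).graph ↔ ∀ a n, sector b (a, n) p.2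
      = (Real.sqrt (n + 1) : ℂ) • annih f (sector b (a, n + 1) p.1) := by
  rw [oneTensor, mem_tensorOp_id_graph_iff b (annihilation_isClosed f), annihilation_graph]
  simp only [mem_annihilationGraph_iff]
  rfl

theorem mem_oneTensor_fieldEnergy_graph_iff {ω : Momentum d → ℝ} (hω : Measurable ω)
    (p : StateSpace 𝒦 d × StateSpace 𝒦 d) :
    p ∈ (oneTensor 𝒦 (fieldEnergy ω)).graph ↔
      ∀ a, (slice (b a) p.1, slice (b a) p.2) ∈ fieldEnergyGraph ω := by
  rw [oneTensor, mem_tensorOp_id_graph_iff b (fieldEnergy_isClosed hω), fieldEnergy_graph]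

section Domains

variable {ω : Momentum d → ℝ} (hω : Measurable ω) (hnn : ∀ k, 0 ≤ ω k) (hpos : ∀ᵐ k, 0 < ω k)
  (f : OneBoson d) {C : ℝ} (hC0 : 0 ≤ C)
  (hC : ∫⁻ q, ENNReal.ofReal (1 / ω q) * ‖f q‖ₑ ^ 2 ≤ ENNReal.ofReal C)

-- The domain of `1 ⊗ dΓ(ω)` is contained in that of `1 ⊗ a(f)`. The image is assembled sector by
-- sector; the sector bounds are summable because the shift `n ↦ n + 1` is injective.
include hω hnn hpos hC0 hC in
theorem exists_annihilation_apply {p : StateSpace 𝒦 d × StateSpace 𝒦 d}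
    (hp : p ∈ (oneTensor 𝒦 (fieldEnergy ω)).graph) :
    ∃ y, (p.1, y) ∈ (oneTensor 𝒦 (annihilation f)).graph
      ∧ ‖y‖ ^ 2 ≤ C * (‖p.1‖ ^ 2 + ‖p.2‖ ^ 2) := by
  obtain ⟨w, b, -⟩ := exists_hilbertBasis ℂ 𝒦
  rw [mem_oneTensor_fieldEnergy_graph_iff b hω] at hp
  let η : ∀ i : w × ℕ, NBoson d i.2 := fun i =>
    (Real.sqrt (i.2 + 1) : ℂ) • annih f (sector b (i.1, i.2 + 1) p.1)
  have h1 : ∀ i : w × ℕ, ‖η i‖ ^ 2 ≤ C * (‖sector b (i.1, i.2 + 1) p.1‖ ^ 2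
      + ‖sector b (i.1, i.2 + 1) p.2‖ ^ 2) := by
    intro i
    have := norm_annih_component_sq_le hω hnn hpos f hC0 hC (hp i.1) i.2
    rw [norm_smul, mul_pow, Complex.norm_real, Real.norm_of_nonneg (Real.sqrt_nonneg _),
      Real.sq_sqrt (by positivity)]
    exact this
  have hinj : Function.Injective fun i : w × ℕ => (i.1, i.2 + 1) := by
    rintro ⟨a, n⟩ ⟨a', n'⟩ h
    simpa using h
  have h2 := (((hasSum_norm_sq_sector b p.1).add (hasSum_norm_sq_sector b p.2)).mul_left C)
  have h3 := h2.summable.comp_injective hinj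
  have h4 : Summable fun i => ‖η i‖ ^ 2 := h3.of_nonneg_of_le (fun i => by positivity) h1
  obtain ⟨y, hy⟩ := exists_sector_eq b η (fun i σ => by
    rw [map_smul, permL_annih f (fun σ => permL_sector b (i.1, i.2 + 1) σ p.1)]) h4
  refine ⟨y, (mem_oneTensor_annihilation_graph_iff b f _).2 fun a n => hy (a, n), ?_⟩
  rw [← (hasSum_norm_sq_sector b y).tsum_eq, ← h2.tsum_eq]
  simp only [hy]
  refine (h4.tsum_le_tsum h1 h3).trans ?_
  exact tsum_comp_le_tsum_of_inj h2.summable (fun i => by positivity) hinj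

-- Membership in the adjoint domain means that `Ψ ↦ ⟨p.1, a(f)Ψ⟩` is bounded. The sector estimates,
-- with `√(n+1)` absorbed into them, give a summable family `B`, and Cauchy–Schwarz over the sectors
-- finishes.
include hω hnn hpos hC0 hC in
theorem mem_annihilation_adjoint_domain {p : StateSpace 𝒦 d × StateSpace 𝒦 d}
    (hp : p ∈ (oneTensor 𝒦 (fieldEnergy ω)).graph) :
    p.1 ∈ (oneTensor 𝒦 (annihilation f))†.domain := by
  obtain ⟨w, b, -⟩ := exists_hilbertBasis ℂ 𝒦
  rw [mem_oneTensor_fieldEnergy_graph_iff b hω] at hp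
  let B : w × ℕ → ℝ := fun i => ‖f‖ ^ 2 * ‖sector b i p.1‖ ^ 2
    + C * (‖sector b i p.1‖ ^ 2 + ‖sector b i p.2‖ ^ 2)
  have hB0 : ∀ i, 0 ≤ B i := fun i => by positivity
  have hB : Summable B := ((hasSum_norm_sq_sector b p.1).summable.mul_left _).add
    (((hasSum_norm_sq_sector b p.1).summable.add
      (hasSum_norm_sq_sector b p.2).summable).mul_left C)
  rw [LinearPMap.mem_adjoint_domain_iff]
  refine AddMonoidHomClass.continuous_of_bound _ (Real.sqrt (∑' i, B i)) fun Ψ => ?_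
  change ‖inner ℂ p.1 (oneTensor 𝒦 (annihilation f) Ψ)‖ ≤ _
  have hg := (mem_oneTensor_annihilation_graph_iff b f _).1
    ((oneTensor 𝒦 (annihilation f)).mem_graph Ψ)
  have hs := hasSum_inner_sector b p.1 (oneTensor 𝒦 (annihilation f) Ψ)
  refine le_of_tendsto hs.norm (Eventually.of_forall fun s => ?_)
  have hinj : Function.Injective fun i : w × ℕ => (i.1, i.2 + 1) := by
    rintro ⟨a, n⟩ ⟨a', n'⟩ h
    simpa using h
  have h1 : ∀ i : w × ℕ, ‖inner ℂ (sector b i p.1)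
      (sector b i (oneTensor 𝒦 (annihilation f) Ψ))‖
        ≤ Real.sqrt (B i) * ‖sector b (i.1, i.2 + 1) (Ψ : StateSpace 𝒦 d)‖ := by
    rintro ⟨a, n⟩
    rw [hg a n, inner_smul_right, norm_mul, Complex.norm_real,
      Real.norm_of_nonneg (Real.sqrt_nonneg _)]
    refine abs_le_of_sq_le_sq' ?_ (by positivity) |>.2
    rw [mul_pow, mul_pow, Real.sq_sqrt (by positivity), Real.sq_sqrt (hB0 _)]
    exact norm_inner_annih_component_sq_le hω hnn hpos f hC0 hC (hp a) n
      (fun σ => permL_sector b (a, n + 1) σ (Ψ : StateSpace 𝒦 d))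
  calc ‖∑ i ∈ s, inner ℂ (sector b i p.1) (sector b i (oneTensor 𝒦 (annihilation f) Ψ))‖
      ≤ ∑ i ∈ s, Real.sqrt (B i) * ‖sector b (i.1, i.2 + 1) (Ψ : StateSpace 𝒦 d)‖ :=
        (norm_sum_le _ _).trans (Finset.sum_le_sum fun i _ => h1 i)
    _ ≤ Real.sqrt (∑ i ∈ s, Real.sqrt (B i) ^ 2)
        * Real.sqrt (∑ i ∈ s, ‖sector b (i.1, i.2 + 1) (Ψ : StateSpace 𝒦 d)‖ ^ 2) :=
        Real.sum_mul_le_sqrt_mul_sqrt _ _ _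
    _ ≤ Real.sqrt (∑' i, B i) * ‖Ψ‖ := by
        gcongr
        · simp only [Real.sq_sqrt (hB0 _)]
          exact hB.sum_le_tsum s fun i _ => hB0 i
        · rw [Real.sqrt_le_left (norm_nonneg _)]
          have h2 := (hasSum_norm_sq_sector b (Ψ : StateSpace 𝒦 d))
          have h3 := h2.summable.comp_injective hinj
          rw [show ‖Ψ‖ = ‖(Ψ : StateSpace 𝒦 d)‖ from rfl, ← h2.tsum_eq]
          exact (h3.sum_le_tsum s fun i _ => sq_nonneg _).trans
            (tsum_comp_le_tsum_of_inj h2.summable (fun i => by positivity) hinj)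

end Domains

theorem hasSum_inner_annihilation {f : OneBoson d} (x : StateSpace 𝒦 d)
    {p : StateSpace 𝒦 d × StateSpace 𝒦 d} (hp : p ∈ (oneTensor 𝒦 (annihilation f)).graph) :
    HasSum (fun n : ℕ => (Real.sqrt (n + 1) : ℂ) * annihForm f n x p.1) (inner ℂ x p.2) := by
  obtain ⟨w, b, -⟩ := exists_hilbertBasis ℂ 𝒦
  obtain ⟨g, h1, h2⟩ := hasSum_inner_sectors b x p.2
  convert h2 using 2 with n
  have h3 := h1 n
  simp only [(mem_oneTensor_annihilation_graph_iff b f p).1 hp _ n, inner_smul_right] at h3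
  exact ((hasSum_annihForm b f n x p.1).mul_left _).unique h3

/-- The vector `y` need not lie in the domain of `a(f)`. Its projections onto fixed boson numbers
do, because `a(f)` is bounded on each such sector, so the adjoint relation can be used on each
projection separately. -/
theorem hasSum_inner_annihilation_adjoint {f : OneBoson d}
    (hd : Dense ((oneTensor 𝒦 (annihilation f)).domain : Set (StateSpace 𝒦 d)))
    (Φ : (oneTensor 𝒦 (annihilation f))†.domain) (y : StateSpace 𝒦 d) :
    HasSum (fun n : ℕ => (Real.sqrt (n + 1) : ℂ) * annihForm f n Φ y)
      (inner ℂ ((oneTensor 𝒦 (annihilation f))† Φ) y) := by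
  classical
  obtain ⟨w, b, -⟩ := exists_hilbertBasis ℂ 𝒦
  obtain ⟨g, h1, h2⟩ := hasSum_inner_sectors b ((oneTensor 𝒦 (annihilation f))† Φ) y
  have hproj : ∀ m : ℕ, ∃ z : StateSpace 𝒦 d, ∀ i, sector b i z
      = if i.2 = m then sector b i y else 0 := by
    intro m
    refine exists_sector_eq b _ (fun i σ => ?_) ?_
    · split_ifs
      · exact permL_sector b i σ y
      · exact map_zero _
    · refine (hasSum_norm_sq_sector b y).summable.of_nonneg_of_le (fun i => by positivity)
        fun i => ?_
      split_ifs
      · exact le_rfl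
      · simp only [norm_zero, ne_eq, OfNat.ofNat_ne_zero, not_false_eq_true, zero_pow]; positivity
  choose P hP using hproj
  have hg : ∀ m, g m = inner ℂ ((oneTensor 𝒦 (annihilation f))† Φ) (P m) := by
    intro m
    obtain ⟨g', h3, h4⟩ := hasSum_inner_sectors b ((oneTensor 𝒦 (annihilation f))† Φ) (P m)
    simp only [hP] at h3
    have h5 : ∀ n, n ≠ m → g' n = 0 := by
      intro n hn
      have := h3 n
      simp only [hn, if_false, inner_zero_right] at this
      exact this.unique hasSum_zero
    have h6 : g' m = g m := by
      have := h3 m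
      simp only [if_true] at this
      exact this.unique (h1 m)
    rw [← h6]
    exact (hasSum_single m h5).unique h4
  have hz : ∀ n : ℕ, ∃ z : StateSpace 𝒦 d, (P (n + 1), z) ∈ (oneTensor 𝒦 (annihilation f)).graph := by
    intro n
    let η : ∀ i : w × ℕ, NBoson d i.2 := fun i =>
      (Real.sqrt (i.2 + 1) : ℂ) • annih f (sector b (i.1, i.2 + 1) (P (n + 1)))
    have hη : ∀ i : w × ℕ, ‖η i‖ ^ 2 ≤ (n + 1) * ‖f‖ ^ 2 * ‖sector b (i.1, i.2 + 1) y‖ ^ 2 := by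
      rintro ⟨a, m⟩
      simp only [η, hP]
      by_cases hm : m = n
      · subst hm
        simp only [if_true]
        rw [norm_smul, mul_pow, Complex.norm_real, Real.norm_of_nonneg (Real.sqrt_nonneg _),
          Real.sq_sqrt (by positivity), mul_assoc, ← mul_pow]
        gcongr
        exact norm_annih_apply_le f _
      · simp only [add_left_inj, hm, if_false, map_zero, smul_zero, norm_zero, ne_eq,
          OfNat.ofNat_ne_zero, not_false_eq_true, zero_pow]
        positivity
    have hinj : Function.Injective fun i : w × ℕ => (i.1, i.2 + 1) := by
      rintro ⟨a, n⟩ ⟨a', n'⟩ h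
      simpa using h
    obtain ⟨z, hz⟩ := exists_sector_eq b η (fun i σ => by
      rw [map_smul, permL_annih f (fun σ => permL_sector b (i.1, i.2 + 1) σ _)])
      ((((hasSum_norm_sq_sector b y).summable.comp_injective hinj).mul_left _).of_nonneg_of_le
        (fun i => by positivity) hη)
    exact ⟨z, (mem_oneTensor_annihilation_graph_iff b f _).2 fun a n => hz (a, n)⟩
  have hadj : ∀ p : StateSpace 𝒦 d × StateSpace 𝒦 d, p ∈ (oneTensor 𝒦 (annihilation f)).graph →
      inner ℂ ((oneTensor 𝒦 (annihilation f))† Φ) p.1 = inner ℂ (Φ : StateSpace 𝒦 d) p.2 := by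
    intro p hp
    obtain ⟨v, hv1, hv2⟩ := (LinearPMap.mem_graph_iff _).1 hp
    rw [← hv1, ← hv2]
    exact LinearPMap.adjoint_isFormalAdjoint hd Φ v
  -- The zero-boson projection is annihilated by `a(f)`.
  have h0 : g 0 = 0 := by
    rw [hg 0, hadj (P 0, 0), inner_zero_right]
    rw [mem_oneTensor_annihilation_graph_iff b f]
    intro a n
    simp [hP]
  have hsucc : ∀ n : ℕ, g (n + 1) = (Real.sqrt (n + 1) : ℂ) * annihForm f n Φ y := by
    intro n
    obtain ⟨z, hz⟩ := hz n
    rw [hg, hadj _ hz]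
    have h3 := hasSum_inner_annihilation (Φ : StateSpace 𝒦 d) hz
    have h4 : ∀ m, annihForm f m (Φ : StateSpace 𝒦 d) (P (n + 1))
        = if m = n then annihForm f m (Φ : StateSpace 𝒦 d) y else 0 := by
      intro m
      have h5 := hasSum_annihForm b f m (Φ : StateSpace 𝒦 d) (P (n + 1))
      simp only [hP, add_left_inj] at h5
      split_ifs with hm
      · subst hm
        simp only [if_true] at h5
        exact h5.unique (hasSum_annihForm b f m (Φ : StateSpace 𝒦 d) y)
      · simp only [hm, if_false, map_zero, inner_zero_right] at h5
        exact h5.unique hasSum_zero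
    simp only [h4] at h3
    refine h3.unique ?_
    have h7 := hasSum_single (f := fun m : ℕ => (Real.sqrt (m + 1) : ℂ) *
      (if m = n then annihForm f m (Φ : StateSpace 𝒦 d) y else 0)) n (fun m hm => by simp [hm])
    simpa using h7
  -- The index drops by one since `a(f)` maps `n + 1` bosons to `n`; the omitted term is the
  -- vanishing zero-boson one.
  have h8 := (hasSum_nat_add_iff' (f := g) 1).2 h2
  simp only [Finset.range_one, Finset.sum_singleton, h0, sub_zero, hsucc] at h8
  exact h8

end StateSpaceAnnihilation

end BoseField

end

noncomputable section

namespace BoseField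

/-! ### The weak pull-through formula -/

section PullThrough

section SymmetricTensor

variable {E F : Type*} [NormedAddCommGroup E] [InnerProductSpace ℂ E]
  [NormedAddCommGroup F] [InnerProductSpace ℂ F]

/-- An induction principle for sesquilinear identities on the graph of `A ⊗ B`. -/
theorem tensorGraph_induction {A : E →ₗ.[ℂ] E} {B : F →ₗ.[ℂ] F} {M : Type*}
    [NormedAddCommGroup M] [InnerProductSpace ℂ M]
    (S T : HilbertTensor E F →L[ℂ] M)
    (h : ∀ (u u' : A.domain) (v v' : B.domain),
      inner ℂ (S (pureTensor (A u) (B v))) (T (pureTensor (u' : E) (v' : F)))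
        = inner ℂ (S (pureTensor (u : E) (v : F))) (T (pureTensor (A u') (B v'))))
    {p q : HilbertTensor E F × HilbertTensor E F} (hp : p ∈ tensorGraph A B)
    (hq : q ∈ tensorGraph A B) :
    inner ℂ (S p.2) (T q.1) = inner ℂ (S p.1) (T q.2) := by
  let X : Set (HilbertTensor E F × HilbertTensor E F) := {p |
    ∃ (u : A.domain) (v : B.domain), p = (pureTensor (u : E) (v : F), pureTensor (A u) (B v))}
  have hl : ∀ {q : HilbertTensor E F × HilbertTensor E F},
      (∀ p ∈ X, inner ℂ (S p.2) (T q.1) = inner ℂ (S p.1) (T q.2)) →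
      ∀ p ∈ tensorGraph A B, inner ℂ (S p.2) (T q.1) = inner ℂ (S p.1) (T q.2) := by
    intro q hX p hp
    have hc : IsClosed {p : HilbertTensor E F × HilbertTensor E F |
        inner ℂ (S p.2) (T q.1) = inner ℂ (S p.1) (T q.2)} :=
      isClosed_eq (by fun_prop) (by fun_prop)
    refine closure_minimal ?_ hc hp
    intro p hp
    induction hp using Submodule.span_induction with
    | mem x hx => exact hX x hx
    | zero => simp
    | add x y _ _ hx hy =>
      simp only [Set.mem_ofPred_eq, Prod.snd_add, Prod.fst_add, map_add, inner_add_left] at *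
      rw [hx, hy]
    | smul z x _ hx =>
      simp only [Set.mem_ofPred_eq, Prod.smul_snd, Prod.smul_fst, map_smul, inner_smul_left] at *
      rw [hx]
  refine hl (fun p hp => ?_) p hp
  have hc : IsClosed {q : HilbertTensor E F × HilbertTensor E F |
      inner ℂ (S p.2) (T q.1) = inner ℂ (S p.1) (T q.2)} :=
    isClosed_eq (by fun_prop) (by fun_prop)
  refine closure_minimal ?_ hc hq
  intro q hq
  induction hq using Submodule.span_induction with
  | mem x hx =>
    obtain ⟨u, v, rfl⟩ := hp
    obtain ⟨u', v', rfl⟩ := hx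
    exact h u u' v v'
  | zero => simp
  | add x y _ _ hx hy =>
    simp only [Set.mem_ofPred_eq, Prod.snd_add, Prod.fst_add, map_add, inner_add_right] at *
    rw [hx, hy]
  | smul z x _ hx =>
    simp only [Set.mem_ofPred_eq, Prod.smul_snd, Prod.smul_fst, map_smul, inner_smul_right] at *
    rw [hx]

variable [CompleteSpace E]

theorem isSymmetricOp_of_isSelfAdjoint {T : E →ₗ.[ℂ] E} (hT : IsSelfAdjoint T) :
    IsSymmetricOp T := by
  intro x y
  have h := LinearPMap.adjoint_isFormalAdjoint hT.dense_domain
  rw [LinearPMap.isSelfAdjoint_def.1 hT] at h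
  exact h x y

/-- Slicing along a basis is of no use when the unbounded operator acts on the first factor.
Closability comes instead from symmetry: if `(0, y)` is in the closed graph then `y` is orthogonal
to `D(A) ⊗ F`, which is dense. -/
theorem tensorOp_mem_tensorGraph {A : E →ₗ.[ℂ] E} (hA : IsSelfAdjoint A)
    (x : (tensorOp A (idOp F)).domain) :
    ((x : HilbertTensor E F), tensorOp A (idOp F) x) ∈ tensorGraph A (idOp F) := by
  refine Submodule.mem_graph_toLinearPMap (g := tensorGraph A (idOp F)) ?_ x
  rintro ⟨x, y⟩ hp hx
  simp only at hx ⊢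
  subst hx
  have h1 : ∀ (u : A.domain) (v : F), inner ℂ y (pureTensor (u : E) v) = 0 := by
    intro u v
    have hq : (pureTensor (u : E) v, pureTensor (A u) v) ∈ tensorGraph A (idOp F) :=
      subset_closure (Submodule.subset_span ⟨u, ⟨v, trivial⟩, rfl⟩)
    have := tensorGraph_induction (ContinuousLinearMap.id ℂ _) (ContinuousLinearMap.id ℂ _)
      (fun u u' v v' => ?_) hp hq
    · simpa using this
    · simp only [ContinuousLinearMap.id_apply, inner_pureTensor]
      rw [isSymmetricOp_of_isSelfAdjoint hA u u']
      rfl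
  have h2 : innerSL ℂ y = 0 := by
    refine eq_of_pureTensor fun u v => ?_
    have hd := hA.dense_domain
    have h3 : Set.EqOn (fun u : E => inner ℂ y (pureTensorR v u)) (fun _ => 0)
        (A.domain : Set E) := fun u hu => h1 ⟨u, hu⟩ v
    have := Continuous.ext_on hd (by fun_prop) continuous_const h3
    exact congrFun this u
  have h3 := DFunLike.congr_fun h2 y
  simpa using h3

end SymmetricTensor

variable {d : ℕ} {𝒦 : Type*} [NormedAddCommGroup 𝒦] [InnerProductSpace ℂ 𝒦] [CompleteSpace 𝒦]

/-- `K ⊗ 1` commutes with operators on the Fock factor. `annihForm` is built from bounded maps `1 ⊗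
B`, so the identity passes from simple tensors to the closed graph. -/
theorem annihForm_tensorGraph {K : 𝒦 →ₗ.[ℂ] 𝒦} (hK : IsSelfAdjoint K) (f : OneBoson d) (n : ℕ)
    {p q : StateSpace 𝒦 d × StateSpace 𝒦 d} (hp : p ∈ tensorGraph K (idOp (BoseFock d)))
    (hq : q ∈ tensorGraph K (idOp (BoseFock d))) :
    annihForm f n p.2 q.1 = annihForm f n p.1 q.2 := by
  refine tensorGraph_induction _ _ (fun u u' v v' => ?_) hp hq
  simp only [tmap_pureTensor, inner_pureTensor, ContinuousLinearMap.id_apply]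
  rw [isSymmetricOp_of_isSelfAdjoint hK u u']
  rfl

/-- The total energies of `n + 1` and of `n` bosons differ by the energy `ω` of the removed boson,
which is then absorbed into the test function. -/
theorem inner_annih_energy {ω : Momentum d → ℝ} {f f' : OneBoson d}
    (hf' : f' =ᵐ[volume] fun k => (ω k : ℂ) * f k) {n : ℕ} {φ φ' : NBoson d n}
    (hφ : φ' =ᵐ[volume] fun k => (totalEnergy ω k : ℂ) * φ k) {ψ ψ' : NBoson d (n + 1)}
    (hψ : ψ' =ᵐ[volume] fun k => (totalEnergy ω k : ℂ) * ψ k) :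
    inner ℂ φ' (annih f ψ) - inner ℂ φ (annih f ψ') = - inner ℂ φ (annih f' ψ) := by
  simp only [inner_annih_right]
  rw [sub_eq_iff_eq_add, neg_add_eq_sub, eq_sub_iff_add_eq]
  simp only [L2.inner_def]
  rw [← integral_add (L2.integrable_inner _ _) (L2.integrable_inner _ _)]
  refine integral_congr_ae ?_
  filter_upwards [consTensor_coeFn f φ, consTensor_coeFn f φ', consTensor_coeFn f' φ, hψ,
    (quasiMeasurePreserving_tail d n).ae hφ, (quasiMeasurePreserving_zero d n).ae hf']
    with x h1 h2 h3 h4 h5 h6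
  rw [h1, h2, h3, h4, h5, h6, totalEnergy_succ]
  simp only [RCLike.inner_apply, map_mul, Complex.conj_ofReal, Complex.ofReal_add]
  ring

theorem annihForm_energy {ω : Momentum d → ℝ} (hω : Measurable ω) {f f' : OneBoson d}
    (hf' : f' =ᵐ[volume] fun k => (ω k : ℂ) * f k) (n : ℕ)
    {p q : StateSpace 𝒦 d × StateSpace 𝒦 d} (hp : p ∈ (oneTensor 𝒦 (fieldEnergy ω)).graph)
    (hq : q ∈ (oneTensor 𝒦 (fieldEnergy ω)).graph) :
    annihForm f n p.2 q.1 - annihForm f n p.1 q.2 = - annihForm f' n p.1 q.1 := by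
  obtain ⟨w, b, -⟩ := exists_hilbertBasis ℂ 𝒦
  rw [mem_oneTensor_fieldEnergy_graph_iff b hω] at hp hq
  have h1 := (hasSum_annihForm b f n p.2 q.1).sub (hasSum_annihForm b f n p.1 q.2)
  have h2 := (hasSum_annihForm b f' n p.1 q.1).neg
  refine h1.unique ?_
  convert h2 using 2 with a
  exact inner_annih_energy hf' (hp a n) (hq a (n + 1))

/-- The commutation relations of the free Hamiltonian with the annihilation operators, in weak
form. -/
theorem inner_freeHamiltonian_annihilation {K : 𝒦 →ₗ.[ℂ] 𝒦} (hK : IsSelfAdjoint K)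
    {ω : Momentum d → ℝ} (hω : Measurable ω) {f f' : OneBoson d}
    (hf' : f' =ᵐ[volume] fun k => (ω k : ℂ) * f k)
    (hd : Dense ((oneTensor 𝒦 (annihilation f)).domain : Set (StateSpace 𝒦 d)))
    (Φ Ψ : (freeHamiltonian K ω).domain) {y y' : StateSpace 𝒦 d}
    (hΦ : (Φ : StateSpace 𝒦 d) ∈ (oneTensor 𝒦 (annihilation f))†.domain)
    (hy : ((Ψ : StateSpace 𝒦 d), y) ∈ (oneTensor 𝒦 (annihilation f)).graph)
    (hy' : ((Ψ : StateSpace 𝒦 d), y') ∈ (oneTensor 𝒦 (annihilation f')).graph) :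
    inner ℂ (freeHamiltonian K ω Φ) y
      - inner ℂ ((oneTensor 𝒦 (annihilation f))† ⟨Φ, hΦ⟩) (freeHamiltonian K ω Ψ)
      = - inner ℂ (Φ : StateSpace 𝒦 d) y' := by
  have hsplit : ∀ X : (freeHamiltonian K ω).domain, ∃ x₁ x₂ : StateSpace 𝒦 d,
      ((X : StateSpace 𝒦 d), x₁) ∈ tensorGraph K (idOp (BoseFock d)) ∧
      ((X : StateSpace 𝒦 d), x₂) ∈ (oneTensor 𝒦 (fieldEnergy ω)).graph ∧
      freeHamiltonian K ω X = x₁ + x₂ := fun X => by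
    have h1 : (X : StateSpace 𝒦 d) ∈ (tensorOp K (idOp (BoseFock d))).domain := X.2.1
    have h2 : (X : StateSpace 𝒦 d) ∈ (oneTensor 𝒦 (fieldEnergy ω)).domain := X.2.2
    exact ⟨tensorOp K (idOp (BoseFock d)) ⟨X, h1⟩, oneTensor 𝒦 (fieldEnergy ω) ⟨X, h2⟩,
      tensorOp_mem_tensorGraph hK ⟨(X : StateSpace 𝒦 d), h1⟩,
      (oneTensor 𝒦 (fieldEnergy ω)).mem_graph ⟨(X : StateSpace 𝒦 d), h2⟩, rfl⟩
  obtain ⟨k₁, b₁, hk₁, hb₁, e₁⟩ := hsplit Φ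
  obtain ⟨k₂, b₂, hk₂, hb₂, e₂⟩ := hsplit Ψ
  rw [e₁, e₂, inner_add_left, inner_add_right]
  -- Each pairing is a convergent series over the boson number, so the commutator is computed term
  -- by term. The separate vectors `k₁`, `b₁` need not lie in the adjoint domain, nor `k₂`, `b₂` in
  -- the domain of `a(f)`.
  have s1 := hasSum_inner_annihilation k₁ hy
  have s2 := hasSum_inner_annihilation b₁ hy
  have s3 := hasSum_inner_annihilation_adjoint hd ⟨Φ, hΦ⟩ k₂
  have s4 := hasSum_inner_annihilation_adjoint hd ⟨Φ, hΦ⟩ b₂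
  have s5 := (hasSum_inner_annihilation (Φ : StateSpace 𝒦 d) hy').neg
  refine ((s1.add s2).sub (s3.add s4)).unique ?_
  convert s5 using 2 with n
  have e3 := annihForm_tensorGraph hK f n hk₁ hk₂
  have e4 := annihForm_energy hω hf' n hb₁ hb₂
  simp only at e3 e4 ⊢
  rw [e3, ← mul_neg, ← e4]
  ring

end PullThrough

end BoseField

end

noncomputable section

namespace BoseField

/-! ### Resolvents of self-adjoint operators bounded from below -/

section Resolvents

variable {E : Type*} [NormedAddCommGroup E] [InnerProductSpace ℂ E]

/-- The quadratic form of `T` is bounded from below by `m`. -/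
def FormBound (T : E →ₗ.[ℂ] E) (m : ℝ) : Prop :=
  ∀ x : T.domain, m * ‖(x : E)‖ ^ 2 ≤ (inner ℂ (x : E) (T x)).re

theorem FormBound.le_norm {T : E →ₗ.[ℂ] E} {m : ℝ} (h : FormBound T m) (z : ℝ)
    (x : T.domain) : (m - z) * ‖(x : E)‖ ≤ ‖T x - (z : ℂ) • (x : E)‖ := by
  rcases (norm_nonneg (x : E)).eq_or_lt with h0 | h0
  · rw [← h0, mul_zero]; positivity
  have h1 : (m - z) * ‖(x : E)‖ ^ 2 ≤ (inner ℂ (x : E) (T x - (z : ℂ) • (x : E))).re := by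
    rw [inner_sub_right, inner_smul_right, inner_self_eq_norm_sq_to_K]
    have h2 : ((z : ℂ) * ((‖(x : E)‖ : ℂ)) ^ 2).re = z * ‖(x : E)‖ ^ 2 := by
      rw [← Complex.ofReal_pow, ← Complex.ofReal_mul, Complex.ofReal_re]
    rw [Complex.sub_re]
    erw [h2]
    linarith [h x]
  have h3 : (inner ℂ (x : E) (T x - (z : ℂ) • (x : E))).re
      ≤ ‖(x : E)‖ * ‖T x - (z : ℂ) • (x : E)‖ :=
    (Complex.re_le_norm _).trans (norm_inner_le_norm _ _)
  nlinarith

variable [CompleteSpace E]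

/-- The form bound makes `T - z` injective with closed range. A vector orthogonal to the range lies
in `D(T†) = D(T)` and is annihilated by `T - z`, hence is zero. -/
theorem exists_resolvent {T : E →ₗ.[ℂ] E} (hT : IsSelfAdjoint T) {m : ℝ} (h : FormBound T m)
    {z : ℝ} (hz : z < m) : ∃ S : E →L[ℂ] E,
      (∀ x : E, ∃ h : S x ∈ T.domain, T ⟨S x, h⟩ - (z : ℂ) • S x = x) ∧
      (∀ x : T.domain, S (T x - (z : ℂ) • (x : E)) = x) ∧
      (∀ x, ‖S x‖ ≤ (m - z)⁻¹ * ‖x‖) := by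
  have hc : 0 < m - z := sub_pos.2 hz
  let A : T.domain →ₗ[ℂ] E := T.toFun - (z : ℂ) • T.domain.subtype
  have hA : ∀ x, A x = T x - (z : ℂ) • (x : E) := fun x => rfl
  have hinj : Function.Injective A := by
    rw [← LinearMap.ker_eq_bot, LinearMap.ker_eq_bot']
    intro x hx
    have := h.le_norm z x
    rw [← hA, hx, norm_zero] at this
    have h0 : ‖(x : E)‖ = 0 := by nlinarith [norm_nonneg (x : E)]
    exact Subtype.ext (norm_eq_zero.1 h0)
  have hclosed : IsClosed (LinearMap.range A : Set E) := by
    rw [← isSeqClosed_iff_isClosed]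
    intro y y₀ hy hlim
    choose x hx using hy
    have hcau : CauchySeq fun n => ((x n : T.domain) : E) := by
      rw [Metric.cauchySeq_iff']
      intro ε hε
      obtain ⟨N, hN⟩ := Metric.cauchySeq_iff'.1 hlim.cauchySeq ((m - z) * ε) (by positivity)
      refine ⟨N, fun n hn => ?_⟩
      have h1 := hN n hn
      rw [dist_eq_norm, ← hx, ← hx, ← map_sub] at h1
      have h2 := h.le_norm z (x n - x N)
      rw [← hA] at h2
      rw [dist_eq_norm]
      have h3 : (m - z) * ‖((x n : E) - (x N : E))‖ < (m - z) * ε := lt_of_le_of_lt h2 h1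
      exact lt_of_mul_lt_mul_left h3 hc.le
    obtain ⟨x₀, hx₀⟩ := cauchySeq_tendsto_of_complete hcau
    have hlim2 : Tendsto (fun n => ((x n : E), T (x n))) atTop (𝓝 (x₀, y₀ + (z : ℂ) • x₀)) := by
      refine hx₀.prodMk_nhds ?_
      have : (fun n => T (x n)) = fun n => y n + (z : ℂ) • (x n : E) := by
        funext n
        rw [← hx, hA]; abel
      rw [this]
      exact hlim.add (hx₀.const_smul _)
    have hmem := hT.isClosed.mem_of_tendsto hlim2 (Eventually.of_forall fun n => T.mem_graph (x n))
    obtain ⟨v, hv1, hv2⟩ := (LinearPMap.mem_graph_iff _).1 hmem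
    refine ⟨v, ?_⟩
    simp only at hv1 hv2
    rw [hA, hv2, hv1]; abel
  have hsurj : LinearMap.range A = ⊤ := by
    have : CompleteSpace (LinearMap.range A) := hclosed.completeSpace_coe
    rw [← Submodule.orthogonal_eq_bot_iff, Submodule.eq_bot_iff]
    intro v hv
    have h1 : ∀ x : T.domain, inner ℂ ((z : ℂ) • v) (x : E) = inner ℂ v (T x) := by
      intro x
      have h2 := (Submodule.mem_orthogonal' _ _).1 hv (A x) ⟨x, rfl⟩
      rw [hA, inner_sub_right, inner_smul_right, sub_eq_zero] at h2
      rw [h2, inner_smul_left, Complex.conj_ofReal]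
    have h2 : v ∈ T†.domain := LinearPMap.mem_adjoint_domain_of_exists v ⟨_, h1⟩
    have h3 := LinearPMap.adjoint_apply_eq hT.dense_domain ⟨v, h2⟩ h1
    have h4 : ∃ hv : v ∈ T.domain, T ⟨v, hv⟩ = (z : ℂ) • v := by
      have e := LinearPMap.isSelfAdjoint_def.1 hT
      have : ∀ T' : E →ₗ.[ℂ] E, T' = T → ∀ (h2 : v ∈ T'.domain), T' ⟨v, h2⟩ = (z : ℂ) • v →
          ∃ hv : v ∈ T.domain, T ⟨v, hv⟩ = (z : ℂ) • v := by
        rintro T' rfl h2 h3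
        exact ⟨h2, h3⟩
      exact this _ e h2 h3
    obtain ⟨hvd, hve⟩ := h4
    have h5 := h.le_norm z ⟨v, hvd⟩
    rw [hve] at h5
    simp only [sub_self, norm_zero] at h5
    exact norm_eq_zero.1 (by nlinarith [norm_nonneg v])
  let e : T.domain ≃ₗ[ℂ] E := LinearEquiv.ofBijective A ⟨hinj, LinearMap.range_eq_top.1 hsurj⟩
  have he : ∀ x, A (e.symm x) = x := fun x => e.apply_symm_apply x
  have hbd : ∀ x, ‖(T.domain.subtype ∘ₗ e.symm.toLinearMap) x‖ ≤ (m - z)⁻¹ * ‖x‖ := by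
    intro x
    have h1 := h.le_norm z (e.symm x)
    rw [← hA, he] at h1
    rw [inv_mul_eq_div, le_div_iff₀ hc, mul_comm]
    exact h1
  refine ⟨(T.domain.subtype ∘ₗ e.symm.toLinearMap).mkContinuous _ hbd, ?_, ?_, hbd⟩
  · intro x
    exact ⟨(e.symm x).2, he x⟩
  · intro x
    change ((e.symm (A x) : T.domain) : E) = x
    rw [show A x = e x from rfl, e.symm_apply_apply]

/-- The infimum of the spectrum is a lower bound of the quadratic form. -/
theorem formBound_groundEnergy {T : E →ₗ.[ℂ] E} (hT : IsSelfAdjoint T)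
    (hb : IsBoundedBelowOp T) (hne : ∃ x : T.domain, ‖(x : E)‖ = 1) :
    FormBound T (groundEnergy T) := by
  obtain ⟨m₀, hm₀⟩ := hb
  obtain ⟨x₀, hx₀⟩ := hne
  -- The infimum of the numerical range `Q` will be shown to be the least point of the spectrum.
  let Q : Set ℝ := {q | ∃ x : T.domain, ‖(x : E)‖ = 1 ∧ q = (inner ℂ (x : E) (T x)).re}
  have hQne : Q.Nonempty := ⟨_, x₀, hx₀, rfl⟩
  have hQbd : BddBelow Q := by
    refine ⟨m₀, ?_⟩
    rintro _ ⟨x, hx, rfl⟩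
    have := hm₀ x
    rwa [hx, one_pow, mul_one] at this
  have hform : FormBound T (sInf Q) := by
    intro x
    rcases eq_or_ne (x : E) 0 with h0 | h0
    · rw [h0]; simp
    have hn : ‖(x : E)‖ ≠ 0 := norm_ne_zero_iff.2 h0
    let c : ℂ := ((‖(x : E)‖⁻¹ : ℝ) : ℂ)
    have h1 : (inner ℂ ((c • x : T.domain) : E) (T (c • x))).re ∈ Q := by
      refine ⟨c • x, ?_, rfl⟩
      rw [Submodule.coe_smul, norm_smul, Complex.norm_real, norm_inv, norm_norm,
        inv_mul_cancel₀ hn]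
    have h2 := csInf_le hQbd h1
    rw [LinearPMap.map_smul, Submodule.coe_smul, inner_smul_left, inner_smul_right,
      Complex.conj_ofReal, Complex.re_ofReal_mul, Complex.re_ofReal_mul, ← mul_assoc] at h2
    calc sInf Q * ‖(x : E)‖ ^ 2 ≤ (‖(x : E)‖⁻¹ * ‖(x : E)‖⁻¹ * (inner ℂ (x : E) (T x)).re)
          * ‖(x : E)‖ ^ 2 := by gcongr
      _ = _ := by field_simp
  have hspec : ∀ z : ℝ, (z : ℂ) ∈ spectrumOp T → sInf Q ≤ z := by
    intro z hz
    by_contra hlt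
    obtain ⟨S, h1, h2, -⟩ := exists_resolvent hT hform (not_le.1 hlt)
    exact hz ⟨S, h1, h2⟩
  -- A bounded inverse `S` at `sInf Q` would be a positive symmetric operator, and its boundedness
  -- would leave a gap between `sInf Q` and the values in `Q`.
  have hmem : ((sInf Q : ℝ) : ℂ) ∈ spectrumOp T := by
    rintro ⟨S, h1, h2⟩
    have hpos : ∀ x, 0 ≤ (inner ℂ x (S x)).re := by
      intro x
      obtain ⟨hx, he⟩ := h1 x
      have h3 := hform ⟨S x, hx⟩
      have h4 : (inner ℂ (S x) (T ⟨S x, hx⟩ - ((sInf Q : ℝ) : ℂ) • S x)).re = (inner ℂ (S x) (T ⟨S x, hx⟩)).re - sInf Q * ‖S x‖ ^ 2 := by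
        rw [inner_sub_right, inner_smul_right, inner_self_eq_norm_sq_to_K, Complex.sub_re]
        congr 1
        erw [← Complex.ofReal_pow, ← Complex.ofReal_mul, Complex.ofReal_re]
        rfl
      rw [he] at h4
      rw [← inner_conj_symm, Complex.conj_re, h4]
      simp only at h3
      linarith
    have hsymm : ∀ x y, inner ℂ (S x) y = inner ℂ x (S y) := by
      intro x y
      obtain ⟨hx, hxe⟩ := h1 x
      obtain ⟨hy, hye⟩ := h1 y
      conv_lhs => rw [← hye]
      conv_rhs => rw [← hxe]
      rw [inner_sub_right, inner_sub_left, inner_smul_right, inner_smul_left, Complex.conj_ofReal,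
        isSymmetricOp_of_isSelfAdjoint hT ⟨S x, hx⟩ ⟨S y, hy⟩]
    -- Follows from positivity of the form of `S` at the vector `x - ‖S‖⁻¹ S x`.
    have hcs : ∀ x, ‖S x‖ ^ 2 ≤ ‖S‖ * (inner ℂ x (S x)).re := by
      intro x
      rcases (norm_nonneg S).eq_or_lt with h0 | h0
      · have : S = 0 := norm_eq_zero.1 h0.symm
        simp [this]
      have h3 := hpos (x - ((‖S‖⁻¹ : ℝ) : ℂ) • S x)
      have h4 : (inner ℂ (S x) (S (S x))).re ≤ ‖S‖ * ‖S x‖ ^ 2 := by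
        refine (Complex.re_le_norm _).trans ((norm_inner_le_norm _ _).trans ?_)
        nlinarith [S.le_opNorm (S x), norm_nonneg (S x)]
      have h5 : (inner ℂ (S x) (S x)).re = ‖S x‖ ^ 2 := inner_self_eq_norm_sq (𝕜 := ℂ) (S x)
      rw [map_sub, map_smul, inner_sub_left, inner_sub_right, inner_sub_right, inner_smul_left,
        inner_smul_right, inner_smul_left, inner_smul_right, Complex.conj_ofReal, ← hsymm x (S x)]
        at h3
      simp only [Complex.sub_re, Complex.re_ofReal_mul, h5] at h3
      have h6 : ‖S‖⁻¹ * (‖S‖⁻¹ * (inner ℂ (S x) (S (S x))).re) ≤ ‖S‖⁻¹ * ‖S x‖ ^ 2 := by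
        refine mul_le_mul_of_nonneg_left ?_ (by positivity)
        rw [inv_mul_le_iff₀ h0]
        exact h4
      have h7 : ‖S‖⁻¹ * ‖S x‖ ^ 2 ≤ (inner ℂ x (S x)).re := by linarith
      rwa [inv_mul_le_iff₀ h0] at h7
    -- A unit vector with energy within `1/(‖S‖ + 1)` of the infimum. Applied to `(T - sInf Q) x`,
    -- the bound `hcs` gives `1 ≤ ‖S‖ (⟨x, T x⟩ - sInf Q) < 1`.
    obtain ⟨q, ⟨x, hx, rfl⟩, hq⟩ := exists_lt_of_csInf_lt hQne
      (show sInf Q < sInf Q + (‖S‖ + 1)⁻¹ by linarith [inv_pos.2 (by positivity : 0 < ‖S‖ + 1)])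
    have h3 := hcs (T x - ((sInf Q : ℝ) : ℂ) • (x : E))
    rw [h2 x, hx, inner_sub_left, inner_smul_left, Complex.conj_ofReal,
      inner_self_eq_norm_sq_to_K, hx, ← inner_conj_symm, Complex.sub_re, Complex.conj_re] at h3
    simp only [one_pow, mul_one, Complex.ofReal_re, RCLike.ofReal_one] at h3
    have h4 : ‖S‖ * ((inner ℂ (x : E) (T x)).re - sInf Q) ≤ ‖S‖ * (‖S‖ + 1)⁻¹ := by
      gcongr
      linarith
    have h5 : ‖S‖ * (‖S‖ + 1)⁻¹ < 1 := by
      rw [← div_eq_mul_inv, div_lt_one (by positivity)]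
      linarith
    linarith
  have : groundEnergy T = sInf Q :=
    (show IsLeast {x : ℝ | (x : ℂ) ∈ spectrumOp T} (sInf Q) from ⟨hmem, hspec⟩).csInf_eq
  rw [this]
  exact hform

/-- The resolvents `(T - m + s)⁻¹`, `s > 0`, of a self-adjoint operator `T ≥ m`. -/
theorem exists_resolvent_family {T : E →ₗ.[ℂ] E} (hT : IsSelfAdjoint T) {m : ℝ}
    (h : FormBound T m) : ∃ R : ℝ → E →L[ℂ] E,
      (∀ s > 0, ∀ x, ∃ hx : R s x ∈ T.domain, T ⟨R s x, hx⟩ - ((m - s : ℝ) : ℂ) • R s x = x) ∧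
      (∀ s > 0, ∀ x, ‖R s x‖ ≤ s⁻¹ * ‖x‖) ∧
      (∀ s > 0, HasDerivAt R (-(R s * R s)) s) := by
  choose R' hR using fun s : {s : ℝ // 0 < s} =>
    exists_resolvent hT h (z := m - s) (by linarith [s.2])
  -- The value `0` at `s ≤ 0` is a filler; all assertions concern `s > 0`.
  let R : ℝ → E →L[ℂ] E := fun s => if hs : 0 < s then R' ⟨s, hs⟩ else 0
  have hRs : ∀ s (hs : 0 < s), R s = R' ⟨s, hs⟩ := fun s hs => dif_pos hs
  have h1 : ∀ s > 0, ∀ x, ∃ hx : R s x ∈ T.domain,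
      T ⟨R s x, hx⟩ - ((m - s : ℝ) : ℂ) • R s x = x := by
    intro s hs x
    rw [hRs s hs]
    exact (hR ⟨s, hs⟩).1 x
  have h2 : ∀ s > 0, ∀ x : T.domain, R s (T x - ((m - s : ℝ) : ℂ) • (x : E)) = x := by
    intro s hs x
    rw [hRs s hs]
    exact (hR ⟨s, hs⟩).2.1 x
  have h3 : ∀ s > 0, ∀ x, ‖R s x‖ ≤ s⁻¹ * ‖x‖ := by
    intro s hs x
    rw [hRs s hs]
    simpa using (hR ⟨s, hs⟩).2.2 x
  have h3' : ∀ s > 0, ‖R s‖ ≤ s⁻¹ := fun s hs =>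
    ContinuousLinearMap.opNorm_le_bound _ (by positivity) (h3 s hs)
  -- The first resolvent identity. With the bound `1/s` it yields norm continuity, and then the
  -- derivative `-R²` as the limit of difference quotients.
  have hid : ∀ s > 0, ∀ t > 0, R t - R s = (t - s) • -(R t * R s) := by
    intro s hs t ht
    ext x
    obtain ⟨hx, he⟩ := h1 s hs x
    have h4 := h2 t ht ⟨R s x, hx⟩
    have h5 : T ⟨R s x, hx⟩ - ((m - t : ℝ) : ℂ) • R s x
        = x + ((t - s : ℝ) : ℂ) • R s x := by
      conv_rhs => enter [1]; rw [← he]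
      push_cast
      module
    simp only at h4
    rw [h5, map_add, map_smul] at h4
    have h6 : ((t - s) • -(R t * R s)) x = -(((t - s : ℝ) : ℂ) • R t (R s x)) := by
      rw [Complex.coe_smul, ← smul_neg]
      rfl
    rw [h6, sub_apply]
    conv_lhs => enter [2]; rw [← h4]
    abel
  have hcont : ∀ s > 0, Tendsto R (𝓝 s) (𝓝 (R s)) := by
    intro s hs
    rw [tendsto_iff_norm_sub_tendsto_zero]
    have h4 : Tendsto (fun t : ℝ => |t - s| * (t⁻¹ * s⁻¹)) (𝓝 s) (𝓝 (|s - s| * (s⁻¹ * s⁻¹))) := by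
      have : ContinuousAt (fun t : ℝ => |t - s| * (t⁻¹ * s⁻¹)) s := by
        have := hs.ne'
        fun_prop (disch := assumption)
      exact this
    rw [sub_self, abs_zero, zero_mul] at h4
    refine squeeze_zero' (Eventually.of_forall fun _ => norm_nonneg _) ?_ h4
    filter_upwards [lt_mem_nhds hs] with t ht
    rw [hid s hs t ht, norm_smul, norm_neg, Real.norm_eq_abs]
    refine mul_le_mul_of_nonneg_left ?_ (abs_nonneg _)
    exact (norm_mul_le _ _).trans (mul_le_mul (h3' t ht) (h3' s hs) (norm_nonneg _)
      (by positivity))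
  refine ⟨R, h1, h3, fun s hs => ?_⟩
  rw [hasDerivAt_iff_tendsto_slope]
  have h5 : Tendsto (fun t => -(R t * R s)) (𝓝[≠] s) (𝓝 (-(R s * R s))) :=
    (((hcont s hs).mul_const _).neg).mono_left nhdsWithin_le_nhds
  refine h5.congr' ?_
  filter_upwards [nhdsWithin_le_nhds (lt_mem_nhds hs), self_mem_nhdsWithin] with t ht hts
  rw [slope_def_module, hid s hs t ht, smul_smul, inv_mul_cancel₀ (sub_ne_zero.2 hts), one_smul]

end Resolvents

end BoseField

end

noncomputable section

namespace BoseField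

/-! ### The pull-through formula for the ground state -/

section WeakEquation

variable {E : Type*} [NormedAddCommGroup E] [InnerProductSpace ℂ E] [CompleteSpace E]

/-- A weak solution of `(T - m) x = y` is a strong solution. -/
theorem mem_domain_of_weak {T : E →ₗ.[ℂ] E} (hT : IsSelfAdjoint T) {x y : E}
    (h : ∀ z : T.domain, inner ℂ (T z) x = inner ℂ (z : E) y) :
    ∃ hx : x ∈ T.domain, T ⟨x, hx⟩ = y := by
  have h1 : ∀ z : T.domain, inner ℂ y (z : E) = inner ℂ x (T z) := fun z => by
    rw [← inner_conj_symm, ← h, inner_conj_symm]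
  have h2 : x ∈ T†.domain := LinearPMap.mem_adjoint_domain_of_exists x ⟨y, h1⟩
  have h3 := LinearPMap.adjoint_apply_eq hT.dense_domain ⟨x, h2⟩ h1
  have e := LinearPMap.isSelfAdjoint_def.1 hT
  have : ∀ T' : E →ₗ.[ℂ] E, T' = T → ∀ (h2 : x ∈ T'.domain), T' ⟨x, h2⟩ = y →
      ∃ hx : x ∈ T.domain, T ⟨x, hx⟩ = y := by
    rintro T' rfl h2 h3
    exact ⟨h2, h3⟩
  exact this _ e h2 h3

/-- By self-adjointness the weak equation is the strong equation `(T - m) x = -y`. Hence `(T - m +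
l) x = l x - y`, and `T ≥ m` bounds the left side from below by `l ‖x‖`. -/
theorem norm_le_of_weak {T : E →ₗ.[ℂ] E} (hT : IsSelfAdjoint T) {m : ℝ} (hm : FormBound T m)
    {x y : E} (h : ∀ z : T.domain, inner ℂ (T z - (m : ℂ) • (z : E)) x = -inner ℂ (z : E) y)
    (l : ℝ) : l * ‖x‖ ≤ ‖(l : ℂ) • x - y‖ := by
  obtain ⟨hx, he⟩ := mem_domain_of_weak hT (x := x) (y := (m : ℂ) • x - y) fun z => by
    have := h z
    rw [inner_sub_left, inner_smul_left, Complex.conj_ofReal] at this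
    rw [inner_sub_right, inner_smul_right]
    linear_combination this
  have := hm.le_norm (m - l) ⟨x, hx⟩
  rw [he] at this
  convert this using 2
  · simp
  · push_cast
    module

/-- The commutator of a symmetric perturbation, evaluated on an eigenvector. -/
theorem inner_add_apply_eq_weakCommutator {S HI A : E →ₗ.[ℂ] E} (hHI : IsSymmetricOp HI)
    (hH : Dense ((S + HI).domain : Set E)) (hd : Dense (A.domain : Set E))
    (Φ Ω : (S + HI).domain) {E₀ : ℝ} (hΩ : (S + HI) Ω = (E₀ : ℂ) • (Ω : E))
    (hΦa : (Φ : E) ∈ A†.domain) (hΩa : (Ω : E) ∈ A.domain) :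
    ∃ hΦI : (Φ : E) ∈ HI†.domain,
      inner ℂ ((S + HI) Φ - (E₀ : ℂ) • (Φ : E)) (A ⟨Ω, hΩa⟩)
        = (inner ℂ (S ⟨Φ, Φ.2.1⟩) (A ⟨Ω, hΩa⟩) - inner ℂ (A† ⟨Φ, hΦa⟩) (S ⟨Ω, Ω.2.1⟩))
          + weakCommutator HI A ⟨Φ, hΦI, hΦa⟩ ⟨Ω, Ω.2.2, hΩa⟩ := by
  have hHId : Dense (HI.domain : Set E) := hH.mono fun Ψ hΨ => hΨ.2
  have hsym : ∀ x : HI.domain, inner ℂ (HI ⟨Φ, Φ.2.2⟩) (x : E)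
      = inner ℂ (Φ : E) (HI x) := fun x => hHI ⟨Φ, Φ.2.2⟩ x
  have hΦI : (Φ : E) ∈ HI†.domain :=
    LinearPMap.mem_adjoint_domain_of_exists _ ⟨_, hsym⟩
  have hΦIe : HI† ⟨Φ, hΦI⟩ = HI ⟨Φ, Φ.2.2⟩ :=
    LinearPMap.adjoint_apply_eq hHId ⟨Φ, hΦI⟩ hsym
  refine ⟨hΦI, ?_⟩
  have h3 : inner ℂ (A† ⟨Φ, hΦa⟩) (Ω : E) = inner ℂ (Φ : E) (A ⟨Ω, hΩa⟩) :=
    LinearPMap.adjoint_isFormalAdjoint hd ⟨Φ, hΦa⟩ ⟨Ω, hΩa⟩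
  have h4 := congrArg (inner ℂ (A† ⟨Φ, hΦa⟩)) hΩ
  rw [LinearPMap.add_apply, inner_add_right, inner_smul_right, h3] at h4
  rw [inner_sub_left, inner_smul_left, Complex.conj_ofReal, LinearPMap.add_apply, inner_add_left,
    weakCommutator, hΦIe]
  linear_combination h4

variable {X : Type*} [MeasurableSpace X] {μ : Measure X}

theorem integrable_conj_smul_of_memLp {u : X → E} (hu : MemLp u 2 μ) (f : Lp ℂ 2 μ) :
    Integrable (fun k => conj (f k) • u k) μ := by
  have : MemLp (fun k => conj (f k) • u k) 1 μ := hu.smul (Lp.memLp f).star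
  exact memLp_one_iff_integrable.1 this

theorem norm_integral_conj_smul_le {u : X → E} (hu : MemLp u 2 μ) :
    ∃ c, 0 ≤ c ∧ ∀ f : Lp ℂ 2 μ, ‖∫ k, conj (f k) • u k ∂μ‖ ≤ c * ‖f‖ := by
  refine ⟨(eLpNorm u 2 μ).toReal, ENNReal.toReal_nonneg, fun f => ?_⟩
  have h1 : MemLp (fun k => conj (f k) • u k) 1 μ := hu.smul (Lp.memLp f).star
  have h2 : eLpNorm (fun k => conj (f k) • u k) 1 μ
      ≤ eLpNorm (fun k => conj (f k)) 2 μ * eLpNorm u 2 μ :=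
    eLpNorm_smul_le_mul_eLpNorm hu.1 (Lp.memLp f).star.1
  have h3 : eLpNorm (fun k => conj (f k)) 2 μ = eLpNorm f 2 μ :=
    eLpNorm_congr_norm_ae (Eventually.of_forall fun k => by simp)
  rw [h3] at h2
  rw [Lp.norm_def, mul_comm, ← ENNReal.toReal_mul, ← toReal_enorm]
  refine ENNReal.toReal_mono (ENNReal.mul_ne_top (Lp.eLpNorm_ne_top f) hu.2.ne) ?_
  refine (enorm_integral_le_lintegral_enorm _).trans ?_
  rw [← eLpNorm_one_eq_lintegral_enorm]
  exact h2

end WeakEquation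

/-! ### The annihilation operator applied to the ground state. -/

section Ground

variable {d : ℕ} {𝒦 : Type*} [NormedAddCommGroup 𝒦] [InnerProductSpace ℂ 𝒦] [CompleteSpace 𝒦]
  {K : 𝒦 →ₗ.[ℂ] 𝒦} {ω : Momentum d → ℝ} {HI : StateSpace 𝒦 d →ₗ.[ℂ] StateSpace 𝒦 d}

theorem mem_fieldEnergy_graph (Ψ : (totalHamiltonian K ω HI).domain) :
    ((Ψ : StateSpace 𝒦 d), oneTensor 𝒦 (fieldEnergy ω) ⟨Ψ, Ψ.2.1.2⟩)
      ∈ (oneTensor 𝒦 (fieldEnergy ω)).graph :=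
  (oneTensor 𝒦 (fieldEnergy ω)).mem_graph ⟨(Ψ : StateSpace 𝒦 d), Ψ.2.1.2⟩

/-- Needed for the adjoint of `a(f)` to be meaningful. The inclusions are `D(H) ⊆ D(1 ⊗ dΓ(ω)) ⊆ D(1
⊗ a(f))`. -/
theorem dense_annihilation_domain (hH : IsSelfAdjoint (totalHamiltonian K ω HI))
    (hω : Measurable ω) (hnn : ∀ k, 0 ≤ ω k) (hpos : ∀ᵐ k, 0 < ω k) (f : OneBoson d) {C : ℝ}
    (hC0 : 0 ≤ C) (hC : ∫⁻ q, ENNReal.ofReal (1 / ω q) * ‖f q‖ₑ ^ 2 ≤ ENNReal.ofReal C) :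
    Dense ((oneTensor 𝒦 (annihilation f)).domain : Set (StateSpace 𝒦 d)) := by
  refine hH.dense_domain.mono fun Ψ hΨ => ?_
  obtain ⟨y, hy, -⟩ := exists_annihilation_apply hω hnn hpos f hC0 hC
    (mem_fieldEnergy_graph ⟨Ψ, hΨ⟩)
  exact LinearPMap.mem_domain_of_mem_graph hy

theorem mem_annihilation_adjoint_domain_of_totalHamiltonian
    (hω : Measurable ω) (hnn : ∀ k, 0 ≤ ω k) (hpos : ∀ᵐ k, 0 < ω k) (f : OneBoson d) {C : ℝ}
    (hC0 : 0 ≤ C) (hC : ∫⁻ q, ENNReal.ofReal (1 / ω q) * ‖f q‖ₑ ^ 2 ≤ ENNReal.ofReal C)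
    (Φ : (totalHamiltonian K ω HI).domain) :
    (Φ : StateSpace 𝒦 d) ∈ (oneTensor 𝒦 (annihilation f))†.domain := by
  have h := mem_fieldEnergy_graph Φ
  have := mem_annihilation_adjoint_domain hω hnn hpos f hC0 hC h
  simp only at this
  exact this

/-- Weak form of `(H - E₀) a(f)Ω + a(ωf)Ω = [H_I, a(f)]Ω`: the free Hamiltonian contributes
`-a(ωf)Ω` and the interaction contributes `I`. -/
theorem inner_totalHamiltonian_annihilation (hK : IsSelfAdjoint K) (hHI : IsSymmetricOp HI)
    (hH : IsSelfAdjoint (totalHamiltonian K ω HI))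
    (hω : Measurable ω) (hnn : ∀ k, 0 ≤ ω k) (hpos : ∀ᵐ k, 0 < ω k) {f f' : OneBoson d} {C : ℝ}
    (hC0 : 0 ≤ C) (hC : ∫⁻ q, ENNReal.ofReal (1 / ω q) * ‖f q‖ₑ ^ 2 ≤ ENNReal.ofReal C)
    (hf' : f' =ᵐ[volume] fun k => (ω k : ℂ) * f k) {I : ℂ}
    (Φ Ω : (totalHamiltonian K ω HI).domain) {E₀ : ℝ}
    (hΩ : totalHamiltonian K ω HI Ω = (E₀ : ℂ) • (Ω : StateSpace 𝒦 d))
    (hcomm : ∀ (hΦ : (Φ : StateSpace 𝒦 d) ∈ HI†.domain ⊓ (oneTensor 𝒦 (annihilation f))†.domain)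
        (hΨ : (Ω : StateSpace 𝒦 d) ∈ HI.domain ⊓ (oneTensor 𝒦 (annihilation f)).domain),
        weakCommutator HI (oneTensor 𝒦 (annihilation f)) ⟨Φ, hΦ⟩ ⟨Ω, hΨ⟩ = I)
    {y y' : StateSpace 𝒦 d}
    (hy : ((Ω : StateSpace 𝒦 d), y) ∈ (oneTensor 𝒦 (annihilation f)).graph)
    (hy' : ((Ω : StateSpace 𝒦 d), y') ∈ (oneTensor 𝒦 (annihilation f')).graph) :
    inner ℂ (totalHamiltonian K ω HI Φ - (E₀ : ℂ) • (Φ : StateSpace 𝒦 d)) y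
      + inner ℂ (Φ : StateSpace 𝒦 d) y' = I := by
  have hd := dense_annihilation_domain hH hω hnn hpos f hC0 hC
  have hΦa : (Φ : StateSpace 𝒦 d) ∈ (oneTensor 𝒦 (annihilation f))†.domain :=
    mem_annihilation_adjoint_domain_of_totalHamiltonian hω hnn hpos f hC0 hC Φ
  have hΩa : (Ω : StateSpace 𝒦 d) ∈ (oneTensor 𝒦 (annihilation f)).domain :=
    LinearPMap.mem_domain_of_mem_graph hy
  have hΩe : oneTensor 𝒦 (annihilation f) ⟨Ω, hΩa⟩ = y :=
    LinearPMap.mem_graph_snd_inj _ ((oneTensor 𝒦 (annihilation f)).mem_graph ⟨_, hΩa⟩) hy rfl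
  obtain ⟨hΦI, h1⟩ := inner_add_apply_eq_weakCommutator hHI hH.dense_domain hd Φ Ω hΩ hΦa hΩa
  have h2 := inner_freeHamiltonian_annihilation hK hω hf' hd ⟨(Φ : StateSpace 𝒦 d), Φ.2.1⟩
    ⟨(Ω : StateSpace 𝒦 d), Ω.2.1⟩ hΦa hy hy'
  have h3 := hcomm ⟨hΦI, hΦa⟩ ⟨Ω.2.2, hΩa⟩
  rw [hΩe] at h1
  have h4 := h1.trans (congrArg₂ (· + ·) h2 h3)
  refine (congrArg (· + inner ℂ (Φ : StateSpace 𝒦 d) y') h4).trans ?_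
  ring

theorem annih_add_smul {n : ℕ} (f g : OneBoson d) (c : ℝ) (Ψ : NBoson d (n + 1)) :
    annih ((c : ℂ) • f - g) Ψ = (c : ℂ) • annih f Ψ - annih g Ψ := by
  refine ext_inner_left ℂ fun φ => ?_
  simp only [inner_annih_right, inner_sub_right, inner_smul_right, map_sub, map_smul,
    sub_apply, smul_apply, inner_sub_left, inner_smul_left, Complex.conj_ofReal]

theorem annihilation_graph_sub {f g : OneBoson d} (c : ℝ) {x y z : StateSpace 𝒦 d}
    (hy : (x, y) ∈ (oneTensor 𝒦 (annihilation f)).graph)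
    (hz : (x, z) ∈ (oneTensor 𝒦 (annihilation g)).graph) :
    (x, (c : ℂ) • y - z) ∈ (oneTensor 𝒦 (annihilation ((c : ℂ) • f - g))).graph := by
  obtain ⟨w, b, -⟩ := exists_hilbertBasis ℂ 𝒦
  rw [mem_oneTensor_annihilation_graph_iff b] at hy hz ⊢
  intro a n
  have h1 := hy a n
  have h2 := hz a n
  simp only at h1 h2 ⊢
  rw [map_sub, map_smul, h1, h2, annih_add_smul, smul_sub, smul_comm]

theorem annihilation_graph_eq {f : OneBoson d} {x y z : StateSpace 𝒦 d}
    (hy : (x, y) ∈ (oneTensor 𝒦 (annihilation f)).graph)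
    (hz : (x, z) ∈ (oneTensor 𝒦 (annihilation f)).graph) : y = z :=
  LinearPMap.mem_graph_snd_inj _ hy hz rfl

/-- If `f` lives on `{ω ≥ ε}` then `∫ |f|²/ω ≤ ‖f‖²/ε`, so the relative bound gives `‖a(f)Ω‖ ≤ c
‖f‖` with `c` independent of `f`. This a priori bound starts the iteration for the pull-through
formula. -/
theorem exists_annihilation_ground_le (hω : Measurable ω) (hnn : ∀ k, 0 ≤ ω k)
    (hpos : ∀ᵐ k, 0 < ω k) (Ω : (totalHamiltonian K ω HI).domain) {ε : ℝ} (hε : 0 < ε) :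
    ∃ c, 0 ≤ c ∧ ∀ f : OneBoson d, (∀ᵐ k, f k ≠ 0 → ε ≤ ω k) →
      (∫⁻ q, ENNReal.ofReal (1 / ω q) * ‖f q‖ₑ ^ 2 ≤ ENNReal.ofReal (ε⁻¹ * ‖f‖ ^ 2)) ∧
      ∃ y, ((Ω : StateSpace 𝒦 d), y) ∈ (oneTensor 𝒦 (annihilation f)).graph ∧ ‖y‖ ≤ c * ‖f‖ := by
  set B : ℝ := ‖(Ω : StateSpace 𝒦 d)‖ ^ 2
    + ‖oneTensor 𝒦 (fieldEnergy ω) ⟨Ω, Ω.2.1.2⟩‖ ^ 2 with hB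
  refine ⟨Real.sqrt (ε⁻¹ * B), Real.sqrt_nonneg _, fun f hf => ?_⟩
  have hC : ∫⁻ q, ENNReal.ofReal (1 / ω q) * ‖f q‖ₑ ^ 2 ≤ ENNReal.ofReal (ε⁻¹ * ‖f‖ ^ 2) := by
    rw [ENNReal.ofReal_mul (by positivity), ENNReal.ofReal_pow (norm_nonneg _), ofReal_norm,
      enorm_sq_eq_lintegral, ← lintegral_const_mul' _ _ ENNReal.ofReal_ne_top]
    refine lintegral_mono_ae ?_
    filter_upwards [hf] with k hk
    by_cases h0 : f k = 0
    · simp [h0]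
    · gcongr
      rw [one_div]
      exact inv_anti₀ hε (hk h0)
  refine ⟨hC, ?_⟩
  obtain ⟨y, hy, hle⟩ := exists_annihilation_apply hω hnn hpos f (by positivity) hC
    (mem_fieldEnergy_graph Ω)
  refine ⟨y, hy, abs_le_of_sq_le_sq' ?_ (by positivity) |>.2⟩
  rw [mul_pow, Real.sq_sqrt (by positivity)]
  calc ‖y‖ ^ 2 ≤ ε⁻¹ * ‖f‖ ^ 2 * B := hle
    _ = _ := by ring

/-- The pull-through formula: on a ground state, `a(f)` acts as `∫ conj f(k) u(k) dk`, for test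
functions supported where `ω` is bounded and bounded away from `0`. -/
theorem annihilation_ground_eq_integral (hK : IsSelfAdjoint K) (hHI : IsSymmetricOp HI)
    (hH : IsSelfAdjoint (totalHamiltonian K ω HI))
    (hω : Measurable ω) (hnn : ∀ k, 0 ≤ ω k) (hpos : ∀ᵐ k, 0 < ω k)
    {g : Momentum d → StateSpace 𝒦 d} (Ω : (totalHamiltonian K ω HI).domain) {E₀ : ℝ}
    (hE₀ : FormBound (totalHamiltonian K ω HI) E₀)
    (hΩ : totalHamiltonian K ω HI Ω = (E₀ : ℂ) • (Ω : StateSpace 𝒦 d))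
    (hcomm : ∀ f : OneBoson d, MemLp (fun k => f k / (Real.sqrt (ω k) : ℂ)) 2 volume →
      ∀ Φ ∈ (totalHamiltonian K ω HI).domain,
      ∀ (hΦ : Φ ∈ HI†.domain ⊓ (oneTensor 𝒦 (annihilation f))†.domain)
        (hΨ : (Ω : StateSpace 𝒦 d) ∈ HI.domain ⊓ (oneTensor 𝒦 (annihilation f)).domain),
        weakCommutator HI (oneTensor 𝒦 (annihilation f)) ⟨Φ, hΦ⟩ ⟨Ω, hΨ⟩
          = ∫ k, conj (f k) * inner ℂ Φ (g k))
    {u : Momentum d → StateSpace 𝒦 d} (hu : MemLp u 2)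
    (hu_eq : ∀ᵐ k, ∀ Φ : (totalHamiltonian K ω HI).domain,
      inner ℂ (totalHamiltonian K ω HI Φ - (E₀ : ℂ) • (Φ : StateSpace 𝒦 d)) (u k)
        + (ω k : ℂ) * inner ℂ (Φ : StateSpace 𝒦 d) (u k) = inner ℂ (Φ : StateSpace 𝒦 d) (g k))
    {ε l : ℝ} (hε : 0 < ε) (hεl : ε ≤ l) (f : OneBoson d)
    (hf : ∀ᵐ k, f k ≠ 0 → ε ≤ ω k ∧ ω k ≤ l) :
    ((Ω : StateSpace 𝒦 d), ∫ k, conj (f k) • u k) ∈ (oneTensor 𝒦 (annihilation f)).graph := by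
  obtain ⟨c₁, hc₁, H₁⟩ := exists_annihilation_ground_le hω hnn hpos Ω hε
  obtain ⟨c₂, hc₂, H₂⟩ := norm_integral_conj_smul_le hu
  have hl : 0 < l := hε.trans_le hεl
  let U : OneBoson d → StateSpace 𝒦 d := fun f => ∫ k, conj (f k) • u k
  -- With `D(f) = a(f)Ω - U f` the weak equations give `(H - E₀ + l) D(f) = D((l - ω)f)`, so `l
  -- ‖D(f)‖ ≤ ‖D((l - ω)f)‖`. On the support of `f` one has `0 ≤ l - ω ≤ l - ε`, and each step gains
  -- the factor `(l - ε)/l < 1`.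
  have main : ∀ n : ℕ, ∀ f : OneBoson d, (∀ᵐ k, f k ≠ 0 → ε ≤ ω k ∧ ω k ≤ l) →
      ∀ y, ((Ω : StateSpace 𝒦 d), y) ∈ (oneTensor 𝒦 (annihilation f)).graph →
      ‖y - U f‖ ≤ (c₁ + c₂) * ((l - ε) / l) ^ n * ‖f‖ := by
    intro n
    induction n with
    | zero =>
      intro f hf y hy
      obtain ⟨-, y₁, hy₁, hle⟩ := H₁ f (hf.mono fun k hk h => (hk h).1)
      rw [annihilation_graph_eq hy hy₁, pow_zero, mul_one, add_mul]
      exact (norm_sub_le _ _).trans (add_le_add hle (H₂ f))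
    | succ n ih =>
      intro f hf y hy
      have hmeas : AEStronglyMeasurable (fun k => (ω k : ℂ) * f k) volume :=
        (Complex.measurable_ofReal.comp hω).aestronglyMeasurable.mul (Lp.aestronglyMeasurable f)
      have hmem : MemLp (fun k => (ω k : ℂ) * f k) 2 := by
        refine (Lp.memLp f).of_le_mul (c := l) hmeas ?_
        filter_upwards [hf] with k hk
        by_cases h0 : f k = 0
        · simp [h0]
        · rw [norm_mul, Complex.norm_real, Real.norm_of_nonneg (hnn k)]
          gcongr
          exact (hk h0).2
      let f' : OneBoson d := hmem.toLp
      have hf' : f' =ᵐ[volume] fun k => (ω k : ℂ) * f k := hmem.coeFn_toLp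
      have hf's : ∀ᵐ k, f' k ≠ 0 → ε ≤ ω k ∧ ω k ≤ l := by
        filter_upwards [hf, hf'] with k h1 h2 h3
        rw [h2] at h3
        exact h1 (right_ne_zero_of_mul h3)
      have hf₁e : ((l : ℂ) • f - f' : OneBoson d) =ᵐ[volume]
          fun k => (l : ℂ) * f k - (ω k : ℂ) * f k := by
        filter_upwards [hf', Lp.coeFn_sub ((l : ℂ) • f) f', Lp.coeFn_smul (l : ℂ) f]
          with k h1 h2 h3
        rw [h2, Pi.sub_apply, h3, h1, Pi.smul_apply, smul_eq_mul]
      have hf₁s : ∀ᵐ k, ((l : ℂ) • f - f' : OneBoson d) k ≠ 0 → ε ≤ ω k ∧ ω k ≤ l := by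
        filter_upwards [hf, hf₁e] with k h1 h2 h3
        rw [h2, ← sub_mul] at h3
        exact h1 (right_ne_zero_of_mul h3)
      have hf₁n : ‖(l : ℂ) • f - f'‖ ≤ (l - ε) * ‖f‖ := by
        refine Lp.norm_le_mul_norm_of_ae_le_mul ?_
        filter_upwards [hf, hf₁e] with k h1 h2
        rw [h2, ← sub_mul, norm_mul]
        by_cases h0 : f k = 0
        · simp [h0]
        · gcongr
          rw [← Complex.ofReal_sub, Complex.norm_real,
            Real.norm_of_nonneg (sub_nonneg.2 (h1 h0).2)]
          linarith [(h1 h0).1]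
      obtain ⟨hC, -⟩ := H₁ f (hf.mono fun k hk h => (hk h).1)
      obtain ⟨-, y', hy', -⟩ := H₁ f' (hf's.mono fun k hk h => (hk h).1)
      have h1 := ih _ hf₁s _ (annihilation_graph_sub l hy hy')
      have hU : U ((l : ℂ) • f - f') = (l : ℂ) • U f - U f' := by
        have i1 : Integrable fun k => (l : ℂ) • (conj (f k) • u k) :=
          (integrable_conj_smul_of_memLp hu f).smul (l : ℂ)
        simp only [U]
        rw [← integral_smul, ← integral_sub i1 (integrable_conj_smul_of_memLp hu f')]
        refine integral_congr_ae ?_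
        filter_upwards [hf₁e, hf'] with k h1 h2
        rw [h1, h2]
        simp only [map_sub, map_mul, Complex.conj_ofReal]
        module
      have hdiv : MemLp (fun k => f k / (Real.sqrt (ω k) : ℂ)) 2 volume := by
        refine (Lp.memLp f).of_le_mul (c := (Real.sqrt ε)⁻¹) ?_ ?_
        · have : AEStronglyMeasurable (fun k => f k * ((Real.sqrt (ω k))⁻¹ : ℝ)) volume :=
            (Lp.aestronglyMeasurable f).mul
              (Complex.measurable_ofReal.comp hω.sqrt.inv).aestronglyMeasurable
          refine this.congr (Eventually.of_forall fun k => ?_)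
          simp [div_eq_mul_inv]
        · filter_upwards [hf] with k hk
          by_cases h0 : f k = 0
          · simp [h0]
          · rw [norm_div, Complex.norm_real, Real.norm_of_nonneg (Real.sqrt_nonneg _),
              div_eq_inv_mul]
            gcongr
            exact (hk h0).1
      have hweak : ∀ z : (totalHamiltonian K ω HI).domain,
          inner ℂ (totalHamiltonian K ω HI z - (E₀ : ℂ) • (z : StateSpace 𝒦 d)) (y - U f)
            = -inner ℂ (z : StateSpace 𝒦 d) (y' - U f') := by
        intro z
        have e1 := inner_totalHamiltonian_annihilation hK hHI hH hω hnn hpos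
          (by positivity) hC hf' z Ω hΩ (hcomm f hdiv z z.2) hy hy'
        have e2 : inner ℂ (totalHamiltonian K ω HI z - (E₀ : ℂ) • (z : StateSpace 𝒦 d)) (U f)
            + inner ℂ (z : StateSpace 𝒦 d) (U f')
            = ∫ k, conj (f k) * inner ℂ (z : StateSpace 𝒦 d) (g k) := by
          have i1 := integrable_conj_smul_of_memLp hu f
          have i2 := integrable_conj_smul_of_memLp hu f'
          rw [← integral_inner i1, ← integral_inner i2,
            ← integral_add (i1.const_inner _) (i2.const_inner _)]
          refine integral_congr_ae ?_
          filter_upwards [hu_eq, hf'] with k h1 h2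
          rw [h2, ← h1 z]
          simp only [inner_smul_right, map_mul, Complex.conj_ofReal]
          ring
        rw [inner_sub_right, inner_sub_right]
        linear_combination e1 - e2
      have h2 := norm_le_of_weak hH hE₀ hweak l
      have h3 : (l : ℂ) • (y - U f) - (y' - U f') = (l : ℂ) • y - y' - U ((l : ℂ) • f - f') := by
        rw [hU]; module
      rw [h3] at h2
      have hq : 0 ≤ (l - ε) / l := div_nonneg (sub_nonneg.2 hεl) hl.le
      calc ‖y - U f‖ = l⁻¹ * (l * ‖y - U f‖) := by field_simp
        _ ≤ l⁻¹ * ((c₁ + c₂) * ((l - ε) / l) ^ n * ((l - ε) * ‖f‖)) := by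
            refine mul_le_mul_of_nonneg_left (h2.trans (h1.trans ?_)) (by positivity)
            exact mul_le_mul_of_nonneg_left hf₁n (by positivity)
        _ = _ := by rw [pow_succ]; ring
  obtain ⟨-, y, hy, -⟩ := H₁ f (hf.mono fun k hk h => (hk h).1)
  have hlim : Tendsto (fun n : ℕ => (c₁ + c₂) * ((l - ε) / l) ^ n * ‖f‖) atTop
      (𝓝 ((c₁ + c₂) * 0 * ‖f‖)) := by
    refine ((tendsto_pow_atTop_nhds_zero_of_lt_one (div_nonneg (sub_nonneg.2 hεl) hl.le)
      ((div_lt_one hl).2 (by linarith))).const_mul _).mul_const _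
  rw [mul_zero, zero_mul] at hlim
  have h0 : ‖y - U f‖ ≤ 0 := ge_of_tendsto' hlim fun n => main n f hf y hy
  have : y = U f := sub_eq_zero.1 (norm_le_zero_iff.1 h0)
  rw [this] at hy
  exact hy

end Ground

end BoseField

end

noncomputable section

namespace BoseField

/-! ### Weak derivatives of functions that are differentiable off a countable set -/

section WeakDerivative

variable {d : ℕ}

/-- For `d > 1` the points whose line in direction `j` meets a given point form a line, a null set;
countably many of these are still null. -/
theorem ae_line_disjoint (hd : d ≠ 1) {J : Set (Momentum d)} (hJ : J.Countable) (j : Fin d) :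
    ∀ᵐ k : Momentum d, ∀ t : ℝ, k + t • EuclideanSpace.single j (1 : ℝ) ∉ J := by
  set e : Momentum d := EuclideanSpace.single j (1 : ℝ)
  have hd2 : 1 < d := by have := j.pos; omega
  have hne : (Submodule.span ℝ {e} : Submodule ℝ (Momentum d)) ≠ ⊤ := by
    intro h
    have h1 := finrank_span_singleton (K := ℝ) (v := e) (by simp [e])
    rw [h, finrank_top, finrank_euclideanSpace_fin] at h1
    omega
  have h1 : ∀ p ∈ J, ∀ᵐ k : Momentum d, ∀ t : ℝ, k + t • e ≠ p := by
    intro p _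
    have h2 : volume ((AffineSubspace.mk' p (Submodule.span ℝ {e}) : AffineSubspace ℝ (Momentum d))
        : Set (Momentum d)) = 0 := by
      refine Measure.addHaar_affineSubspace _ _ fun h => hne ?_
      rw [← AffineSubspace.direction_mk' p (Submodule.span ℝ {e}), h,
        AffineSubspace.direction_top]
    filter_upwards [measure_eq_zero_iff_ae_notMem.1 h2] with k hk t ht
    refine hk ?_
    rw [SetLike.mem_coe, AffineSubspace.mem_mk']
    refine Submodule.mem_span_singleton.2 ⟨-t, ?_⟩
    rw [← ht, vsub_eq_sub]
    module
  filter_upwards [(ae_ball_iff hJ).2 h1] with k hk t ht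
  exact hk _ ht t rfl

/-- The integral of a derivative over the whole space vanishes. -/
theorem integral_lineDeriv_eq_zero {φ F : Momentum d → ℂ} {J : Set (Momentum d)}
    (hJ : J.Countable) (j : Fin d)
    (hF : ∀ k ∉ J, HasLineDerivAt ℝ φ (F k) k (EuclideanSpace.single j 1))
    (hc : d = 1 → Continuous φ) (hφ : Integrable φ) (hFi : Integrable F) : ∫ k, F k = 0 := by
  set e : Momentum d := EuclideanSpace.single j (1 : ℝ) with he
  have he0 : e ≠ 0 := by simp [he]
  have hderiv : ∀ (k : Momentum d) (t : ℝ), k + t • e ∉ J →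
      HasDerivAt (fun s : ℝ => φ (k + s • e)) (F (k + t • e)) t := by
    intro k t ht
    have h1 : HasDerivAt (fun s : ℝ => φ (k + t • e + s • e)) (F (k + t • e)) (t - t) := by
      rw [sub_self]; exact hF _ ht
    have h2 := h1.comp_sub_const t t
    refine h2.congr_of_eventuallyEq (Eventually.of_forall fun s => ?_)
    simp only
    congr 1
    module
  -- When `d = 1` the only line is the whole space, which cannot avoid `J`; this is why continuity
  -- is assumed in that case.
  have hcont : ∀ᵐ k : Momentum d, Continuous fun s : ℝ => φ (k + s • e) := by
    by_cases hd : d = 1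
    · exact Eventually.of_forall fun k => (hc hd).comp (by fun_prop)
    · filter_upwards [ae_line_disjoint hd hJ j] with k hk
      exact continuous_iff_continuousAt.2 fun t => (hderiv k t (hk t)).continuousAt
  -- By translation invariance `∫ (φ(k + e) - φ(k)) dk = 0`. Writing the difference as `∫ F(k + t e)
  -- dt` over `t ∈ (0, 1]` and exchanging the integrals turns the same quantity into `∫ F`.
  let ν : Measure ℝ := volume.restrict (Set.Ioc 0 1)
  have hmp : MeasurePreserving (fun p : ℝ × Momentum d => (p.1, p.2 + p.1 • e))
      (ν.prod volume) (ν.prod volume) := by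
    refine (MeasurePreserving.id ν).skew_product (g := fun t k => k + t • e) ?_
      (Eventually.of_forall fun t => ?_)
    · exact Continuous.measurable (by simp only [Function.uncurry_def]; fun_prop)
    · exact map_add_right_eq_self volume (t • e)
  have hint : Integrable (fun p : ℝ × Momentum d => F (p.2 + p.1 • e)) (ν.prod volume) := by
    have h1 : Integrable (fun p : ℝ × Momentum d => F p.2) (ν.prod volume) :=
      hFi.comp_snd ν
    exact hmp.integrable_comp_of_integrable h1
  have hftc : ∀ᵐ k : Momentum d, ∫ t, F (k + t • e) ∂ν = φ (k + e) - φ k := by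
    filter_upwards [hcont, hint.prod_left_ae] with k h1 h2
    have hcount : {t : ℝ | k + t • e ∈ J}.Countable := by
      refine hJ.preimage_of_injOn (f := fun t : ℝ => k + t • e) fun s _ t _ hst => ?_
      exact smul_left_injective ℝ he0 (add_left_cancel hst)
    have h3 := integral_eq_of_hasDerivAt_off_countable (fun s : ℝ => φ (k + s • e))
      (fun t => F (k + t • e)) (a := 0) (b := 1) hcount h1.continuousOn
      (fun t ht => hderiv k t ht.2)
      ((intervalIntegrable_iff_integrableOn_Ioc_of_le zero_le_one).2 h2)
    rw [intervalIntegral.integral_of_le zero_le_one] at h3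
    rw [h3]
    simp
  have h1 : ∫ k, ∫ t, F (k + t • e) ∂ν = 0 := by
    rw [integral_congr_ae hftc, integral_sub (hφ.comp_add_right e) hφ, integral_add_right_eq_self,
      sub_self]
  have h2 : ∫ t, (∫ k, F (k + t • e)) ∂ν = 0 := by
    rw [← h1, integral_integral_swap hint]
  simp only [integral_add_right_eq_self] at h2
  simpa [ν] using h2

theorem deriv_smoothTransition_of_neg {x : ℝ} (h : x < 0) :
    deriv Real.smoothTransition x = 0 := by
  have : Real.smoothTransition =ᶠ[𝓝 x] fun _ => 0 := by
    filter_upwards [gt_mem_nhds h] with y hy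
    exact Real.smoothTransition.zero_of_nonpos hy.le
  rw [this.deriv_eq, deriv_const]

theorem deriv_smoothTransition_of_gt {x : ℝ} (h : 1 < x) :
    deriv Real.smoothTransition x = 0 := by
  have : Real.smoothTransition =ᶠ[𝓝 x] fun _ => 1 := by
    filter_upwards [lt_mem_nhds h] with y hy
    exact Real.smoothTransition.one_of_one_le hy.le
  rw [this.deriv_eq, deriv_const]

/-- Used at `x = nω - 1`, where `x + 1 = nω`, to bound `nω S'(nω - 1)` uniformly in `n`. The
derivative lives on `[0, 1]`, where `x + 1 ≤ 2`. -/
theorem exists_bound_deriv_smoothTransition :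
    ∃ C, 0 ≤ C ∧ ∀ x, (x + 1) * |deriv Real.smoothTransition x| ≤ C := by
  have hc : Continuous (deriv Real.smoothTransition) :=
    (Real.smoothTransition.contDiff (n := 1)).continuous_deriv le_rfl
  obtain ⟨M, hM⟩ := (isCompact_Icc (a := (0 : ℝ)) (b := 1)).exists_bound_of_continuousOn
    hc.continuousOn
  have hM0 : 0 ≤ M := (norm_nonneg _).trans (hM 0 (by simp))
  refine ⟨2 * M, by positivity, fun x => ?_⟩
  rcases lt_or_ge x 0 with h | h
  · rw [deriv_smoothTransition_of_neg h, abs_zero, mul_zero]; positivity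
  rcases lt_or_ge 1 x with h' | h'
  · rw [deriv_smoothTransition_of_gt h', abs_zero, mul_zero]; positivity
  · have := hM x ⟨h, h'⟩
    rw [Real.norm_eq_abs] at this
    exact mul_le_mul (by linarith) this (abs_nonneg _) (by norm_num)

theorem measurable_partialD (j : Fin d) {V : Type*} [NormedAddCommGroup V] [NormedSpace ℝ V]
    [CompleteSpace V] [MeasurableSpace V] [BorelSpace V] (g : Momentum d → V) :
    Measurable (partialD j g) :=
  measurable_fderiv_apply_const ℝ g _

/-- Integration by parts for a square integrable function that is differentiable off a countable
set and the zeros of `ω`, near which it is controlled by `ω / |∂ω|`. -/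
theorem integral_conj_partialD_mul {ω : Momentum d → ℝ} (hω : Continuous ω)
    (hnn : ∀ k, 0 ≤ ω k) (hpos : ∀ᵐ k, 0 < ω k) {J : Set (Momentum d)} (hJ : J.Countable)
    (hωd : ∀ k ∉ J, DifferentiableAt ℝ ω k) {h : Momentum d → ℂ}
    (hd : ∀ k ∉ J, 0 < ω k → DifferentiableAt ℝ h k)
    (hc : d = 1 → ∀ k, 0 < ω k → ContinuousAt h k) (j : Fin d) (hh : MemLp h 2)
    (hv : MemLp (partialD j h) 2)
    (hωh : MemLp (fun k => ((partialD j ω k / ω k : ℝ) : ℂ) * h k) 2)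
    (ψ : SchwartzMap (Momentum d) ℂ) :
    ∫ k, conj (partialD j ψ k) * h k = -∫ k, conj (ψ k) * partialD j h k := by
  set e : Momentum d := EuclideanSpace.single j (1 : ℝ) with he
  obtain ⟨C, hC0, hC⟩ := exists_bound_deriv_smoothTransition
  let S : ℝ → ℝ := Real.smoothTransition
  have hSc : Continuous S := Real.smoothTransition.continuous
  have hS'c : Continuous (deriv S) :=
    (Real.smoothTransition.contDiff (n := 1)).continuous_deriv le_rfl
  have hSd : ∀ x, HasDerivAt S (deriv S x) x := fun x =>
    ((Real.smoothTransition.contDiff (n := 1)).differentiable one_ne_zero x).hasDerivAt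
  have hψ : MemLp (fun k => conj (ψ k)) 2 := (ψ.memLp 2 volume).star
  have hψ' : MemLp (fun k => conj (partialD j ψ k)) 2 := by
    have := (SchwartzMap.memLp (LineDeriv.lineDerivOp e ψ) 2 volume).star
    exact this
  -- The cutoff `S(nω - 1)` is `0` for `ω ≤ 1/n` and `1` for `ω ≥ 2/n`, so `φ n` vanishes near the
  -- zeros of `ω`.
  let φ : ℕ → Momentum d → ℂ := fun n k => (S (n * ω k - 1) : ℂ) * (h k * conj (ψ k))
  let A : Momentum d → ℂ := fun k => partialD j h k * conj (ψ k) + h k * conj (partialD j ψ k)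
  -- The term in which the derivative falls on the cutoff: `n ∂ω S'` is written as `(nω S') ·
  -- (∂ω/ω)`, a uniformly bounded factor times one that is integrable against `h ψ`.
  let B : ℕ → Momentum d → ℂ := fun n k =>
    ((deriv S (n * ω k - 1) * (n * ω k) : ℝ) : ℂ)
      * (((partialD j ω k / ω k : ℝ) : ℂ) * h k * conj (ψ k))
  let F : ℕ → Momentum d → ℂ := fun n k => B n k + (S (n * ω k - 1) : ℂ) * A k
  have hA : Integrable A :=
    (hv.integrable_mul hψ).add (hh.integrable_mul hψ')
  have hωhψ : Integrable fun k => ((partialD j ω k / ω k : ℝ) : ℂ) * h k * conj (ψ k) :=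
    hωh.integrable_mul hψ
  have hbS : ∀ x, ‖(S x : ℂ)‖ ≤ 1 := fun x => by
    rw [Complex.norm_real, Real.norm_of_nonneg (Real.smoothTransition.nonneg x)]
    exact Real.smoothTransition.le_one x
  have hbS' : ∀ (n : ℕ) k, ‖((deriv S (n * ω k - 1) * (n * ω k) : ℝ) : ℂ)‖ ≤ C := fun n k => by
    rw [Complex.norm_real, norm_mul, Real.norm_eq_abs, mul_comm,
      Real.norm_of_nonneg (mul_nonneg n.cast_nonneg (hnn k))]
    simpa using hC (n * ω k - 1)
  have hmS : ∀ n : ℕ, AEStronglyMeasurable (fun k => (S (n * ω k - 1) : ℂ)) volume := fun n =>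
    Continuous.aestronglyMeasurable (by fun_prop)
  have hmS' : ∀ n : ℕ,
      AEStronglyMeasurable (fun k => ((deriv S (n * ω k - 1) * (n * ω k) : ℝ) : ℂ)) volume :=
    fun n => Continuous.aestronglyMeasurable (by fun_prop)
  have hBi : ∀ n, Integrable (B n) := fun n =>
    hωhψ.bdd_mul (hmS' n) (Eventually.of_forall (hbS' n))
  have hAi : ∀ n : ℕ, Integrable fun k => (S (n * ω k - 1) : ℂ) * A k := fun n =>
    hA.bdd_mul (hmS n) (Eventually.of_forall fun k => hbS _)
  have hφi : ∀ n, Integrable (φ n) := fun n =>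
    (hh.integrable_mul hψ).bdd_mul (hmS n) (Eventually.of_forall fun k => hbS _)
  have hzero : ∀ (n : ℕ) k, ω k = 0 → φ n =ᶠ[𝓝 k] fun _ => 0 := by
    intro n k hk
    have h1 : ∀ᶠ q in 𝓝 k, (n : ℝ) * ω q - 1 < 0 :=
      ContinuousAt.eventually_lt (by fun_prop) continuousAt_const (by rw [hk]; simp)
    filter_upwards [h1] with q hq
    simp only [φ, S]
    rw [Real.smoothTransition.zero_of_nonpos hq.le]
    simp
  have hline : ∀ n, ∀ k ∉ J, HasLineDerivAt ℝ (φ n) (F n k) k e := by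
    intro n k hk
    rcases (hnn k).eq_or_lt with h0 | h0
    · have h1 : F n k = 0 := by
        simp only [F, B, S]
        rw [← h0, mul_zero, zero_sub, Real.smoothTransition.zero_of_nonpos (by norm_num)]
        simp
      rw [h1]
      exact ((hasFDerivAt_const (0 : ℂ) k).congr_of_eventuallyEq (hzero n k h0.symm)).hasLineDerivAt
        e |>.congr_deriv (by simp)
    · have hx : ∀ {G : Type} [NormedAddCommGroup G] [NormedSpace ℝ G] (g : Momentum d → G),
          DifferentiableAt ℝ g k → HasDerivAt (fun t : ℝ => g (k + t • e)) (partialD j g k) 0 :=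
        fun g hg => hg.hasFDerivAt.hasLineDerivAt e
      have h1 := hx ω (hωd k hk)
      have h2 := hx h (hd k hk h0)
      have h3 := (hx ψ ψ.differentiableAt).star
      have hk0 : k + (0 : ℝ) • e = k := by simp
      have h4 : HasDerivAt (fun t : ℝ => S (n * ω (k + t • e) - 1))
          (deriv S (n * ω k - 1) * (n * partialD j ω k)) 0 := by
        have := ((h1.const_mul (n : ℝ)).sub_const 1)
        have h5 := hSd (n * ω k - 1)
        have h6 : HasDerivAt S (deriv S (n * ω k - 1)) (n * ω (k + (0 : ℝ) • e) - 1) := by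
          rw [hk0]; exact h5
        exact h6.comp (0 : ℝ) this
      have h5 := (h4.ofReal_comp).mul (h2.mul h3)
      refine h5.congr_deriv ?_
      simp only [F, B, A, hk0, Pi.mul_apply]
      have hne : (ω k : ℂ) ≠ 0 := Complex.ofReal_ne_zero.2 h0.ne'
      simp only [Complex.ofReal_mul, Complex.ofReal_div, Complex.ofReal_natCast,
        ← starRingEnd_apply]
      field_simp
  have hcont : d = 1 → ∀ n, Continuous (φ n) := by
    intro h1 n
    refine continuous_iff_continuousAt.2 fun k => ?_
    rcases (hnn k).eq_or_lt with h0 | h0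
    · exact continuousAt_const.congr (hzero n k h0.symm).symm
    · have h2 := hc h1 k h0
      have h3 : ContinuousAt (fun k => conj (ψ k)) k :=
        (Complex.continuous_conj.comp ψ.continuous).continuousAt
      have h4 : ContinuousAt (fun k => (S (n * ω k - 1) : ℂ)) k :=
        Continuous.continuousAt (by fun_prop)
      exact h4.mul (h2.mul h3)
  have hint : ∀ n, ∫ k, F n k = 0 := fun n =>
    integral_lineDeriv_eq_zero hJ j (hline n) (fun h1 => hcont h1 n) (hφi n)
      ((hBi n).add (hAi n))
  have hlim : Tendsto (fun n => ∫ k, F n k) atTop (𝓝 (∫ k, A k)) := by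
    refine tendsto_integral_of_dominated_convergence
      (fun k => C * ‖((partialD j ω k / ω k : ℝ) : ℂ) * h k * conj (ψ k)‖ + ‖A k‖)
      (fun n => ((hBi n).add (hAi n)).1) ((hωhψ.norm.const_mul C).add hA.norm)
      (fun n => Eventually.of_forall fun k => ?_) ?_
    · refine (norm_add_le _ _).trans (add_le_add ?_ ?_)
      · rw [norm_mul]
        exact mul_le_mul_of_nonneg_right (hbS' n k) (norm_nonneg _)
      · rw [norm_mul]
        exact mul_le_of_le_one_left (norm_nonneg _) (hbS _)
    -- Where `ω(k) > 0`, for large `n` the cutoff has reached its plateau: `B n k` is zero and `F n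
    -- k = A k`.
    · filter_upwards [hpos] with k hk
      refine tendsto_const_nhds.congr' ?_
      have h1 : Tendsto (fun n : ℕ => (n : ℝ) * ω k - 1) atTop atTop :=
        tendsto_atTop_add_const_right _ _ (tendsto_natCast_atTop_atTop.atTop_mul_const hk)
      filter_upwards [h1.eventually_gt_atTop 1] with n hn
      simp only [F, B, S]
      rw [deriv_smoothTransition_of_gt hn, Real.smoothTransition.one_of_one_le hn.le]
      simp
  simp only [hint] at hlim
  have h0 := tendsto_nhds_unique hlim tendsto_const_nhds
  simp only [A] at h0
  have i1 : Integrable fun k => partialD j h k * conj (ψ k) := hv.integrable_mul hψ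
  have i2 : Integrable fun k => h k * conj (partialD j ψ k) := hh.integrable_mul hψ'
  rw [integral_add i1 i2] at h0
  rw [eq_neg_iff_add_eq_zero, ← h0, add_comm]
  congr 1 <;> exact integral_congr_ae (Eventually.of_forall fun k => mul_comm _ _)

/-- The Fourier transform carries weak derivatives to multiplication operators. -/
theorem fourier_of_weak_deriv {H V : OneBoson d} (j : Fin d)
    (h : ∀ ψ : SchwartzMap (Momentum d) ℂ,
      ∫ k, conj (partialD j ψ k) * H k = -∫ k, conj (ψ k) * V k) :
    ∀ᵐ q, Lp.fourierTransformₗᵢ (Momentum d) ℂ V q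
      = ((2 * Real.pi * q j : ℝ) : ℂ) * Complex.I * Lp.fourierTransformₗᵢ (Momentum d) ℂ H q := by
  set e : Momentum d := EuclideanSpace.single j (1 : ℝ) with he
  set FH := Lp.fourierTransformₗᵢ (Momentum d) ℂ H
  set FV := Lp.fourierTransformₗᵢ (Momentum d) ℂ V
  have hinner : ∀ (ψ : SchwartzMap (Momentum d) ℂ) (X : OneBoson d),
      ∫ k, conj (ψ k) * X k = ∫ k, conj (FourierTransform.fourier ψ k)
        * Lp.fourierTransformₗᵢ (Momentum d) ℂ X k := by
    intro ψ X
    have h1 : ∀ (ψ : SchwartzMap (Momentum d) ℂ) (X : OneBoson d),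
        inner ℂ (ψ.toLp 2) X = ∫ k, conj (ψ k) * X k := by
      intro ψ X
      rw [L2.inner_def]
      refine integral_congr_ae ?_
      filter_upwards [ψ.coeFn_toLp 2 volume] with k hk
      rw [hk, RCLike.inner_apply, mul_comm]
    rw [← h1, ← h1, ← SchwartzMap.toLp_fourier_eq]
    exact (Lp.inner_fourier_eq _ _).symm
  have key : ∀ ψ : SchwartzMap (Momentum d) ℂ,
      ∫ q, conj (ψ q) * (FV q - ((2 * Real.pi * q j : ℝ) : ℂ) * Complex.I * FH q) = 0 := by
    intro ψ
    -- The test function is chosen on the Fourier side. Parseval turns the hypothesis for its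
    -- inverse transform `θ` into an identity tested against `conj ψ`.
    let θ : SchwartzMap (Momentum d) ℂ := FourierTransformInv.fourierInv ψ
    have hθ : FourierTransform.fourier θ = ψ := FourierTransform.fourier_fourierInv_eq ψ
    have hg : (fun q : Momentum d => inner ℝ q e).HasTemperateGrowth := by fun_prop
    have h2 : ∀ q, FourierTransform.fourier (LineDeriv.lineDerivOp e θ) q
        = (2 * Real.pi * Complex.I) * (((q j : ℝ) : ℂ) * ψ q) := by
      intro q
      rw [SchwartzMap.fourier_lineDerivOp_eq, hθ]
      rw [smul_apply, SchwartzMap.smulLeftCLM_apply_apply hg, smul_eq_mul, he,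
        EuclideanSpace.inner_single_right]
      simp
    have i1 : Integrable fun q => conj (ψ q) * FV q :=
      (ψ.memLp 2 volume).star.integrable_mul (Lp.memLp FV)
    have i2 : Integrable fun q =>
        conj (FourierTransform.fourier (LineDeriv.lineDerivOp e θ) q) * FH q :=
      (SchwartzMap.memLp (FourierTransform.fourier (LineDeriv.lineDerivOp e θ)) 2
        volume).star.integrable_mul (Lp.memLp FH)
    have h3 := h θ
    rw [hinner θ V, hθ] at h3
    have h4 := hinner (LineDeriv.lineDerivOp e θ) H
    have h5 : ∫ k, conj (LineDeriv.lineDerivOp e θ k) * H k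
        = ∫ k, conj (partialD j θ k) * H k := rfl
    rw [h5, h3] at h4
    have h6 : ∫ q, conj (ψ q) * (FV q - ((2 * Real.pi * q j : ℝ) : ℂ) * Complex.I * FH q)
        = ∫ q, (conj (ψ q) * FV q
          + conj (FourierTransform.fourier (LineDeriv.lineDerivOp e θ) q) * FH q) := by
      refine integral_congr_ae (Eventually.of_forall fun q => ?_)
      simp only [h2, map_mul, Complex.conj_I, Complex.conj_ofReal, Complex.ofReal_mul,
        Complex.ofReal_ofNat, map_ofNat]
      ring
    rw [h6, integral_add i1 i2, ← h4]
    exact add_neg_cancel _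
  have hloc : LocallyIntegrable (fun q : Momentum d =>
      FV q - ((2 * Real.pi * q j : ℝ) : ℂ) * Complex.I * FH q) := by
    refine ((Lp.memLp FV).locallyIntegrable one_le_two).sub ?_
    rw [← locallyIntegrableOn_univ]
    refine LocallyIntegrableOn.continuousOn_mul (s := Set.univ)
      (g := fun q : Momentum d => ((2 * Real.pi * q j : ℝ) : ℂ) * Complex.I)
      (locallyIntegrableOn_univ.2 ((Lp.memLp FH).locallyIntegrable one_le_two))
      (Continuous.continuousOn (by fun_prop)) isOpen_univ.isLocallyClosed
  -- A locally integrable function that is orthogonal to all smooth compactly supported functions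
  -- vanishes almost everywhere.
  have := ae_eq_zero_of_integral_contDiff_smul_eq_zero hloc fun g hg hgs => by
    have h1 := key ((hgs.comp_left (g := Complex.ofReal) rfl).toSchwartzMap
      (Complex.ofRealCLM.contDiff.comp hg))
    rw [← h1]
    refine integral_congr_ae (Eventually.of_forall fun q => ?_)
    change g q • _ = conj ((g q : ℝ) : ℂ) * _
    rw [Complex.conj_ofReal, Complex.real_smul]
  filter_upwards [this] with q hq
  exact sub_eq_zero.1 hq

end WeakDerivative

end BoseField

end

noncomputable section

namespace BoseField

/-! ### The resolvent applied to the interaction -/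

section ResolventFunction

variable {d : ℕ}

theorem ae_notMem_of_countable (j : Fin d) {J : Set (Momentum d)} (hJ : J.Countable) :
    ∀ᵐ k : Momentum d, k ∉ J := by
  have : Nontrivial (Momentum d) := ⟨EuclideanSpace.single j (1 : ℝ), 0, by simp⟩
  exact hJ.ae_notMem volume

variable {E : Type*} [NormedAddCommGroup E] [InnerProductSpace ℂ E]
  {R : ℝ → E →L[ℂ] E} {ω : Momentum d → ℝ} {g : Momentum d → E}

theorem continuousAt_resolvent_apply (hR : ∀ s > 0, HasDerivAt R (-(R s * R s)) s)
    (hω : Continuous ω) {k : Momentum d} (hk : 0 < ω k) (hg : ContinuousAt g k) :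
    ContinuousAt (fun k => R (ω k) (g k)) k :=
  ((hR _ hk).continuousAt.comp (f := ω) hω.continuousAt).clm_apply hg

/-- Continuity off a null set, on the second countable space of momenta, suffices; the space `E` may
be nonseparable. -/
theorem aestronglyMeasurable_resolvent_apply (hR : ∀ s > 0, HasDerivAt R (-(R s * R s)) s)
    (hω : Continuous ω) (hpos : ∀ᵐ k, 0 < ω k) {J : Set (Momentum d)} (hJ : ∀ᵐ k, k ∉ J)
    (hJm : MeasurableSet J) (hg : ∀ k ∉ J, ContinuousAt g k) :
    AEStronglyMeasurable (fun k => R (ω k) (g k)) volume := by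
  have hm : MeasurableSet ({k | 0 < ω k} ∩ Jᶜ) :=
    (measurableSet_lt measurable_const hω.measurable).inter hJm.compl
  have h1 : ContinuousOn (fun k => R (ω k) (g k)) ({k | 0 < ω k} ∩ Jᶜ) := fun k hk =>
    (continuousAt_resolvent_apply hR hω hk.1 (hg k hk.2)).continuousWithinAt
  have h2 := h1.aestronglyMeasurable (μ := volume) hm
  rwa [Measure.restrict_eq_self_of_ae_mem] at h2
  filter_upwards [hpos, hJ] with k h1 h2 using ⟨h1, h2⟩

theorem enorm_resolvent_apply_sq_le (hR : ∀ s > 0, ∀ x, ‖R s x‖ ≤ s⁻¹ * ‖x‖) {k : Momentum d}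
    (hk : 0 < ω k) : ‖R (ω k) (g k)‖ₑ ^ 2 ≤ ENNReal.ofReal (1 / ω k ^ 2 * ‖g k‖ ^ 2) := by
  rw [← ofReal_norm, ← ENNReal.ofReal_pow (norm_nonneg _)]
  refine ENNReal.ofReal_le_ofReal ?_
  calc ‖R (ω k) (g k)‖ ^ 2 ≤ ((ω k)⁻¹ * ‖g k‖) ^ 2 := by gcongr; exact hR _ hk _
    _ = _ := by rw [mul_pow, inv_pow, one_div]

/-- Chain and product rule with `R' = -R²`; the factor `R²` is the origin of the weight `1/ω⁴` in
the estimates. -/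
theorem hasFDerivAt_resolvent_apply (hR : ∀ s > 0, HasDerivAt R (-(R s * R s)) s)
    {k : Momentum d} (hk : 0 < ω k) (hω : DifferentiableAt ℝ ω k) (hg : DifferentiableAt ℝ g k) :
    DifferentiableAt ℝ (fun k => R (ω k) (g k)) k ∧ ∀ j, partialD j (fun k => R (ω k) (g k)) k
      = R (ω k) (partialD j g k) - partialD j ω k • R (ω k) (R (ω k) (g k)) := by
  let ρ := ContinuousLinearMap.restrictScalarsL ℂ E E ℝ ℝ
  have h1 : HasFDerivAt (fun k => R (ω k)) _ k := (hR _ hk).hasFDerivAt.comp k hω.hasFDerivAt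
  have h2 : HasFDerivAt (fun k => ρ (R (ω k))) _ k := ρ.hasFDerivAt.comp k h1
  have h3 := h2.clm_apply hg.hasFDerivAt
  refine ⟨h3.differentiableAt, fun j => ?_⟩
  have h4 := congrArg (fun T => T (EuclideanSpace.single j (1 : ℝ))) h3.fderiv
  refine h4.trans ?_
  simp [ρ, partialD, sub_eq_add_neg]

/-- The factor `2` from `(s + t)² ≤ 2(s² + t²)` is the one in `ξ_j`. -/
theorem enorm_partialD_resolvent_apply_sq_le (hR : ∀ s > 0, HasDerivAt R (-(R s * R s)) s)
    (hR' : ∀ s > 0, ∀ x, ‖R s x‖ ≤ s⁻¹ * ‖x‖)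
    {k : Momentum d} (hk : 0 < ω k) (hω : DifferentiableAt ℝ ω k) (hg : DifferentiableAt ℝ g k)
    (j : Fin d) : ‖partialD j (fun k => R (ω k) (g k)) k‖ₑ ^ 2
      ≤ 2 * (ENNReal.ofReal (1 / ω k ^ 2 * ‖partialD j g k‖ ^ 2)
        + ENNReal.ofReal (|partialD j ω k| ^ 2 / ω k ^ 4 * ‖g k‖ ^ 2)) := by
  rw [(hasFDerivAt_resolvent_apply hR hk hω hg).2 j, ← ofReal_norm,
    ← ENNReal.ofReal_pow (norm_nonneg _), ← ENNReal.ofReal_add (by positivity) (by positivity),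
    show (2 : ℝ≥0∞) = ENNReal.ofReal 2 by simp, ← ENNReal.ofReal_mul (by norm_num)]
  refine ENNReal.ofReal_le_ofReal ?_
  have h1 : ‖R (ω k) (partialD j g k)‖ ≤ (ω k)⁻¹ * ‖partialD j g k‖ := hR' _ hk _
  have h2 : ‖partialD j ω k • R (ω k) (R (ω k) (g k))‖
      ≤ |partialD j ω k| * ((ω k)⁻¹ * ((ω k)⁻¹ * ‖g k‖)) := by
    rw [norm_smul, Real.norm_eq_abs]
    gcongr
    refine (hR' _ hk _).trans ?_
    gcongr
    exact hR' _ hk _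
  have h3 := (norm_sub_le (R (ω k) (partialD j g k))
    (partialD j ω k • R (ω k) (R (ω k) (g k)))).trans (add_le_add h1 h2)
  calc ‖R (ω k) (partialD j g k) - partialD j ω k • R (ω k) (R (ω k) (g k))‖ ^ 2
      ≤ ((ω k)⁻¹ * ‖partialD j g k‖ + |partialD j ω k| * ((ω k)⁻¹ * ((ω k)⁻¹ * ‖g k‖))) ^ 2 := by
        gcongr
    _ ≤ 2 * (((ω k)⁻¹ * ‖partialD j g k‖) ^ 2
        + (|partialD j ω k| * ((ω k)⁻¹ * ((ω k)⁻¹ * ‖g k‖))) ^ 2) := add_sq_le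
    _ = _ := by field_simp

end ResolventFunction

/-! ### Weak derivatives and Fourier moments of scalar components. -/

section Bessel

variable {d : ℕ} {E : Type*} [NormedAddCommGroup E] [InnerProductSpace ℂ E]

/-- The index set may be uncountable, since `𝒦` need not be separable, so the sum is controlled
through finite partial sums instead of being exchanged with the integral. -/
theorem tsum_lintegral_le_of_bessel {X ι : Type*} [MeasurableSpace X] {μ : Measure X}
    {F : ι → X → ℝ≥0∞} {b : X → ℝ≥0∞} (hF : ∀ i, AEMeasurable (F i) μ)
    (h : ∀ᵐ x ∂μ, ∑' i, F i x ≤ b x) : ∑' i, ∫⁻ x, F i x ∂μ ≤ ∫⁻ x, b x ∂μ := by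
  rw [ENNReal.tsum_eq_iSup_sum]
  refine iSup_le fun s => ?_
  rw [← lintegral_finsetSum' s fun i _ => hF i]
  refine lintegral_mono_ae ?_
  filter_upwards [h] with x hx
  exact (ENNReal.sum_le_tsum s).trans hx

theorem partialD_clm_comp (L : E →L[ℂ] ℂ) {u : Momentum d → E} {k : Momentum d}
    (hu : DifferentiableAt ℝ u k) (j : Fin d) :
    DifferentiableAt ℝ (fun k => L (u k)) k ∧
      partialD j (fun k => L (u k)) k = L (partialD j u k) := by
  have h := (L.restrictScalars ℝ).hasFDerivAt.comp k hu.hasFDerivAt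
  exact ⟨h.differentiableAt,
    congrArg (fun T => T (EuclideanSpace.single j (1 : ℝ))) h.fderiv⟩

theorem memLp_two_of_lintegral {X F : Type*} [MeasurableSpace X] [NormedAddCommGroup F]
    {μ : Measure X} {f : X → F}
    (hf : AEStronglyMeasurable f μ) (h : ∫⁻ x, ‖f x‖ₑ ^ 2 ∂μ < ∞) : MemLp f 2 μ := by
  refine ⟨hf, ?_⟩
  rw [eLpNorm_lt_top_iff_lintegral_rpow_enorm_lt_top (by norm_num) (by norm_num)]
  simpa using h

theorem enorm_ofReal (x : ℝ) : ‖(x : ℂ)‖ₑ = ‖x‖ₑ := by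
  rw [← ofReal_norm, ← ofReal_norm, Complex.norm_real]

theorem enorm_ofReal_mul_I_mul (x : ℝ) (w : ℂ) :
    ‖(x : ℂ) * Complex.I * w‖ₑ = ‖x‖ₑ * ‖w‖ₑ := by
  rw [enorm_mul, enorm_mul, enorm_ofReal, ← ofReal_norm Complex.I, Complex.norm_I,
    ENNReal.ofReal_one, mul_one]

/-- For a function with square integrable gradient, the momentum moments of its components. -/
theorem lintegral_fourier_component {ω : Momentum d → ℝ} (hω : Continuous ω)
    (hnn : ∀ k, 0 ≤ ω k) (hpos : ∀ᵐ k, 0 < ω k) {J : Set (Momentum d)} (hJ : J.Countable)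
    (hωd : ∀ k ∉ J, DifferentiableAt ℝ ω k) {u : Momentum d → E}
    (hud : ∀ k ∉ J, 0 < ω k → DifferentiableAt ℝ u k)
    (huc : d = 1 → ∀ k, 0 < ω k → ContinuousAt u k) (j : Fin d)
    (hu' : ∫⁻ k, ‖partialD j u k‖ₑ ^ 2 < ∞)
    (hωu : ∫⁻ k, ‖partialD j ω k / ω k‖ₑ ^ 2 * ‖u k‖ₑ ^ 2 < ∞)
    (L : E →L[ℂ] ℂ) {W : OneBoson d} (hW : W =ᵐ[volume] fun k => L (u k)) :
    ∫⁻ q, ‖2 * Real.pi * q j‖ₑ ^ 2 * ‖Lp.fourierTransformₗᵢ (Momentum d) ℂ W q‖ₑ ^ 2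
      = ∫⁻ k, ‖partialD j (fun k => L (u k)) k‖ₑ ^ 2 := by
  have hL : ∀ x, ‖L x‖ₑ ≤ ‖L‖ₑ * ‖x‖ₑ := fun x => L.le_opENorm x
  have hh : MemLp (fun k => L (u k)) 2 := (Lp.memLp W).ae_eq hW
  have hv : MemLp (partialD j fun k => L (u k)) 2 := by
    refine memLp_two_of_lintegral (measurable_partialD j _).aestronglyMeasurable ?_
    calc ∫⁻ k, ‖partialD j (fun k => L (u k)) k‖ₑ ^ 2
        ≤ ∫⁻ k, ‖L‖ₑ ^ 2 * ‖partialD j u k‖ₑ ^ 2 := by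
          refine lintegral_mono_ae ?_
          filter_upwards [ae_notMem_of_countable j hJ, hpos] with k h1 h2
          rw [(partialD_clm_comp L (hud k h1 h2) j).2, ← mul_pow]
          gcongr
          exact hL _
      _ = ‖L‖ₑ ^ 2 * ∫⁻ k, ‖partialD j u k‖ₑ ^ 2 := lintegral_const_mul' _ _ (by finiteness)
      _ < ∞ := ENNReal.mul_lt_top (by finiteness) hu'
  -- This square integrability is what makes the cutoff at the zeros of `ω` harmless in the
  -- integration by parts.
  have hωh : MemLp (fun k => ((partialD j ω k / ω k : ℝ) : ℂ) * L (u k)) 2 := by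
    refine memLp_two_of_lintegral (AEStronglyMeasurable.mul ?_ hh.1) ?_
    · exact (Complex.measurable_ofReal.comp
        ((measurable_partialD j ω).div hω.measurable)).aestronglyMeasurable
    calc ∫⁻ k, ‖((partialD j ω k / ω k : ℝ) : ℂ) * L (u k)‖ₑ ^ 2
        ≤ ∫⁻ k, ‖L‖ₑ ^ 2 * (‖partialD j ω k / ω k‖ₑ ^ 2 * ‖u k‖ₑ ^ 2) := by
          refine lintegral_mono fun k => ?_
          simp only
          rw [enorm_mul, enorm_ofReal, mul_left_comm, ← mul_pow, ← mul_pow]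
          gcongr
          exact hL _
      _ = ‖L‖ₑ ^ 2 * ∫⁻ k, ‖partialD j ω k / ω k‖ₑ ^ 2 * ‖u k‖ₑ ^ 2 :=
          lintegral_const_mul' _ _ (by finiteness)
      _ < ∞ := ENNReal.mul_lt_top (by finiteness) hωu
  let V : OneBoson d := hv.toLp
  have hweak : ∀ ψ : SchwartzMap (Momentum d) ℂ,
      ∫ k, conj (partialD j ψ k) * W k = -∫ k, conj (ψ k) * V k := by
    intro ψ
    have h1 := integral_conj_partialD_mul hω hnn hpos hJ hωd
      (fun k hk hk' => (partialD_clm_comp L (hud k hk hk') j).1)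
      (fun h1 k hk => (L.continuous.continuousAt).comp (huc h1 k hk)) j hh hv hωh ψ
    rw [integral_congr_ae (g := fun k => conj (partialD j ψ k) * L (u k)), h1]
    · congr 1
      refine integral_congr_ae ?_
      filter_upwards [hv.coeFn_toLp] with k hk
      rw [hk]
    · filter_upwards [hW] with k hk
      rw [hk]
  have h1 := fourier_of_weak_deriv j hweak
  have h2 := enorm_sq_eq_lintegral (Lp.fourierTransformₗᵢ (Momentum d) ℂ V)
  rw [LinearIsometryEquiv.enorm_map, enorm_sq_eq_lintegral] at h2
  calc _ = ∫⁻ q, ‖Lp.fourierTransformₗᵢ (Momentum d) ℂ V q‖ₑ ^ 2 := by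
        refine lintegral_congr_ae ?_
        filter_upwards [h1] with q hq
        rw [hq, enorm_ofReal_mul_I_mul, mul_pow]
    _ = _ := by
        rw [← h2]
        refine lintegral_congr_ae ?_
        filter_upwards [hv.coeFn_toLp] with k hk
        rw [hk]

end Bessel

end BoseField

end

noncomputable section

namespace BoseField

/-! ### Second quantization of Fourier multipliers -/

section SecondQuantization

variable {d : ℕ} {m : Momentum d → ℝ}

theorem memLp_top_prod (hm : Measurable m) (h0 : ∀ k, 0 ≤ m k) (h1 : ∀ k, m k ≤ 1) (n : ℕ) :
    MemLp (fun x : Fin n → Momentum d => ((∏ i, m ((2 * Real.pi) • x i) : ℝ) : ℂ)) ∞ volume := by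
  refine memLp_top_of_bound (C := 1) ?_ (Eventually.of_forall fun x => ?_)
  · refine (Complex.measurable_ofReal.comp ?_).aestronglyMeasurable
    exact Finset.measurable_prod _ fun i _ =>
      hm.comp ((measurable_pi_apply i).const_smul (2 * Real.pi))
  · rw [Complex.norm_real, Real.norm_of_nonneg (Finset.prod_nonneg fun i _ => h0 _)]
    exact Finset.prod_le_one (fun i _ => h0 _) fun i _ => h1 _

theorem memLp_top_multiplier (hm : Measurable m) (h0 : ∀ k, 0 ≤ m k) (h1 : ∀ k, m k ≤ 1) :
    MemLp (fun x : Momentum d => (m ((2 * Real.pi) • x) : ℂ)) ∞ volume := by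
  refine memLp_top_of_bound (C := 1) ?_ (Eventually.of_forall fun x => ?_)
  · exact (Complex.measurable_ofReal.comp
      (hm.comp (measurable_id.const_smul (2 * Real.pi)))).aestronglyMeasurable
  · rw [Complex.norm_real, Real.norm_of_nonneg (h0 _)]
    exact h1 _

theorem fourierMultiplier_graph (m : Momentum d → ℝ) :
    (fourierMultiplier m).graph = fourierMultiplierGraph m := by
  refine Submodule.toLinearPMap_graph_eq _ ?_
  rintro ⟨x, y⟩ hp hx
  simp only at hx ⊢
  subst hx
  have h : Lp.fourierTransformₗᵢ (Momentum d) ℂ y = 0 := by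
    refine Lp.ext ?_
    filter_upwards [hp, Lp.coeFn_zero ℂ 2 (volume : Measure (Momentum d))] with k a b
    simp only [map_zero] at a
    rw [a, b]
    simp
  exact (LinearIsometryEquiv.map_eq_zero_iff _).1 h

section

variable (hm : Measurable m) (h0 : ∀ k, 0 ≤ m k) (h1 : ∀ k, m k ≤ 1)

/-- `m(-i∇)` as a bounded operator. -/
def multiplierL : OneBoson d →L[ℂ] OneBoson d :=
  ((Lp.fourierTransformₗᵢ (Momentum d) ℂ).symm.toContinuousLinearEquiv : OneBoson d →L[ℂ] _).comp
    ((mulL (memLp_top_multiplier hm h0 h1)).comp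
      ((Lp.fourierTransformₗᵢ (Momentum d) ℂ).toContinuousLinearEquiv : OneBoson d →L[ℂ] _))

/-- `⊗ⁿ m(-i∇)` as a bounded operator. -/
def multiplierPowL (n : ℕ) : NBoson d n →L[ℂ] NBoson d n :=
  ((tensorPow (Lp.fourierTransformₗᵢ (Momentum d) ℂ) n).symm.toContinuousLinearEquiv :
      NBoson d n →L[ℂ] _).comp
    ((mulL (memLp_top_prod hm h0 h1 n)).comp
      ((tensorPow (Lp.fourierTransformₗᵢ (Momentum d) ℂ) n).toContinuousLinearEquiv :
        NBoson d n →L[ℂ] _))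

theorem fourier_multiplierL (f : OneBoson d) :
    Lp.fourierTransformₗᵢ (Momentum d) ℂ (multiplierL hm h0 h1 f)
      = mulL (memLp_top_multiplier hm h0 h1) (Lp.fourierTransformₗᵢ (Momentum d) ℂ f) :=
  LinearIsometryEquiv.apply_symm_apply _ _

theorem tensorPow_multiplierPowL {n : ℕ} (Ψ : NBoson d n) :
    tensorPow (Lp.fourierTransformₗᵢ (Momentum d) ℂ) n (multiplierPowL hm h0 h1 n Ψ)
      = mulL (memLp_top_prod hm h0 h1 n)
        (tensorPow (Lp.fourierTransformₗᵢ (Momentum d) ℂ) n Ψ) :=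
  LinearIsometryEquiv.apply_symm_apply _ _

theorem multiplierL_mem_graph (f : OneBoson d) :
    (f, multiplierL hm h0 h1 f) ∈ (fourierMultiplier m).graph := by
  rw [fourierMultiplier_graph]
  change ∀ᵐ x, _ = _
  simp only
  rw [fourier_multiplierL]
  exact mulL_coeFn _ _

theorem fourierMultiplier_apply (f : (fourierMultiplier m).domain) :
    fourierMultiplier m f = multiplierL hm h0 h1 f :=
  LinearPMap.mem_graph_snd_inj _ ((fourierMultiplier m).mem_graph f)
    (multiplierL_mem_graph hm h0 h1 f) rfl

theorem multiplierPowL_elemTensor {n : ℕ} (f : Fin n → OneBoson d) :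
    multiplierPowL hm h0 h1 n (elemTensor f)
      = elemTensor fun i => multiplierL hm h0 h1 (f i) := by
  apply (tensorPow (Lp.fourierTransformₗᵢ (Momentum d) ℂ) n).injective
  rw [tensorPow_multiplierPowL, tensorPow_elemTensor, tensorPow_elemTensor]
  simp only [fourier_multiplierL]
  refine Lp.ext ?_
  have h2 : ∀ i, ∀ᵐ x : Fin n → Momentum d,
      mulL (memLp_top_multiplier hm h0 h1) (Lp.fourierTransformₗᵢ (Momentum d) ℂ (f i)) (x i)
        = (m ((2 * Real.pi) • x i) : ℂ) * Lp.fourierTransformₗᵢ (Momentum d) ℂ (f i) (x i) :=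
    fun i => (Measure.quasiMeasurePreserving_eval (fun _ : Fin n => (volume : Measure (Momentum d))) i).ae
      (mulL_coeFn (memLp_top_multiplier hm h0 h1) _)
  filter_upwards [mulL_coeFn (memLp_top_prod hm h0 h1 n)
      (elemTensor fun i => Lp.fourierTransformₗᵢ (Momentum d) ℂ (f i)),
    elemTensor_coeFn fun i => Lp.fourierTransformₗᵢ (Momentum d) ℂ (f i),
    elemTensor_coeFn fun i =>
      mulL (memLp_top_multiplier hm h0 h1) (Lp.fourierTransformₗᵢ (Momentum d) ℂ (f i)),
    ae_all_iff.2 h2] with x a b c e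
  rw [a, b, c]
  simp only [e, Finset.prod_mul_distrib, Complex.ofReal_prod]

/-- Both inclusions are closure arguments: the generating pairs lie in the closed graph of the
bounded operator, and conversely every elementary tensor is admissible because `m(-i∇)` is
everywhere defined. -/
theorem mem_tensorPowerGraph_iff {n : ℕ} (p : NBoson d n × NBoson d n) :
    p ∈ tensorPowerGraph (fourierMultiplier m) n ↔ p.2 = multiplierPowL hm h0 h1 n p.1 := by
  set T := multiplierPowL hm h0 h1 n
  constructor
  · intro hp
    let S : Submodule ℂ (NBoson d n × NBoson d n) := (T : NBoson d n →ₗ[ℂ] NBoson d n).graph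
    have hS : IsClosed (S : Set (NBoson d n × NBoson d n)) := by
      have : (S : Set (NBoson d n × NBoson d n)) = {p | p.2 = T p.1} := by
        ext p; exact LinearMap.mem_graph_iff _ p
      rw [this]
      exact isClosed_eq continuous_snd (T.continuous.comp continuous_fst)
    have h : tensorPowerGraph (fourierMultiplier m) n ≤ S := by
      refine Submodule.topologicalClosure_minimal _ (Submodule.span_le.2 ?_) hS
      rintro ⟨x, y⟩ ⟨f, hx, hy⟩
      have e1 : x = elemTensor fun i => (f i : OneBoson d) :=
        Lp.ext (hx.trans (elemTensor_coeFn _).symm)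
      have e2 : y = elemTensor fun i => fourierMultiplier m (f i) :=
        Lp.ext (hy.trans (elemTensor_coeFn _).symm)
      refine (LinearMap.mem_graph_iff _ _).2 ?_
      rw [e1, e2]
      simp only [fourierMultiplier_apply hm h0 h1]
      exact (multiplierPowL_elemTensor hm h0 h1 _).symm
    exact (LinearMap.mem_graph_iff _ _).1 (h hp)
  · obtain ⟨x, y⟩ := p
    intro hy
    simp only at hy
    subst hy
    let S : Submodule ℂ (NBoson d n) := (tensorPowerGraph (fourierMultiplier m) n).comap
      (LinearMap.id.prod (T : NBoson d n →ₗ[ℂ] NBoson d n))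
    have hS : IsClosed (S : Set (NBoson d n)) :=
      (Submodule.isClosed_topologicalClosure _).preimage
        (continuous_id.prodMk T.continuous)
    have h : (Submodule.span ℂ (Set.range
        (elemTensor : (Fin n → OneBoson d) → NBoson d n))).topologicalClosure ≤ S := by
      refine Submodule.topologicalClosure_minimal _ (Submodule.span_le.2 ?_) hS
      rintro _ ⟨f, rfl⟩
      refine Submodule.le_topologicalClosure _ (Submodule.subset_span ?_)
      have hf : ∀ i, f i ∈ (fourierMultiplier m).domain := fun i =>
        LinearPMap.mem_domain_of_mem_graph (multiplierL_mem_graph hm h0 h1 (f i))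
      refine ⟨fun i => ⟨f i, hf i⟩, elemTensor_coeFn f, ?_⟩
      change T (elemTensor f) =ᵐ[volume] _
      rw [multiplierPowL_elemTensor]
      simp only [fourierMultiplier_apply hm h0 h1]
      exact elemTensor_coeFn _
    rw [dense_span_elemTensor] at h
    exact h (Submodule.mem_top : x ∈ ⊤)

theorem permL_mulL {n : ℕ} {φ : (Fin n → Momentum d) → ℂ} (hφ : MemLp φ ∞ volume)
    (hs : ∀ (σ : Equiv.Perm (Fin n)) x, φ (x ∘ σ) = φ x) (σ : Equiv.Perm (Fin n))
    (Ψ : NBoson d n) : permL σ (mulL hφ Ψ) = mulL hφ (permL σ Ψ) := by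
  refine Lp.ext ?_
  filter_upwards [permL_coeFn σ (mulL hφ Ψ), mulL_coeFn hφ (permL σ Ψ), permL_coeFn σ Ψ,
    (measurePreserving_perm σ).quasiMeasurePreserving.ae (mulL_coeFn hφ Ψ)] with x a b c e
  rw [a, b, c, e, hs]

theorem permL_multiplierPowL {n : ℕ} (σ : Equiv.Perm (Fin n)) (Ψ : NBoson d n) :
    permL σ (multiplierPowL hm h0 h1 n Ψ) = multiplierPowL hm h0 h1 n (permL σ Ψ) := by
  apply (tensorPow (Lp.fourierTransformₗᵢ (Momentum d) ℂ) n).injective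
  rw [tensorPow_multiplierPowL, tensorPow_permL, tensorPow_permL, tensorPow_multiplierPowL,
    permL_mulL]
  intro σ x
  congr 1
  exact Equiv.prod_comp σ fun i => m ((2 * Real.pi) • x i)

theorem mem_gam_graph_iff (p : BoseFock d × BoseFock d) :
    p ∈ (Gam (fourierMultiplier m)).graph ↔
      ∀ n, component d n p.2 = multiplierPowL hm h0 h1 n (component d n p.1) := by
  have key : ∀ p : BoseFock d × BoseFock d,
      p ∈ (⨅ n : ℕ, (tensorPowerGraph (fourierMultiplier m) n).comap
        ((component d n).prodMap (component d n)))
      ↔ ∀ n, component d n p.2 = multiplierPowL hm h0 h1 n (component d n p.1) := by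
    intro p
    simp only [Submodule.mem_iInf, Submodule.mem_comap]
    exact forall_congr' fun n => mem_tensorPowerGraph_iff hm h0 h1 _
  rw [Gam, Submodule.toLinearPMap_graph_eq, key]
  rintro ⟨x, y⟩ hp hx
  rw [key] at hp
  simp only at hx hp ⊢
  subst hx
  refine fock_ext fun n => ?_
  rw [hp, map_zero, map_zero]

/-- Conjugation with the Fourier transform in every variable turns `⊗ⁿ m(-i∇)` into multiplication
by a product, with `2π` coming from the normalization of the transform. -/
theorem norm_multiplierPowL_sub_sq {n : ℕ} (Ψ : NBoson d n) :
    ‖Ψ - multiplierPowL hm h0 h1 n Ψ‖ₑ ^ 2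
      = ∫⁻ x, ‖1 - ∏ i, m ((2 * Real.pi) • x i)‖ₑ ^ 2
        * ‖tensorPow (Lp.fourierTransformₗᵢ (Momentum d) ℂ) n Ψ x‖ₑ ^ 2 := by
  rw [← LinearIsometryEquiv.enorm_map (tensorPow (Lp.fourierTransformₗᵢ (Momentum d) ℂ) n),
    map_sub, tensorPow_multiplierPowL, enorm_sq_eq_lintegral]
  set Φ := tensorPow (Lp.fourierTransformₗᵢ (Momentum d) ℂ) n Ψ
  refine lintegral_congr_ae ?_
  filter_upwards [Lp.coeFn_sub Φ (mulL (memLp_top_prod hm h0 h1 n) Φ),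
    mulL_coeFn (memLp_top_prod hm h0 h1 n) Φ] with x a b
  rw [a, Pi.sub_apply, b, ← one_sub_mul, enorm_mul, mul_pow, ← Complex.ofReal_one,
    ← Complex.ofReal_sub, enorm_ofReal]

theorem norm_multiplierPowL_sub_le {n : ℕ} (Ψ : NBoson d n) :
    ‖Ψ - multiplierPowL hm h0 h1 n Ψ‖ ≤ ‖Ψ‖ := by
  have h : ‖Ψ - multiplierPowL hm h0 h1 n Ψ‖ₑ ^ 2 ≤ ‖Ψ‖ₑ ^ 2 := by
    rw [norm_multiplierPowL_sub_sq,
      ← LinearIsometryEquiv.enorm_map (tensorPow (Lp.fourierTransformₗᵢ (Momentum d) ℂ) n) Ψ,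
      enorm_sq_eq_lintegral]
    refine lintegral_mono fun x => mul_le_of_le_one_left' (pow_le_one' ?_ 2)
    have h2 : 0 ≤ ∏ i, m ((2 * Real.pi) • x i) := Finset.prod_nonneg fun i _ => h0 _
    have h3 : ∏ i, m ((2 * Real.pi) • x i) ≤ 1 :=
      Finset.prod_le_one (fun i _ => h0 _) fun i _ => h1 _
    rw [← ofReal_norm, Real.norm_of_nonneg (by linarith)]
    exact ENNReal.ofReal_le_one.2 (by linarith)
  rw [← ofReal_norm, ← ofReal_norm, ← ENNReal.ofReal_pow (norm_nonneg _),
    ← ENNReal.ofReal_pow (norm_nonneg _), ENNReal.ofReal_le_ofReal_iff (by positivity)] at h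
  exact (pow_le_pow_iff_left₀ (norm_nonneg _) (norm_nonneg _) two_ne_zero).1 h

theorem mem_sub_gam_graph_iff (p : BoseFock d × BoseFock d) :
    p ∈ (idOp (BoseFock d) - Gam (fourierMultiplier m)).graph ↔ ∀ n, component d n p.2
      = component d n p.1 - multiplierPowL hm h0 h1 n (component d n p.1) := by
  obtain ⟨x, y⟩ := p
  constructor
  · intro hp n
    obtain ⟨z, hz1, hz2⟩ := (LinearPMap.mem_graph_iff _).1 hp
    simp only at hz1 hz2 ⊢
    have hz : (z : BoseFock d) ∈ (Gam (fourierMultiplier m)).domain := z.2.2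
    have h2 := (mem_gam_graph_iff hm h0 h1 _).1
      ((Gam (fourierMultiplier m)).mem_graph ⟨z, hz⟩) n
    have h3 : (idOp (BoseFock d) - Gam (fourierMultiplier m)) z
        = (z : BoseFock d) - Gam (fourierMultiplier m) ⟨z, hz⟩ := rfl
    rw [← hz2, h3, map_sub, ← hz1]
    congr 1
  · intro hp
    simp only at hp
    have h2 : (x, x - y) ∈ (Gam (fourierMultiplier m)).graph := by
      rw [mem_gam_graph_iff hm h0 h1]
      intro n
      simp only
      rw [map_sub, hp n, sub_sub_cancel]
    have hx := LinearPMap.mem_domain_of_mem_graph h2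
    refine (LinearPMap.mem_graph_iff _).2 ⟨⟨x, ⟨trivial, hx⟩⟩, rfl, ?_⟩
    have h3 : (idOp (BoseFock d) - Gam (fourierMultiplier m)) ⟨x, ⟨trivial, hx⟩⟩
        = x - Gam (fourierMultiplier m) ⟨x, hx⟩ := rfl
    rw [h3, LinearPMap.mem_graph_snd_inj _
      ((Gam (fourierMultiplier m)).mem_graph ⟨x, hx⟩) h2 rfl]
    exact sub_sub_cancel x y

include hm h0 h1 in
theorem sub_gam_isClosed : (idOp (BoseFock d) - Gam (fourierMultiplier m)).IsClosed := by
  rw [LinearPMap.IsClosed]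
  have : ((idOp (BoseFock d) - Gam (fourierMultiplier m)).graph : Set (BoseFock d × BoseFock d))
      = ⋂ n : ℕ, {p | component d n p.2
        = component d n p.1 - multiplierPowL hm h0 h1 n (component d n p.1)} := by
    ext p
    simp only [SetLike.mem_coe, Set.mem_iInter, Set.mem_ofPred_eq]
    exact mem_sub_gam_graph_iff hm h0 h1 p
  rw [this]
  refine isClosed_iInter fun n => isClosed_eq ((continuous_component n).comp continuous_snd) ?_
  have h2 := (continuous_component (d := d) n).comp
    (continuous_fst : Continuous fun p : BoseFock d × BoseFock d => p.1)
  exact h2.sub ((multiplierPowL hm h0 h1 n).continuous.comp h2)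

/-- Every vector is in the domain of `1 ⊗ (1 - Γ(m(-i∇)))`, which acts sector by sector. -/
theorem exists_defect_apply {𝒦 : Type*} [NormedAddCommGroup 𝒦] [InnerProductSpace ℂ 𝒦]
    [CompleteSpace 𝒦] {κ : Type*} (b : HilbertBasis κ ℂ 𝒦) (x : StateSpace 𝒦 d) :
    ∃ hx : x ∈ (oneTensor 𝒦 (idOp (BoseFock d) - Gam (fourierMultiplier m))).domain,
      ∀ i : κ × ℕ, sector b i (oneTensor 𝒦 (idOp (BoseFock d) - Gam (fourierMultiplier m)) ⟨x, hx⟩)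
        = sector b i x - multiplierPowL hm h0 h1 i.2 (sector b i x) := by
  obtain ⟨y, hy⟩ := exists_sector_eq b
    (fun i : κ × ℕ => sector b i x - multiplierPowL hm h0 h1 i.2 (sector b i x))
    (fun i σ => by rw [map_sub, permL_multiplierPowL, permL_sector])
    ((hasSum_norm_sq_sector b x).summable.of_nonneg_of_le (fun i => by positivity)
      fun i => by gcongr; exact norm_multiplierPowL_sub_le hm h0 h1 _)
  have hmem : (x, y) ∈ (oneTensor 𝒦 (idOp (BoseFock d) - Gam (fourierMultiplier m))).graph := by
    rw [oneTensor, mem_tensorOp_id_graph_iff b (sub_gam_isClosed hm h0 h1)]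
    intro a
    rw [mem_sub_gam_graph_iff hm h0 h1]
    exact fun n => hy (a, n)
  refine ⟨LinearPMap.mem_domain_of_mem_graph hmem, fun i => ?_⟩
  rw [LinearPMap.mem_graph_snd_inj _ (LinearPMap.mem_graph _ ⟨x, _⟩) hmem rfl, hy]

end

end SecondQuantization

end BoseField

end

noncomputable section

namespace BoseField

/-! ### Expansion of the localization defect in one-boson functions -/

section Expansion

theorem tsum_enorm_sq_of_hasSum {ι F : Type*} {G : ι → Type*} [NormedAddCommGroup F]
    [∀ i, NormedAddCommGroup (G i)] {f : ∀ i, G i} {x : F}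
    (h : HasSum (fun i => ‖f i‖ ^ 2) (‖x‖ ^ 2)) : ∑' i, ‖f i‖ₑ ^ 2 = ‖x‖ₑ ^ 2 := by
  have h1 := ENNReal.ofReal_tsum_of_nonneg (fun i => sq_nonneg ‖f i‖) h.summable
  rw [h.tsum_eq] at h1
  simpa only [ENNReal.ofReal_pow (norm_nonneg _), ofReal_norm] using h1.symm

theorem tsum_enorm_sq_inner {ι E : Type*} [NormedAddCommGroup E] [InnerProductSpace ℂ E]
    (b : HilbertBasis ι ℂ E) (x : E) : ∑' i, ‖inner ℂ (b i) x‖ₑ ^ 2 = ‖x‖ₑ ^ 2 := by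
  refine tsum_enorm_sq_of_hasSum ?_
  have h := Complex.hasSum_re (b.hasSum_inner_mul_inner x x)
  have e : (inner ℂ x x).re = ‖x‖ ^ 2 := inner_self_eq_norm_sq (𝕜 := ℂ) x
  rw [e] at h
  refine h.congr_fun fun i => ?_
  rw [← inner_conj_symm x, RCLike.conj_mul]
  norm_cast

variable {d : ℕ}

/-- Parseval in the product basis, with the first index summed for each fixed choice of the others.
-/
theorem tsum_enorm_contract_sq {ι : Type*} (e : HilbertBasis ι ℂ (OneBoson d)) {n : ℕ}
    (Φ : NBoson d (n + 1)) :
    ∑' I, ‖contract (tensorBasis e n I) Φ‖ₑ ^ 2 = ‖Φ‖ₑ ^ 2 := by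
  rw [← tsum_enorm_sq_inner (tensorBasis e (n + 1)),
    ← (Fin.consEquiv fun _ : Fin (n + 1) => ι).tsum_eq, ENNReal.tsum_prod', ENNReal.tsum_comm]
  refine tsum_congr fun I => ?_
  rw [← tsum_enorm_sq_inner e]
  refine tsum_congr fun i => ?_
  rw [inner_contract_right, tensorBasis_apply, tensorBasis_apply, ← elemTensor_cons]
  congr 4
  funext j
  refine Fin.cases ?_ (fun k => ?_) j <;> simp [Fin.consEquiv]

theorem contract_mulL {n : ℕ} {A : Set (Momentum d)}
    (h1 : MemLp (A.indicator fun _ => (1 : ℂ)) ∞ volume)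
    (h2 : MemLp (fun x : Fin (n + 1) → Momentum d => A.indicator (fun _ => (1 : ℂ)) (x 0)) ∞ volume)
    (g : NBoson d n) (Φ : NBoson d (n + 1)) :
    contract g (mulL h2 Φ) = mulL h1 (contract g Φ) := by
  have hs : ∀ {X : Type} [MeasurableSpace X] {μ : Measure X} {B : X → ℂ} (hB : MemLp B ∞ μ)
      (_ : ∀ x, conj (B x) = B x) (f f' : Lp ℂ 2 μ),
      inner ℂ f (mulL hB f') = inner ℂ (mulL hB f) f' := by
    intro X _ μ B hB hBr f f'
    rw [L2.inner_def, L2.inner_def]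
    refine integral_congr_ae ?_
    filter_upwards [mulL_coeFn hB f, mulL_coeFn hB f'] with x a b
    rw [a, b]
    simp only [RCLike.inner_apply, map_mul, hBr]
    ring
  have hr : ∀ q, conj (A.indicator (fun _ => (1 : ℂ)) q) = A.indicator (fun _ => (1 : ℂ)) q := by
    intro q
    by_cases hq : q ∈ A <;> simp [hq]
  refine ext_inner_left ℂ fun f => ?_
  rw [inner_contract_right, hs h2 fun x => hr (x 0), hs h1 hr, inner_contract_right]
  congr 1
  refine Lp.ext ?_
  filter_upwards [mulL_coeFn h2 (consTensor d n f g), consTensor_coeFn f g,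
    consTensor_coeFn (mulL h1 f) g,
    (quasiMeasurePreserving_zero d n).ae (mulL_coeFn h1 f)] with x a b c e
  rw [a, b, c, e]
  ring

theorem contract_tensorPow (V : OneBoson d ≃ₗᵢ[ℂ] OneBoson d) {n : ℕ} (g : NBoson d n)
    (Ψ : NBoson d (n + 1)) :
    contract (tensorPow V n g) (tensorPow V (n + 1) Ψ) = V (contract g Ψ) := by
  refine ext_inner_left ℂ fun f => ?_
  obtain ⟨f, rfl⟩ := V.surjective f
  rw [LinearIsometryEquiv.inner_map_map, inner_contract_right, inner_contract_right,
    ← tensorPow_consTensor, LinearIsometryEquiv.inner_map_map]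

theorem enorm_mulL_sq {X : Type*} [MeasurableSpace X] {μ : Measure X} {φ : X → ℂ}
    (h : MemLp φ ∞ μ) (f : Lp ℂ 2 μ) : ‖mulL h f‖ₑ ^ 2 = ∫⁻ x, ‖φ x‖ₑ ^ 2 * ‖f x‖ₑ ^ 2 ∂μ := by
  rw [enorm_sq_eq_lintegral]
  refine lintegral_congr_ae ?_
  filter_upwards [mulL_coeFn h f] with x a
  rw [a, enorm_mul, mul_pow]

theorem enorm_mulL_indicator_sq {X : Type*} [MeasurableSpace X] {μ : Measure X} {A : Set X}
    (h : MemLp (A.indicator fun _ => (1 : ℂ)) ∞ μ) (f : Lp ℂ 2 μ) :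
    ‖mulL h f‖ₑ ^ 2 = ∫⁻ x, A.indicator (fun _ => 1) x * ‖f x‖ₑ ^ 2 ∂μ := by
  rw [enorm_mulL_sq]
  refine lintegral_congr fun x => ?_
  by_cases hx : x ∈ A <;> simp [hx]

/-- A tail estimate for symmetric functions in terms of their one-boson components. -/
theorem lintegral_tail_eq_tsum {ι : Type*} (e : HilbertBasis ι ℂ (OneBoson d))
    (V : OneBoson d ≃ₗᵢ[ℂ] OneBoson d) {A : Set (Momentum d)} (hA : MeasurableSet A) {n : ℕ}
    {Ψ : NBoson d (n + 1)} (hΨ : ∀ σ, permL σ Ψ = Ψ) :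
    ∫⁻ x, (∑ i, A.indicator (fun _ => 1) (x i)) * ‖tensorPow V (n + 1) Ψ x‖ₑ ^ 2
      = ∑' I, ∫⁻ q, A.indicator (fun _ => 1) q
        * ‖V ((Real.sqrt (n + 1) : ℂ) • contract (tensorBasis e n I) Ψ) q‖ₑ ^ 2 := by
  set Φ := tensorPow V (n + 1) Ψ with hΦdef
  have hΦ : ∀ σ, permL σ Φ = Φ := fun σ => by rw [hΦdef, ← tensorPow_permL, hΨ]
  have h1 : MemLp (A.indicator fun _ => (1 : ℂ)) ∞ (volume : Measure (Momentum d)) := by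
    refine memLp_top_of_bound (C := 1)
      (measurable_const.indicator hA).aestronglyMeasurable (Eventually.of_forall fun x => ?_)
    by_cases hx : x ∈ A <;> simp [hx]
  have h2 : MemLp (fun x : Fin (n + 1) → Momentum d => A.indicator (fun _ => (1 : ℂ)) (x 0)) ∞
      volume := by
    refine memLp_top_of_bound (C := 1)
      ((measurable_const.indicator hA).comp (measurable_pi_apply 0)).aestronglyMeasurable
      (Eventually.of_forall fun x => ?_)
    by_cases hx : x 0 ∈ A <;> simp [hx]
  have h3 := lintegral_sum_symm hΦ (g := A.indicator fun _ => 1) (measurable_const.indicator hA)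
    (w := fun _ => 1) measurable_const fun _ _ => rfl
  simp only [one_mul] at h3
  rw [h3]
  have h4 : ∫⁻ x, A.indicator (fun _ => 1) (x 0) * ‖Φ x‖ₑ ^ 2 = ‖mulL h2 Φ‖ₑ ^ 2 := by
    rw [enorm_mulL_sq]
    refine lintegral_congr fun x => ?_
    by_cases hx : x 0 ∈ A <;> simp [hx]
  -- The sum is expanded in the basis transported by `V`, because contraction with `tensorPow V` of
  -- a basis vector commutes with `V`.
  rw [h4, ← tsum_enorm_contract_sq (mapBasis e V), ← ENNReal.tsum_mul_left]
  refine tsum_congr fun I => ?_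
  have h5 : tensorBasis (mapBasis e V) n I = tensorPow V n (tensorBasis e n I) := by
    rw [tensorBasis_apply, tensorBasis_apply, tensorPow_elemTensor]
    congr 1
  rw [contract_mulL h1 h2, h5, contract_tensorPow, ← enorm_mulL_indicator_sq h1, map_smul,
    map_smul, enorm_smul, mul_pow]
  congr 1
  rw [enorm_ofReal, ← ofReal_norm, Real.norm_of_nonneg (Real.sqrt_nonneg _),
    ← ENNReal.ofReal_pow (Real.sqrt_nonneg _), Real.sq_sqrt (by positivity),
    ENNReal.ofReal_add (by positivity) (by positivity), ENNReal.ofReal_natCast, ENNReal.ofReal_one]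

/-- `1 - ∏ m` lies in `[0, 1]` and vanishes when all momenta have norm at most `R`. It is therefore
dominated by the number of momenta beyond `R`, that is, by the second quantization of the tail
projection. -/
theorem norm_multiplierPowL_sub_sq_le {m : Momentum d → ℝ} (hm : Measurable m)
    (h0 : ∀ k, 0 ≤ m k) (h1 : ∀ k, m k ≤ 1) {R : ℝ} (hR : ∀ k, ‖k‖ ≤ R → m k = 1) {n : ℕ}
    (Ψ : NBoson d n) :
    ‖Ψ - multiplierPowL hm h0 h1 n Ψ‖ₑ ^ 2
      ≤ ∫⁻ x, (∑ i, {q | R < ‖(2 * Real.pi) • q‖}.indicator (fun _ => 1) (x i))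
        * ‖tensorPow (Lp.fourierTransformₗᵢ (Momentum d) ℂ) n Ψ x‖ₑ ^ 2 := by
  rw [norm_multiplierPowL_sub_sq]
  refine lintegral_mono fun x => mul_le_mul_left ?_ _
  by_cases hx : ∀ i, ‖(2 * Real.pi) • x i‖ ≤ R
  · rw [Finset.prod_eq_one fun i _ => hR _ (hx i)]
    simp
  · push Not at hx
    obtain ⟨i, hi⟩ := hx
    refine le_trans ?_ (Finset.single_le_sum (fun _ _ => zero_le) (Finset.mem_univ i))
    rw [Set.indicator_of_mem (by exact hi)]
    refine pow_le_one' ?_ 2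
    have h2 : 0 ≤ ∏ i, m ((2 * Real.pi) • x i) := Finset.prod_nonneg fun i _ => h0 _
    have h3 : ∏ i, m ((2 * Real.pi) • x i) ≤ 1 :=
      Finset.prod_le_one (fun i _ => h0 _) fun i _ => h1 _
    rw [← ofReal_norm, Real.norm_of_nonneg (by linarith)]
    exact ENNReal.ofReal_le_one.2 (by linarith)

variable {𝒦 : Type*} [NormedAddCommGroup 𝒦] [InnerProductSpace ℂ 𝒦] {κ : Type*}
  (b : HilbertBasis κ ℂ 𝒦) {ι : Type*} (e : HilbertBasis ι ℂ (OneBoson d))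

/-- The coefficients of a vector of the state space in the basis given by `b` and the elementary
tensors in `e`. -/
def coefL (β : κ × Σ n, (Fin n → ι)) : StateSpace 𝒦 d →L[ℂ] ℂ :=
  (innerSL ℂ (tensorBasis e β.2.1 β.2.2)).comp (sector b (β.1, β.2.1))

theorem coefL_apply (a : κ) (n : ℕ) (I : Fin n → ι) (x : StateSpace 𝒦 d) :
    coefL b e (a, ⟨n, I⟩) x = inner ℂ (tensorBasis e n I) (sector b (a, n) x) := rfl

theorem tsum_enorm_coefL_sq (x : StateSpace 𝒦 d) :
    ∑' β, ‖coefL b e β x‖ₑ ^ 2 = ‖x‖ₑ ^ 2 := by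
  rw [← tsum_enorm_sq_of_hasSum (hasSum_norm_sq_sector b x), ENNReal.tsum_prod', ENNReal.tsum_prod']
  refine tsum_congr fun a => ?_
  rw [ENNReal.tsum_sigma']
  refine tsum_congr fun n => ?_
  simp only [coefL_apply]
  exact tsum_enorm_sq_inner (tensorBasis e n) _

/-- The one-boson functions `k ↦ ⟨g, a(k) x⟩`. -/
def oneBosonCoef (x : StateSpace 𝒦 d) (β : κ × Σ n, (Fin n → ι)) : OneBoson d :=
  (Real.sqrt (β.2.1 + 1) : ℂ) • contract (tensorBasis e β.2.1 β.2.2) (sector b (β.1, β.2.1 + 1) x)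

theorem enorm_defect_sq_le [CompleteSpace 𝒦] {m : Momentum d → ℝ} (hm : Measurable m)
    (h0 : ∀ k, 0 ≤ m k) (h1 : ∀ k, m k ≤ 1) {R : ℝ} (hR : ∀ k, ‖k‖ ≤ R → m k = 1)
    (x : StateSpace 𝒦 d) :
    ∃ hx : x ∈ (oneTensor 𝒦 (idOp (BoseFock d) - Gam (fourierMultiplier m))).domain,
      ‖oneTensor 𝒦 (idOp (BoseFock d) - Gam (fourierMultiplier m)) ⟨x, hx⟩‖ₑ ^ 2
        ≤ ∑' β, ∫⁻ q, {q | R < ‖(2 * Real.pi) • q‖}.indicator (fun _ => 1) q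
          * ‖Lp.fourierTransformₗᵢ (Momentum d) ℂ (oneBosonCoef b e x β) q‖ₑ ^ 2 := by
  obtain ⟨hx, hs⟩ := exists_defect_apply hm h0 h1 b x
  refine ⟨hx, ?_⟩
  have hA : MeasurableSet {q : Momentum d | R < ‖(2 * Real.pi) • q‖} :=
    measurableSet_lt measurable_const (by fun_prop)
  rw [← tsum_enorm_sq_of_hasSum (hasSum_norm_sq_sector b _), ENNReal.tsum_prod', ENNReal.tsum_prod']
  refine ENNReal.tsum_le_tsum fun a => ?_
  simp only [hs]
  rw [ENNReal.tsum_sigma', tsum_eq_zero_add' ENNReal.summable]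
  -- The zero-boson sector has no defect, as the empty product is `1`. The sum thus starts at one
  -- boson, in accordance with the shift in `oneBosonCoef`.
  have hz := norm_multiplierPowL_sub_sq_le hm h0 h1 hR (sector b (a, 0) x)
  simp only [Finset.univ_eq_empty, Finset.sum_empty, zero_mul, lintegral_zero] at hz
  rw [nonpos_iff_eq_zero.1 hz, zero_add]
  refine ENNReal.tsum_le_tsum fun n => ?_
  refine (norm_multiplierPowL_sub_sq_le hm h0 h1 hR _).trans ?_
  rw [lintegral_tail_eq_tsum e _ hA fun σ => permL_sector b (a, n + 1) σ x]
  rfl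

/-- If `a(f) x = ∫ conj f(k) u(k) dk` for sufficiently many `f`, then the one-boson functions of
`x` are the coefficients of `u`. -/
theorem oneBosonCoef_ae_eq [CompleteSpace 𝒦] {ω : Momentum d → ℝ} (hω : Measurable ω)
    (hpos : ∀ᵐ k, 0 < ω k) {u : Momentum d → StateSpace 𝒦 d} (hu : MemLp u 2)
    {x : StateSpace 𝒦 d}
    (h : ∀ ε l : ℝ, 0 < ε → ε ≤ l → ∀ f : OneBoson d, (∀ᵐ k, f k ≠ 0 → ε ≤ ω k ∧ ω k ≤ l) →
      (x, ∫ k, conj (f k) • u k) ∈ (oneTensor 𝒦 (annihilation f)).graph)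
    (β : κ × Σ n, (Fin n → ι)) :
    oneBosonCoef b e x β =ᵐ[volume] fun k => coefL b e β (u k) := by
  obtain ⟨a, n, I⟩ := β
  set L := coefL b e (a, ⟨n, I⟩) with hL
  have hLu : MemLp (fun k => L (u k)) 2 := L.comp_memLp' hu
  let U : OneBoson d := hLu.toLp
  have hU : U =ᵐ[volume] fun k => L (u k) := hLu.coeFn_toLp
  set W := oneBosonCoef b e x (a, ⟨n, I⟩) with hW
  have hfW : ∀ ε l : ℝ, 0 < ε → ε ≤ l → ∀ f : OneBoson d,
      (∀ᵐ k, f k ≠ 0 → ε ≤ ω k ∧ ω k ≤ l) → inner ℂ f W = inner ℂ f U := by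
    intro ε l hε hεl f hf
    have h1 := (mem_oneTensor_annihilation_graph_iff b f _).1 (h ε l hε hεl f hf) a n
    simp only at h1
    have h2 : inner ℂ f W = L (∫ k, conj (f k) • u k) := by
      rw [hW, oneBosonCoef, inner_smul_right, inner_contract_right, ← inner_annih_right, hL,
        coefL_apply, h1, inner_smul_right]
    rw [h2, ← L.integral_comp_comm (integrable_conj_smul_of_memLp hu f), L2.inner_def]
    refine integral_congr_ae ?_
    filter_upwards [hU] with k hk
    rw [hk, map_smul, smul_eq_mul, RCLike.inner_apply, mul_comm]
  -- Equality is first shown on the band where `ω` lies in `[1/(N+1), N+1]`, by testing `W - U`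
  -- against its own restriction to that band. These bands exhaust almost all momenta since `ω > 0`
  -- almost everywhere.
  have hN : ∀ N : ℕ, ∀ᵐ k, ω k ∈ Set.Icc ((N : ℝ) + 1)⁻¹ (N + 1) → W k = U k := by
    intro N
    let S : Set (Momentum d) := {k | ω k ∈ Set.Icc ((N : ℝ) + 1)⁻¹ (N + 1)}
    have hS : MeasurableSet S := hω measurableSet_Icc
    have hSm : MemLp (S.indicator fun _ => (1 : ℂ)) ∞ (volume : Measure (Momentum d)) := by
      refine memLp_top_of_bound (C := 1)
        (measurable_const.indicator hS).aestronglyMeasurable (Eventually.of_forall fun x => ?_)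
      by_cases hx : x ∈ S <;> simp [hx]
    let f : OneBoson d := mulL hSm (W - U)
    have hfe : f =ᵐ[volume] fun k => S.indicator (fun _ => (1 : ℂ)) k * (W - U : OneBoson d) k :=
      mulL_coeFn hSm _
    have hfs : ∀ᵐ k, f k ≠ 0 → ((N : ℝ) + 1)⁻¹ ≤ ω k ∧ ω k ≤ N + 1 := by
      filter_upwards [hfe] with k hk hne
      by_contra hc
      have : k ∉ S := hc
      rw [hk, Set.indicator_of_notMem this, zero_mul] at hne
      exact hne rfl
    have h1 : ((N : ℝ) + 1)⁻¹ ≤ N + 1 :=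
      (inv_le_one_of_one_le₀ (by linarith [N.cast_nonneg (α := ℝ)])).trans
        (by linarith [N.cast_nonneg (α := ℝ)])
    have h2 := hfW _ _ (by positivity) h1 f hfs
    have h3 : inner ℂ f f = inner ℂ f (W - U) := by
      rw [L2.inner_def, L2.inner_def]
      refine integral_congr_ae ?_
      filter_upwards [hfe] with k hk
      rw [hk]
      by_cases hx : k ∈ S <;> simp [hx]
    rw [inner_sub_right, h2, sub_self, inner_self_eq_zero] at h3
    have h4 := Lp.coeFn_zero ℂ 2 (volume : Measure (Momentum d))
    rw [← h3] at h4
    filter_upwards [h4, hfe, Lp.coeFn_sub W U] with k a1 a2 a3 hk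
    have hkS : k ∈ S := hk
    rw [a1, Set.indicator_of_mem hkS, one_mul, a3, Pi.sub_apply, Pi.zero_apply] at a2
    exact (sub_eq_zero.1 a2.symm)
  filter_upwards [ae_all_iff.2 hN, hU, hpos] with k h1 h2 h3
  obtain ⟨N, hN1⟩ := exists_nat_ge (max (ω k) (ω k)⁻¹)
  rw [← h2]
  refine h1 N ⟨?_, ?_⟩
  · rw [inv_le_comm₀ (by positivity) h3]
    linarith [le_max_right (ω k) (ω k)⁻¹]
  · linarith [le_max_left (ω k) (ω k)⁻¹]

end Expansion

end BoseField

end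

noncomputable section

namespace BoseField

/-! ### The localization estimate -/

section Estimate

variable {d : ℕ}

/-- Chebyshev's inequality, in the form suited to the moments `2π q_j` produced by differentiation.
-/
theorem indicator_le_sum_sq {R : ℝ} (hR : 0 < R) (q : Momentum d) :
    {q : Momentum d | R < ‖(2 * Real.pi) • q‖}.indicator (fun _ => (1 : ℝ≥0∞)) q
      ≤ ENNReal.ofReal (1 / R ^ 2) * ∑ j, ‖2 * Real.pi * q j‖ₑ ^ 2 := by
  by_cases hq : R < ‖(2 * Real.pi) • q‖
  · rw [Set.indicator_of_mem (by exact hq)]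
    have h1 : ∑ j, ‖2 * Real.pi * q j‖ₑ ^ 2 = ENNReal.ofReal (‖(2 * Real.pi) • q‖ ^ 2) := by
      rw [EuclideanSpace.norm_sq_eq, ENNReal.ofReal_sum_of_nonneg fun i _ => by positivity]
      refine Finset.sum_congr rfl fun j _ => ?_
      rw [ENNReal.ofReal_pow (norm_nonneg _), ofReal_norm]
      rfl
    rw [h1, ← ENNReal.ofReal_mul (by positivity)]
    refine ENNReal.one_le_ofReal.2 ?_
    rw [one_div, inv_mul_eq_div, one_le_div (by positivity)]
    gcongr
  · rw [Set.indicator_of_notMem (by exact hq)]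
    exact zero_le

/-- The first bound drops the indicator and uses Plancherel and Bessel for `u`. The second replaces
the indicator by `|p|²/R²`, which turns the tail into the norms of the partial derivatives of the
components, and then applies Bessel to `∂_j u`. -/
theorem tsum_tail_le {E : Type*} [NormedAddCommGroup E] [InnerProductSpace ℂ E]
    {ω : Momentum d → ℝ} (hω : Continuous ω)
    (hnn : ∀ k, 0 ≤ ω k) (hpos : ∀ᵐ k, 0 < ω k) {J : Set (Momentum d)} (hJ : J.Countable)
    (hJ0 : ∀ᵐ k : Momentum d, k ∉ J)
    (hωd : ∀ k ∉ J, DifferentiableAt ℝ ω k) {u : Momentum d → E}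
    (hud : ∀ k ∉ J, 0 < ω k → DifferentiableAt ℝ u k)
    (huc : d = 1 → ∀ k, 0 < ω k → ContinuousAt u k)
    (hu' : ∀ j, ∫⁻ k, ‖partialD j u k‖ₑ ^ 2 < ∞)
    (hωu : ∀ j, ∫⁻ k, ‖partialD j ω k / ω k‖ₑ ^ 2 * ‖u k‖ₑ ^ 2 < ∞)
    {ι : Type*} {L : ι → E →L[ℂ] ℂ} (hL : ∀ x, ∑' i, ‖L i x‖ₑ ^ 2 ≤ ‖x‖ₑ ^ 2)
    {W : ι → OneBoson d} (hW : ∀ i, W i =ᵐ[volume] fun k => L i (u k)) {R : ℝ} (hR : 0 < R) :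
    (∑' i, ∫⁻ q, {q | R < ‖(2 * Real.pi) • q‖}.indicator (fun _ => 1) q
        * ‖Lp.fourierTransformₗᵢ (Momentum d) ℂ (W i) q‖ₑ ^ 2 ≤ ∫⁻ k, ‖u k‖ₑ ^ 2) ∧
    (∑' i, ∫⁻ q, {q | R < ‖(2 * Real.pi) • q‖}.indicator (fun _ => 1) q
        * ‖Lp.fourierTransformₗᵢ (Momentum d) ℂ (W i) q‖ₑ ^ 2
      ≤ ENNReal.ofReal (1 / R ^ 2) * ∑ j, ∫⁻ k, ‖partialD j u k‖ₑ ^ 2) := by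
  have hWm : ∀ i, AEMeasurable (fun q => ‖Lp.fourierTransformₗᵢ (Momentum d) ℂ (W i) q‖ₑ ^ 2)
      volume := fun i => (Lp.aestronglyMeasurable _).enorm.pow_const 2
  constructor
  · calc _ ≤ ∑' i, ∫⁻ k, ‖W i k‖ₑ ^ 2 := by
          refine ENNReal.tsum_le_tsum fun i => ?_
          rw [← enorm_sq_eq_lintegral,
            ← LinearIsometryEquiv.enorm_map (Lp.fourierTransformₗᵢ (Momentum d) ℂ),
            enorm_sq_eq_lintegral]
          refine lintegral_mono fun q => mul_le_of_le_one_left' ?_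
          exact Set.indicator_le_self' (fun _ _ => zero_le) _
      _ = ∑' i, ∫⁻ k, ‖L i (u k)‖ₑ ^ 2 := by
          refine tsum_congr fun i => lintegral_congr_ae ?_
          filter_upwards [hW i] with k hk
          rw [hk]
      _ ≤ _ := by
          refine tsum_lintegral_le_of_bessel (fun i => ?_) (Eventually.of_forall fun k => hL _)
          exact (((Lp.aestronglyMeasurable (W i)).congr (hW i)).enorm.pow_const 2)
  · calc _ ≤ ∑' i, ∑ j, ENNReal.ofReal (1 / R ^ 2) *
            ∫⁻ q, ‖2 * Real.pi * q j‖ₑ ^ 2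
              * ‖Lp.fourierTransformₗᵢ (Momentum d) ℂ (W i) q‖ₑ ^ 2 := by
          refine ENNReal.tsum_le_tsum fun i => ?_
          rw [← Finset.mul_sum, ← lintegral_finsetSum', ← lintegral_const_mul']
          · refine lintegral_mono fun q => ?_
            simp only
            rw [← Finset.sum_mul, ← mul_assoc]
            exact mul_le_mul_left (indicator_le_sum_sq hR q) _
          · exact ENNReal.ofReal_ne_top
          · intro j _
            refine AEMeasurable.mul (Measurable.aemeasurable ?_) (hWm i)
            fun_prop
      _ = ENNReal.ofReal (1 / R ^ 2) * ∑ j, ∑' i,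
            ∫⁻ k, ‖partialD j (fun k => L i (u k)) k‖ₑ ^ 2 := by
          simp only [← Finset.mul_sum]
          rw [ENNReal.tsum_mul_left, Summable.tsum_finsetSum fun _ _ => ENNReal.summable]
          congr 1
          refine Finset.sum_congr rfl fun j _ => tsum_congr fun i => ?_
          exact lintegral_fourier_component hω hnn hpos hJ hωd hud huc j (hu' j) (hωu j) (L i)
            (hW i)
      _ ≤ _ := by
          gcongr with j
          refine tsum_lintegral_le_of_bessel
            (fun i => ((measurable_partialD j _).enorm.pow_const 2).aemeasurable) ?_
          filter_upwards [hJ0, hpos] with k h1 h2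
          simp only [(partialD_clm_comp (L _) (hud k h1 h2) j).2]
          exact hL _

/-- Both `c` and `X = (D/R⁴) c + (D/R²) S` dominate `a²`, so `a⁴ ≤ c X`; the factor `D ≥ 1` and the
term with `R⁴` are slack. For `R ≥ 1` one has `X ≤ D (c + S)/R²`, and subadditivity of the fourth
root gives the second bound. -/
theorem rpow_bounds {a c S D R : ℝ} (ha : 0 ≤ a) (hc : 0 ≤ c) (hS : 0 ≤ S) (hD : 1 ≤ D)
    (hR : 0 < R) (h1 : a ^ 2 ≤ c) (h2 : a ^ 2 ≤ 1 / R ^ 2 * S) :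
    a ^ 2 ≤ c ^ (1 / 2 : ℝ) * (D / R ^ 4 * c + D / R ^ 2 * S) ^ (1 / 2 : ℝ) ∧
    (1 ≤ R → a ≤ D ^ (1 / 4 : ℝ) * (c ^ (1 / 2 : ℝ) + c ^ (1 / 4 : ℝ) * S ^ (1 / 4 : ℝ))
      / Real.sqrt R) := by
  set X := D / R ^ 4 * c + D / R ^ 2 * S with hX
  have hX0 : 0 ≤ X := by positivity
  have h3 : a ^ 2 ≤ X := by
    refine h2.trans ?_
    have : 1 / R ^ 2 * S ≤ D / R ^ 2 * S := by gcongr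
    have : 0 ≤ D / R ^ 4 * c := by positivity
    linarith
  have hmain : a ^ 2 ≤ c ^ (1 / 2 : ℝ) * X ^ (1 / 2 : ℝ) := by
    rw [← Real.sqrt_eq_rpow, ← Real.sqrt_eq_rpow, ← Real.sqrt_mul hc]
    refine Real.le_sqrt_of_sq_le ?_
    rw [sq (a ^ 2)]
    exact mul_le_mul h1 h3 (by positivity) hc
  refine ⟨hmain, fun hR1 => ?_⟩
  have h4 : a ≤ c ^ (1 / 4 : ℝ) * X ^ (1 / 4 : ℝ) := by
    have h5 : a ^ 4 ≤ c * X := by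
      calc a ^ 4 = a ^ 2 * a ^ 2 := by ring
        _ ≤ c * X := mul_le_mul h1 h3 (by positivity) hc
    rw [← Real.mul_rpow hc hX0]
    calc a = (a ^ (4 : ℕ)) ^ (1 / 4 : ℝ) := by
          rw [← Real.rpow_natCast, ← Real.rpow_mul ha]; norm_num
      _ ≤ _ := by gcongr
  have h5 : X ≤ D * (c + S) / R ^ 2 := by
    have h6 : D / R ^ 4 * c ≤ D / R ^ 2 * c := by
      gcongr
      norm_num
    calc X ≤ D / R ^ 2 * c + D / R ^ 2 * S := by rw [hX]; gcongr
      _ = _ := by ring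
  have h6 : X ^ (1 / 4 : ℝ) ≤ D ^ (1 / 4 : ℝ) * (c ^ (1 / 4 : ℝ) + S ^ (1 / 4 : ℝ))
      / Real.sqrt R := by
    calc X ^ (1 / 4 : ℝ) ≤ (D * (c + S) / R ^ 2) ^ (1 / 4 : ℝ) := by gcongr
      _ = D ^ (1 / 4 : ℝ) * (c + S) ^ (1 / 4 : ℝ) / Real.sqrt R := by
          rw [Real.div_rpow (by positivity) (by positivity), Real.mul_rpow (by positivity)
            (by positivity), ← Real.rpow_natCast, ← Real.rpow_mul hR.le, Real.sqrt_eq_rpow]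
          norm_num
      _ ≤ _ := by
          gcongr
          exact Real.rpow_add_le_add_rpow hc hS (by norm_num) (by norm_num)
  have h7 : c ^ (1 / 2 : ℝ) = c ^ (1 / 4 : ℝ) * c ^ (1 / 4 : ℝ) := by
    rw [← Real.rpow_add_of_nonneg hc (by norm_num) (by norm_num)]
    norm_num
  calc a ≤ c ^ (1 / 4 : ℝ) * X ^ (1 / 4 : ℝ) := h4
    _ ≤ c ^ (1 / 4 : ℝ) * (D ^ (1 / 4 : ℝ) * (c ^ (1 / 4 : ℝ) + S ^ (1 / 4 : ℝ))
        / Real.sqrt R) := by gcongr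
    _ = _ := by rw [h7]; ring

end Estimate

/-! ### Momentum tails of the ground state. -/

section Ground

variable {d : ℕ} {𝒦 : Type*} [NormedAddCommGroup 𝒦] [InnerProductSpace ℂ 𝒦] [CompleteSpace 𝒦]
  {K : 𝒦 →ₗ.[ℂ] 𝒦} {ω : Momentum d → ℝ} {HI : StateSpace 𝒦 d →ₗ.[ℂ] StateSpace 𝒦 d}

/-- On a one-point space the infimum `0` would be the value of `ω`, contradicting positivity almost
everywhere. -/
theorem pos_of_isGLB_range (hω_inf : IsGLB (Set.range ω) 0) (hpos : ∀ᵐ k, 0 < ω k) : 0 < d := by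
  rcases Nat.eq_zero_or_pos d with rfl | h
  · obtain ⟨k, hk⟩ := hpos.exists
    have h1 : ω k ≤ 0 := hω_inf.2 (by
      rintro _ ⟨q, rfl⟩
      rw [Subsingleton.elim q k])
    exact absurd hk h1.not_gt
  · exact h

/-- The momentum tails of a ground state. -/
theorem norm_defect_ground_sq_le (hK : IsSelfAdjoint K) (hω : Continuous ω)
    (hnn : ∀ k, 0 ≤ ω k) (hpos : ∀ᵐ k, 0 < ω k) (hd : 0 < d) (hHI : IsSymmetricOp HI)
    (hH : IsSelfAdjoint (totalHamiltonian K ω HI))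
    (Ω : (totalHamiltonian K ω HI).domain) {E₀ : ℝ}
    (hE₀ : FormBound (totalHamiltonian K ω HI) E₀)
    (hΩ : totalHamiltonian K ω HI Ω = (E₀ : ℂ) • (Ω : StateSpace 𝒦 d))
    {g : Momentum d → StateSpace 𝒦 d}
    (hcomm : ∀ f : OneBoson d, MemLp (fun k => f k / (Real.sqrt (ω k) : ℂ)) 2 volume →
      ∀ Φ ∈ (totalHamiltonian K ω HI).domain,
      ∀ (hΦ : Φ ∈ HI†.domain ⊓ (oneTensor 𝒦 (annihilation f))†.domain)
        (hΨ : (Ω : StateSpace 𝒦 d) ∈ HI.domain ⊓ (oneTensor 𝒦 (annihilation f)).domain),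
        weakCommutator HI (oneTensor 𝒦 (annihilation f)) ⟨Φ, hΦ⟩ ⟨Ω, hΨ⟩
          = ∫ k, conj (f k) * inner ℂ Φ (g k))
    {J : Set (Momentum d)} (hJ : J.Countable) (hωd : ∀ k ∉ J, DifferentiableAt ℝ ω k)
    (hgd : ∀ k ∉ J, DifferentiableAt ℝ g k)
    (hgc : d = 1 → ∀ k, 0 < ω k → ContinuousAt g k)
    {c : ℝ} (hc0 : 0 ≤ c) (hc : ∫⁻ k, ENNReal.ofReal (1 / ω k ^ 2 * ‖g k‖ ^ 2) ≤ ENNReal.ofReal c)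
    {x y : Fin d → ℝ} (hx0 : ∀ j, 0 ≤ x j) (hy0 : ∀ j, 0 ≤ y j)
    (hx : ∀ j, ∫⁻ k, ENNReal.ofReal (|partialD j ω k| ^ 2 / ω k ^ 4 * ‖g k‖ ^ 2)
      ≤ ENNReal.ofReal (x j))
    (hy : ∀ j, ∫⁻ k, ENNReal.ofReal (1 / ω k ^ 2 * ‖partialD j g k‖ ^ 2) ≤ ENNReal.ofReal (y j))
    {χ : Momentum d → ℝ} (hχm : Measurable χ) (hχ0 : ∀ k, 0 ≤ χ k) (hχ1 : ∀ k, χ k ≤ 1)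
    (hχ : ∀ k, ‖k‖ ≤ 1 → χ k = 1) {R : ℝ} (hR : 0 < R) :
    ∃ h : (Ω : StateSpace 𝒦 d) ∈ (momentumCutoffDefect 𝒦 χ R).domain,
      ‖momentumCutoffDefect 𝒦 χ R ⟨Ω, h⟩‖ ^ 2 ≤ c ∧
      ‖momentumCutoffDefect 𝒦 χ R ⟨Ω, h⟩‖ ^ 2 ≤ 1 / R ^ 2 * ∑ j, 2 * (x j + y j) := by
  obtain ⟨w, b, -⟩ := exists_hilbertBasis ℂ 𝒦
  obtain ⟨w', e, -⟩ := exists_hilbertBasis ℂ (OneBoson d)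
  obtain ⟨r, hr1, hr2, hr3⟩ := exists_resolvent_family hH hE₀
  have hJ0 : ∀ᵐ k : Momentum d, k ∉ J := ae_notMem_of_countable ⟨0, hd⟩ hJ
  -- The candidate for `a(k)Ω` given by the pull-through formula.
  let u : Momentum d → StateSpace 𝒦 d := fun k => r (ω k) (g k)
  have hum : AEStronglyMeasurable u volume :=
    aestronglyMeasurable_resolvent_apply hr3 hω hpos hJ0 hJ.measurableSet
      fun k hk => (hgd k hk).continuousAt
  have hgm : AEStronglyMeasurable g volume := by
    have h1 : ContinuousOn g Jᶜ := fun k hk => (hgd k hk).continuousAt.continuousWithinAt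
    have h2 := h1.aestronglyMeasurable (μ := volume) hJ.measurableSet.compl
    rwa [Measure.restrict_eq_self_of_ae_mem (s := Jᶜ) hJ0] at h2
  have hu2 : ∫⁻ k, ‖u k‖ₑ ^ 2 ≤ ENNReal.ofReal c := by
    refine le_trans (lintegral_mono_ae ?_) hc
    filter_upwards [hpos] with k hk
    exact enorm_resolvent_apply_sq_le hr2 hk
  have hu : MemLp u 2 := memLp_two_of_lintegral hum (hu2.trans_lt ENNReal.ofReal_lt_top)
  -- Weak form of `(H - E₀ + ω(k)) u(k) = g(k)`, with `H` moved onto `Φ` by symmetry.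
  have hueq : ∀ᵐ k, ∀ Φ : (totalHamiltonian K ω HI).domain,
      inner ℂ (totalHamiltonian K ω HI Φ - (E₀ : ℂ) • (Φ : StateSpace 𝒦 d)) (u k)
        + (ω k : ℂ) * inner ℂ (Φ : StateSpace 𝒦 d) (u k)
        = inner ℂ (Φ : StateSpace 𝒦 d) (g k) := by
    filter_upwards [hpos] with k hk Φ
    obtain ⟨h1, h2⟩ := hr1 _ hk (g k)
    have h3 : inner ℂ (totalHamiltonian K ω HI Φ) (u k) = _ :=
      isSymmetricOp_of_isSelfAdjoint hH Φ ⟨u k, h1⟩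
    rw [inner_sub_left, inner_smul_left, Complex.conj_ofReal, h3]
    conv_rhs => rw [← h2]
    rw [inner_sub_right, inner_smul_right, Complex.ofReal_sub]
    simp only [u]
    ring
  have hW : ∀ β, oneBosonCoef b e (Ω : StateSpace 𝒦 d) β =ᵐ[volume] fun k => coefL b e β (u k) :=
    oneBosonCoef_ae_eq b e hω.measurable hpos hu fun ε l hε hεl f hf =>
      annihilation_ground_eq_integral hK hHI hH hω.measurable hnn hpos Ω hE₀ hΩ hcomm hu hueq
        hε hεl f hf
  have hu' : ∀ j, ∫⁻ k, ‖partialD j u k‖ₑ ^ 2 ≤ ENNReal.ofReal (2 * (x j + y j)) := by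
    intro j
    calc ∫⁻ k, ‖partialD j u k‖ₑ ^ 2
        ≤ ∫⁻ k, 2 * (ENNReal.ofReal (1 / ω k ^ 2 * ‖partialD j g k‖ ^ 2)
        + ENNReal.ofReal (|partialD j ω k| ^ 2 / ω k ^ 4 * ‖g k‖ ^ 2)) := by
          refine lintegral_mono_ae ?_
          filter_upwards [hpos, hJ0] with k h1 h2
          exact enorm_partialD_resolvent_apply_sq_le hr3 hr2 h1 (hωd k h2) (hgd k h2) j
      _ = 2 * ((∫⁻ k, ENNReal.ofReal (1 / ω k ^ 2 * ‖partialD j g k‖ ^ 2))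
          + ∫⁻ k, ENNReal.ofReal (|partialD j ω k| ^ 2 / ω k ^ 4 * ‖g k‖ ^ 2)) := by
          rw [lintegral_const_mul' _ _ (by simp), lintegral_add_right']
          refine AEMeasurable.ennreal_ofReal (AEMeasurable.mul (Measurable.aemeasurable ?_)
            (hgm.norm.aemeasurable.pow_const 2))
          exact ((measurable_partialD j ω).abs.pow_const 2).div (hω.measurable.pow_const 4)
      _ ≤ 2 * (ENNReal.ofReal (y j) + ENNReal.ofReal (x j)) := by
          gcongr
          · exact hy j
          · exact hx j
      _ = _ := by
          rw [← ENNReal.ofReal_add (hy0 j) (hx0 j), add_comm,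
            ENNReal.ofReal_mul (by norm_num), ENNReal.ofReal_ofNat]
  -- Since `‖u‖ ≤ ‖g‖/ω`, the integrand is at most `|∂_j ω|²/ω⁴ ‖g‖²`, which is the quantity already
  -- bounded by `x j`.
  have hωu : ∀ j, ∫⁻ k, ‖partialD j ω k / ω k‖ₑ ^ 2 * ‖u k‖ₑ ^ 2 < ∞ := by
    intro j
    refine lt_of_le_of_lt (le_trans (lintegral_mono_ae ?_) (hx j)) ENNReal.ofReal_lt_top
    filter_upwards [hpos] with k hk
    refine (mul_le_mul_right (enorm_resolvent_apply_sq_le hr2 hk) _).trans ?_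
    rw [← ofReal_norm, ← ENNReal.ofReal_pow (norm_nonneg _), ← ENNReal.ofReal_mul (by positivity)]
    refine ENNReal.ofReal_le_ofReal (le_of_eq ?_)
    rw [Real.norm_eq_abs, abs_div, abs_of_pos hk]
    field_simp
  have hm : Measurable fun k : Momentum d => χ (R⁻¹ • k) :=
    hχm.comp (measurable_const_smul R⁻¹)
  obtain ⟨h, hle⟩ := enorm_defect_sq_le b e hm (fun k => hχ0 _) (fun k => hχ1 _) (R := R)
    (fun k hk => hχ _ (by
      rw [norm_smul, norm_inv, Real.norm_of_nonneg hR.le, inv_mul_le_iff₀ hR, mul_one]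
      exact hk)) (Ω : StateSpace 𝒦 d)
  obtain ⟨t1, t2⟩ := tsum_tail_le hω hnn hpos hJ hJ0 hωd
    (fun k hk hk' => (hasFDerivAt_resolvent_apply hr3 hk' (hωd k hk) (hgd k hk)).1)
    (fun h1 k hk => continuousAt_resolvent_apply hr3 hω hk (hgc h1 k hk))
    (fun j => (hu' j).trans_lt ENNReal.ofReal_lt_top) hωu
    (fun z => (tsum_enorm_coefL_sq b e z).le) hW hR
  refine ⟨h, ?_, ?_⟩
  · have h1 := (hle.trans t1).trans hu2
    rwa [← ofReal_norm, ← ENNReal.ofReal_pow (norm_nonneg _),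
      ENNReal.ofReal_le_ofReal_iff hc0] at h1
  · have h2 : ∑ j, ∫⁻ k, ‖partialD j u k‖ₑ ^ 2 ≤ ENNReal.ofReal (∑ j, 2 * (x j + y j)) := by
      rw [ENNReal.ofReal_sum_of_nonneg fun j _ => by linarith [hx0 j, hy0 j]]
      exact Finset.sum_le_sum fun j _ => hu' j
    have h1 := (hle.trans t2).trans (mul_le_mul_right h2 _)
    have h3 : 0 ≤ ∑ j, 2 * (x j + y j) :=
      Finset.sum_nonneg fun j _ => by linarith [hx0 j, hy0 j]
    rwa [← ofReal_norm, ← ENNReal.ofReal_pow (norm_nonneg _),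
      ← ENNReal.ofReal_mul (by positivity),
      ENNReal.ofReal_le_ofReal_iff (by positivity)] at h1

end Ground

end BoseField

end

/-! ### Assembly of the constants. -/

open BoseField in
theorem proposition2p5 {d : ℕ} {𝒦 : Type*} [NormedAddCommGroup 𝒦] [InnerProductSpace ℂ 𝒦]
    [CompleteSpace 𝒦]
    -- the operator `K`
    (K : 𝒦 →ₗ.[ℂ] 𝒦) (hK : IsSelfAdjoint K) (hK_below : IsBoundedBelowOp K)
    -- the dispersion relation `ω`
    (ω : Momentum d → ℝ) (hω_cont : Continuous ω) (hω_inf : IsGLB (Set.range ω) 0)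
    (hω_lim : Tendsto ω (cocompact (Momentum d)) atTop) (hω_pos : ∀ᵐ k, 0 < ω k)
    -- the interaction and the total Hamiltonian
    (HI : StateSpace 𝒦 d →ₗ.[ℂ] StateSpace 𝒦 d) (hHI : IsSymmetricOp HI)
    (hH : IsSelfAdjoint (totalHamiltonian K ω HI))
    (hH_below : IsBoundedBelowOp (totalHamiltonian K ω HI))
    -- the commutator of the interaction with the annihilation operators
    (G : Momentum d → (StateSpace 𝒦 d →L[ℂ] StateSpace 𝒦 d))
    (hG_comm : ∀ f : OneBoson d, MemLp (fun k => f k / (Real.sqrt (ω k) : ℂ)) 2 volume →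
      ∀ Φ ∈ (totalHamiltonian K ω HI).domain, ∀ Ψ ∈ (totalHamiltonian K ω HI).domain,
      ∀ (hΦ : Φ ∈ HI†.domain ⊓ (oneTensor 𝒦 (annihilation f))†.domain)
        (hΨ : Ψ ∈ HI.domain ⊓ (oneTensor 𝒦 (annihilation f)).domain),
        weakCommutator HI (oneTensor 𝒦 (annihilation f)) ⟨Φ, hΦ⟩ ⟨Ψ, hΨ⟩
          = ∫ k, conj (f k) * inner ℂ Φ (G k Ψ))
    (ζ τ : Fin 2 → ℝ) (hζ : ∀ l, 0 ≤ ζ l) (hτ : ∀ l, 0 ≤ τ l)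
    (hG_bound : ∀ (l : Fin 2) (Ψ : (totalHamiltonian K ω HI).domain),
      ∫⁻ k, ENNReal.ofReal (1 / ω k ^ (2 * (l : ℕ)) * ‖G k Ψ‖ ^ 2)
        ≤ ENNReal.ofReal (ζ l * ‖totalHamiltonian K ω HI Ψ‖ ^ 2
          + τ l * ‖(Ψ : StateSpace 𝒦 d)‖ ^ 2))
    -- regularity of `ω`
    (I₀ : Set (Momentum d)) (hI₀ : I₀.Countable)
    (hω_diff : ∀ k ∉ I₀, DifferentiableAt ℝ ω k) (hω_C1 : ContinuousOn (fderiv ℝ ω) I₀ᶜ)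
    (hω_deriv_bdd : ∀ j, ∃ C : ℝ, ∀ k ∉ I₀, |partialD j ω k| ≤ C)
    (μ₀ ν₀ : ℝ) (hμ₀ : 0 ≤ μ₀) (hν₀ : 0 ≤ ν₀)
    (hω_deriv_bound : ∀ (j : Fin d) (Ψ : (totalHamiltonian K ω HI).domain),
      ∫⁻ k, ENNReal.ofReal (|partialD j ω k| ^ 2 / ω k ^ 4 * ‖G k Ψ‖ ^ 2)
        ≤ ENNReal.ofReal (μ₀ * ‖totalHamiltonian K ω HI Ψ‖ ^ 2
          + ν₀ * ‖(Ψ : StateSpace 𝒦 d)‖ ^ 2))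
    -- regularity of `G`
    (J₀ : Set (Momentum d)) (hJ₀ : J₀.Countable)
    (hG_diff : ∀ Ψ : StateSpace 𝒦 d, ∀ k ∉ J₀, DifferentiableAt ℝ (fun q => G q Ψ) k)
    (hG_cont : d = 1 → ∀ Ψ : StateSpace 𝒦 d, ∀ k ∈ J₀, 0 < ω k →
      ContinuousAt (fun q => G q Ψ) k)
    (μ ν : Fin d → ℝ) (hμ : ∀ j, 0 ≤ μ j) (hν : ∀ j, 0 ≤ ν j)
    (hG_deriv_bound : ∀ (j : Fin d) (Ψ : (totalHamiltonian K ω HI).domain),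
      ∫⁻ k, ENNReal.ofReal (1 / ω k ^ 2 * ‖partialD j (fun q => G q Ψ) k‖ ^ 2)
        ≤ ENNReal.ofReal (μ j * ‖totalHamiltonian K ω HI Ψ‖ ^ 2
          + ν j * ‖(Ψ : StateSpace 𝒦 d)‖ ^ 2))
    -- the ground state
    (Ω : (totalHamiltonian K ω HI).domain)
    (hΩ : totalHamiltonian K ω HI Ω
      = (groundEnergy (totalHamiltonian K ω HI) : ℂ) • (Ω : StateSpace 𝒦 d))
    (hΩ_norm : ‖(Ω : StateSpace 𝒦 d)‖ = 1)
    -- the cutoff function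
    (χ : Momentum d → ℝ) (hχ_smooth : ContDiff ℝ ((⊤ : ℕ∞) : WithTop ℕ∞) χ) (hχ_supp : HasCompactSupport χ)
    (hχ_nonneg : ∀ k, 0 ≤ χ k) (hχ_le : ∀ k, χ k ≤ 1) (hχ_one : ∀ k, ‖k‖ ≤ 1 → χ k = 1)
    -- the constants
    (c₁ c₂ : ℝ) (ξ : Fin d → ℝ)
    (hc₁ : c₁ = groundEnergy (totalHamiltonian K ω HI) ^ 2 * ζ 1 + τ 1)
    (hξ : ∀ j, ξ j
      = 2 * ((μ₀ + μ j) * groundEnergy (totalHamiltonian K ω HI) ^ 2 + ν₀ + ν j))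
    (hc₂ : c₂ = ((d : ℝ) + 1) ^ (1 / 4 : ℝ)
      * (c₁ ^ (1 / 2 : ℝ) + c₁ ^ (1 / 4 : ℝ) * (∑ j, ξ j) ^ (1 / 4 : ℝ))) :
    (∀ R : ℝ, 0 < R →
      ∃ h : (Ω : StateSpace 𝒦 d) ∈ (momentumCutoffDefect 𝒦 χ R).domain,
        ‖momentumCutoffDefect 𝒦 χ R ⟨Ω, h⟩‖ ^ 2
          ≤ c₁ ^ (1 / 2 : ℝ) * (((d : ℝ) + 1) / R ^ 4 * c₁
            + ((d : ℝ) + 1) / R ^ 2 * ∑ j, ξ j) ^ (1 / 2 : ℝ)) ∧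
    (∀ R : ℝ, 1 ≤ R →
      ∃ h : (Ω : StateSpace 𝒦 d) ∈ (momentumCutoffDefect 𝒦 χ R).domain,
        ‖momentumCutoffDefect 𝒦 χ R ⟨Ω, h⟩‖ ≤ c₂ / Real.sqrt R) := by
  have hnn : ∀ k, 0 ≤ ω k := fun k => hω_inf.1 ⟨k, rfl⟩
  have hd := pos_of_isGLB_range hω_inf hω_pos
  set E₀ := groundEnergy (totalHamiltonian K ω HI) with hE₀
  have hform : FormBound (totalHamiltonian K ω HI) E₀ :=
    formBound_groundEnergy hH hH_below ⟨Ω, hΩ_norm⟩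
  have hTΩ : ‖totalHamiltonian K ω HI Ω‖ ^ 2 = E₀ ^ 2 := by
    rw [hΩ, norm_smul, hΩ_norm, mul_one, Complex.norm_real, Real.norm_eq_abs, sq_abs]
  have hval : ∀ s t : ℝ, s * ‖totalHamiltonian K ω HI Ω‖ ^ 2 + t * ‖(Ω : StateSpace 𝒦 d)‖ ^ 2
      = s * E₀ ^ 2 + t := fun s t => by rw [hTΩ, hΩ_norm, one_pow, mul_one]
  have hc0 : 0 ≤ c₁ := by
    rw [hc₁]
    have := hζ 1
    have := hτ 1
    positivity
  have hx0 : 0 ≤ μ₀ * E₀ ^ 2 + ν₀ := by positivity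
  have hy0 : ∀ j, 0 ≤ μ j * E₀ ^ 2 + ν j := fun j => by
    have := hμ j
    have := hν j
    positivity
  -- Separates the contribution of `∂_j ω` from that of `∂_j G`, each evaluated on `Ω` with `‖HΩ‖² =
  -- E₀²`.
  have hξ' : ∀ j, ξ j = 2 * ((μ₀ * E₀ ^ 2 + ν₀) + (μ j * E₀ ^ 2 + ν j)) := fun j => by
    rw [hξ]; ring
  have hξ0 : 0 ≤ ∑ j, ξ j := Finset.sum_nonneg fun j _ => by
    rw [hξ']
    linarith [hy0 j]
  have key : ∀ R : ℝ, 0 < R → ∃ h : (Ω : StateSpace 𝒦 d) ∈ (momentumCutoffDefect 𝒦 χ R).domain,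
      ‖momentumCutoffDefect 𝒦 χ R ⟨Ω, h⟩‖ ^ 2 ≤ c₁ ∧
      ‖momentumCutoffDefect 𝒦 χ R ⟨Ω, h⟩‖ ^ 2 ≤ 1 / R ^ 2 * ∑ j, ξ j := by
    intro R hR
    simp only [hξ']
    -- The exceptional set is `I₀ ∪ J₀`. For `d = 1`, continuity of `k ↦ G(k)Ω` where `ω > 0` is a
    -- hypothesis on `J₀` and follows from differentiability elsewhere.
    refine norm_defect_ground_sq_le hK hω_cont hnn hω_pos hd hHI hH Ω hform hΩ
      (g := fun k => G k Ω) (fun f hf Φ hΦ => hG_comm f hf Φ hΦ Ω Ω.2) (hI₀.union hJ₀)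
      (fun k hk => hω_diff k fun h => hk (Or.inl h))
      (fun k hk => hG_diff Ω k fun h => hk (Or.inr h)) (fun h1 k hk => ?_) hc0 ?_
      (fun _ => hx0) hy0 (fun j => ?_) (fun j => ?_) hχ_smooth.continuous.measurable hχ_nonneg
      hχ_le hχ_one hR
    · by_cases hkJ : k ∈ J₀
      · exact hG_cont h1 Ω k hkJ hk
      · exact (hG_diff Ω k hkJ).continuousAt
    · have := hG_bound 1 Ω
      rw [hval, mul_comm (ζ 1), ← hc₁] at this
      exact this
    · rw [← hval]
      exact hω_deriv_bound j Ω
    · rw [← hval]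
      exact hG_deriv_bound j Ω
  have hD : (1 : ℝ) ≤ (d : ℝ) + 1 := by linarith [(Nat.cast_nonneg d : (0 : ℝ) ≤ d)]
  constructor
  · intro R hR
    obtain ⟨h, h1, h2⟩ := key R hR
    exact ⟨h, (rpow_bounds (norm_nonneg _) hc0 hξ0 hD hR h1 h2).1⟩
  · intro R hR
    obtain ⟨h, h1, h2⟩ := key R (by linarith)
    refine ⟨h, ?_⟩
    rw [hc₂]
    exact (rpow_bounds (norm_nonneg _) hc0 hξ0 hD (by linarith) h1 h2).2 hR
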